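/- **Setting.** Let $d\ge 1$, let $\mathcal K$ be a finite-dimensional complex Hilbert space and $K$ a self-adjoint operator on $\mathcal K$ with eigenvalues $k_0<k_1<\dots<k_n$. Let $\mathfrak h=L^2(\mathbb R^d,dk)$, let $\omega$ be multiplication by $\omega(k)=|k|$, let $\Gamma(\mathfrak h)$ be the bosonic Fock space with vacuum $\Omega$ and number operator $N$, and let $\mathcal H=\mathcal K\otimes\Gamma(\mathfrak h)$. For a form factor $\alpha\in\mathcal B(\mathcal K,\mathcal K\otimes\mathfrak h)$ let $a(\alpha)$ be the annihilation operator, which maps $\psi_{n+1}\in\mathcal K\otimes\Gamma_{n+1}(\mathfrak h)$ to $\sqrt{n+1}\,\alpha^*$ applied in one boson variable of $\psi_{n+1}$, let $a^*(\alpha)$ be its adjoint, and let $\phi(\alpha)$ be the closure of $2^{-1/2}(a(\alpha)+a^*(\alpha))$ defined on the domain $\mathcal D(N^{1/2})$. Put $$H_0=K\otimes 1+1\otimes \mathrm d\Gamma(\omega),\qquad H_\lambda=H_0+\lambda\phi(\alpha)\quad(\lambda\in\mathbb R).$$ Use polar coordinates $(Tu)(r,\theta)=r^{(d-1)/2}u(r\theta)$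 to identify $\mathfrak h$ with $L^2(\mathbb R^+,dr)\otimes L^2(S^{d-1},d\theta)$, write $\partial_r$ for $\partial_r\otimes 1$, and let $\dot{\mathcal H}^1(\mathbb R^+)$ be the completion of $C_c^\infty((0,\infty))$ in the norm $\|\cdot\|_2+\|\partial_r\cdot\|_2$. **Hypotheses on $\alpha$.** - (I0) $(1\otimes\omega^{-1/2})\alpha\in\mathcal B(\mathcal K,\mathcal K\otimes\mathfrak h)$. - (I1a) $\alpha\in\mathcal B\big(\mathcal K,\mathcal K\otimes\dot{\mathcal H}^1(\mathbb R^+)\otimes L^2(S^{d-1})\big)$ and $(1\otimes\omega^{-1/2})\,\partial_r\alpha\in\mathcal B(\mathcal K,\mathcal K\otimes\mathfrak h)$. - (I1b) $(1\otimes\omega^{-a})\alpha\in\mathcal B(\mathcal K,\mathcal K\otimes\mathfrak h)$ for some $a>1$. - Fermi golden rule at $k_{i_0}$: with $P=P_{k_{i_0}}\otimes P_\Omega$, where $P_{k_{i_0}}$ is the projection onto the eigenspace of $K$ and $P_\Omega$ the projection onto $\mathbb C\Omega$, and $\overline P=1-P$, the weak limit $$\operatorname*{w-lim}_{\varepsilon\to0^+}P\phi(\alpha)\overline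 P\,\operatorname{Im}\big((H_0-k_{i_0}-i\varepsilon)^{-1}\big)\,\overline P\phi(\alpha)P$$ exists and is strictly positive (positive definite) on $P\mathcal H$. Here $\operatorname{Im}A=(A-A^*)/(2i)$, so $\operatorname{Im}\big((H_0-k_{i_0}-i\varepsilon)^{-1}\big)=\varepsilon\big((H_0-k_{i_0})^2+\varepsilon^2\big)^{-1}$. **Theorem 1.1.** Let $i_0>0$ and let $\mathcal I\subset\mathbb R$ be an open interval (bounded or not) that contains $k_{i_0}$ and whose closure contains no other eigenvalue of $K$. Assume the Fermi golden rule at $k_{i_0}$, (I0), (I1a) and (I1b). Then there is $\lambda_0>0$ such that $H_\lambda$ has no eigenvalue in $\mathcal I$ for all real $\lambda$ with $0<|\lambda|<\lambda_0$. -/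

import Mathlib

open MeasureTheory Filter Topology
open scoped ENNReal InnerProductSpace ContDiff ComplexStarModule

noncomputable section

namespace PauliFierz

/-- Momentum space `ℝ^d` with the Euclidean norm. -/
abbrev Mom (d : ℕ) : Type := EuclideanSpace ℝ (Fin d)

/-- `𝒦 ⊗ L²(ℝ^d)`, realised as `L²(ℝ^d; 𝒦)`. -/
abbrev OneBoson (𝒦 : Type*) [NormedAddCommGroup 𝒦] (d : ℕ) : Type _ :=
  Lp 𝒦 2 (volume : Measure (Mom d))

/-- `𝒦 ⊗ L²(ℝ^d)^{⊗ n}`, realised as `L²((ℝ^d)^n; 𝒦)`. -/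
abbrev NBoson (𝒦 : Type*) [NormedAddCommGroup 𝒦] (d n : ℕ) : Type _ :=
  Lp 𝒦 2 (volume : Measure (Fin n → Mom d))

section Permutations

/-- Permuting the momenta preserves Lebesgue measure. -/
theorem measurePreserving_perm {d n : ℕ} (σ : Equiv.Perm (Fin n)) :
    MeasurePreserving (fun k : Fin n → Mom d => k ∘ σ) volume volume := by
  have h := volume_measurePreserving_piCongrLeft (fun _ : Fin n => Mom d) σ.symm
  have h' : (fun k : Fin n → Mom d => k ∘ σ) =
      MeasurableEquiv.piCongrLeft (fun _ : Fin n => Mom d) σ.symm := by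
    funext k j
    have := Equiv.piCongrLeft_apply_apply (P := fun _ : Fin n => Mom d) (e := σ.symm) k (σ j)
    simp only [Equiv.symm_apply_apply] at this
    simpa [MeasurableEquiv.coe_piCongrLeft] using this.symm
  rw [h']
  exact h

/-- The action of a permutation on `n`-boson wave functions. -/
def permute (𝒦 : Type*) [NormedAddCommGroup 𝒦] [InnerProductSpace ℂ 𝒦] (d n : ℕ)
    (σ : Equiv.Perm (Fin n)) : NBoson 𝒦 d n →ₗᵢ[ℂ] NBoson 𝒦 d n :=
  Lp.compMeasurePreservingₗᵢ ℂ (fun k : Fin n → Mom d => k ∘ σ) (measurePreserving_perm σ)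

end Permutations

/-- `𝒦 ⊗ Γ_n(L²(ℝ^d))`: the `𝒦`-valued square integrable functions of `n` momenta that are
invariant under permutations of the momenta. -/
def sector (𝒦 : Type*) [NormedAddCommGroup 𝒦] [InnerProductSpace ℂ 𝒦] (d n : ℕ) :
    Submodule ℂ (NBoson 𝒦 d n) where
  carrier := {f | ∀ σ : Equiv.Perm (Fin n), permute 𝒦 d n σ f = f}
  add_mem' := fun {f g} hf hg σ => by rw [map_add, hf σ, hg σ]
  zero_mem' := fun σ => map_zero _
  smul_mem' := fun c f hf σ => by rw [map_smul, hf σ]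

/-- The Hilbert space `ℋ = 𝒦 ⊗ Γ(L²(ℝ^d)) = ⨁_n 𝒦 ⊗ Γ_n(L²(ℝ^d))` (Hilbert sum). -/
abbrev FockSpace (𝒦 : Type*) [NormedAddCommGroup 𝒦] [InnerProductSpace ℂ 𝒦] (d : ℕ) : Type _ :=
  lp (fun n : ℕ => sector 𝒦 d n) 2

instance instCompleteSector (𝒦 : Type*) [NormedAddCommGroup 𝒦] [InnerProductSpace ℂ 𝒦]
    [FiniteDimensional ℂ 𝒦] (d n : ℕ) : CompleteSpace (sector 𝒦 d n) := by
  have : CompleteSpace 𝒦 := FiniteDimensional.complete ℂ 𝒦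
  have h : IsClosed (sector 𝒦 d n : Set (NBoson 𝒦 d n)) := by
    have : (sector 𝒦 d n : Set (NBoson 𝒦 d n)) =
        ⋂ σ : Equiv.Perm (Fin n), {f | permute 𝒦 d n σ f = f} := by
      ext f; simp [sector]
    rw [this]
    exact isClosed_iInter fun σ => isClosed_eq (permute 𝒦 d n σ).continuous continuous_id
  exact h.completeSpace_coe

section Operators

variable {𝒦 : Type*} [NormedAddCommGroup 𝒦] [InnerProductSpace ℂ 𝒦] {d : ℕ}

/-- The `n`-boson wave function of a vector of `ℋ`. -/
def wave (ψ : FockSpace 𝒦 d) (n : ℕ) : (Fin n → Mom d) → 𝒦 :=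
  ⇑(ψ n : NBoson 𝒦 d n)

theorem wave_add (ψ χ : FockSpace 𝒦 d) (n : ℕ) :
    wave (ψ + χ) n =ᵐ[volume] wave ψ n + wave χ n :=
  Lp.coeFn_add (ψ n : NBoson 𝒦 d n) (χ n : NBoson 𝒦 d n)

theorem wave_smul (c : ℂ) (ψ : FockSpace 𝒦 d) (n : ℕ) :
    wave (c • ψ) n =ᵐ[volume] c • wave ψ n :=
  Lp.coeFn_smul c (ψ n : NBoson 𝒦 d n)

theorem wave_zero (n : ℕ) : wave (0 : FockSpace 𝒦 d) n =ᵐ[volume] 0 :=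
  Lp.coeFn_zero 𝒦 2 (volume : Measure (Fin n → Mom d))

theorem memLp_wave (ψ : FockSpace 𝒦 d) (n : ℕ) : MemLp (wave ψ n) 2 volume :=
  Lp.memLp _

theorem ext_wave {ψ χ : FockSpace 𝒦 d} (h : ∀ n, wave ψ n =ᵐ[volume] wave χ n) : ψ = χ := by
  apply lp.ext
  funext n
  exact Subtype.ext (Lp.ext (h n))

/-- The graph of the operator that multiplies the `n`-boson wave function by the matrix valued
function `M n`, on its maximal domain. -/
def multiplicationGraph (M : ∀ n : ℕ, (Fin n → Mom d) → (𝒦 →ₗ[ℂ] 𝒦)) :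
    Submodule ℂ (FockSpace 𝒦 d × FockSpace 𝒦 d) where
  carrier := {x | ∀ n, ∀ᵐ k, wave x.2 n k = M n k (wave x.1 n k)}
  add_mem' := fun {x y} hx hy n => by
    filter_upwards [hx n, hy n, wave_add x.1 y.1 n, wave_add x.2 y.2 n] with k h1 h2 h3 h4
    simp only [Prod.fst_add, Prod.snd_add, h3, h4, Pi.add_apply, map_add, h1, h2]
  zero_mem' := fun n => by
    filter_upwards [wave_zero (𝒦 := 𝒦) (d := d) n] with k h1
    simp only [Prod.fst_zero, Prod.snd_zero, h1, Pi.zero_apply, map_zero]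
  smul_mem' := fun c x hx n => by
    filter_upwards [hx n, wave_smul c x.1 n, wave_smul c x.2 n] with k h1 h2 h3
    simp only [Prod.smul_fst, Prod.smul_snd, h2, h3, Pi.smul_apply, map_smul, h1]

/-- The operator of multiplication by the matrix valued functions `M n`, on its maximal domain. -/
def multiplication (M : ∀ n : ℕ, (Fin n → Mom d) → (𝒦 →ₗ[ℂ] 𝒦)) :
    FockSpace 𝒦 d →ₗ.[ℂ] FockSpace 𝒦 d :=
  (multiplicationGraph M).toLinearPMap

theorem multiplication_graph (M : ∀ n : ℕ, (Fin n → Mom d) → (𝒦 →ₗ[ℂ] 𝒦)) :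
    (multiplication M).graph = multiplicationGraph M := by
  refine Submodule.toLinearPMap_graph_eq _ fun x hx hx0 => ext_wave fun n => ?_
  filter_upwards [hx n, wave_zero (𝒦 := 𝒦) (d := d) n] with k h1 h2
  rw [h1, hx0, h2]
  simp

/-- `K ⊗ 1`. -/
def atomHamiltonian (d : ℕ) (K : 𝒦 →ₗ[ℂ] 𝒦) : FockSpace 𝒦 d →ₗ.[ℂ] FockSpace 𝒦 d :=
  multiplication fun _ _ => K

/-- `1 ⊗ dΓ(ω)` with `ω(k) = |k|`: multiplication by `|k₁| + ⋯ + |k_n|` on the `n`-boson sector. -/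
def fieldEnergy (𝒦 : Type*) [NormedAddCommGroup 𝒦] [InnerProductSpace ℂ 𝒦] (d : ℕ) :
    FockSpace 𝒦 d →ₗ.[ℂ] FockSpace 𝒦 d :=
  multiplication fun _ k => ((∑ j, ‖k j‖ : ℝ) : ℂ) • LinearMap.id

/-- The free Hamiltonian `H₀ = K ⊗ 1 + 1 ⊗ dΓ(ω)`. -/
def freeHamiltonian (d : ℕ) (K : 𝒦 →ₗ[ℂ] 𝒦) : FockSpace 𝒦 d →ₗ.[ℂ] FockSpace 𝒦 d :=
  atomHamiltonian d K + fieldEnergy 𝒦 d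

variable [FiniteDimensional ℂ 𝒦]

/-- The annihilation operator on `(n+1)`-boson wave functions:
`(a(α)ψ)(k₁,…,k_n) = √(n+1) α^*(ψ(·, k₁, …, k_n))`,
with `α^* f = ∑ i, ⟨α e_i, f⟩ e_i` for an orthonormal basis `(e_i)` of `𝒦`. -/
def annihilate (α : 𝒦 →L[ℂ] OneBoson 𝒦 d) {n : ℕ} (f : (Fin (n + 1) → Mom d) → 𝒦) :
    (Fin n → Mom d) → 𝒦 := fun k =>
  ((√(n + 1) : ℝ) : ℂ) • ∑ i,
    (∫ q, ⟪α (stdOrthonormalBasis ℂ 𝒦 i) q, f (Fin.cons q k)⟫_ℂ) • stdOrthonormalBasis ℂ 𝒦 i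

/-- The creation operator on `n`-boson wave functions (the adjoint of the annihilation operator):
`(a^*(α)ψ)(k₀,…,k_n) = (n+1)^{-1/2} ∑_j (α ψ(k₀,…,k̂_j,…,k_n))(k_j)`,
with `(α x)(q) = ∑ i, ⟨e_i, x⟩ (α e_i)(q)`. -/
def create (α : 𝒦 →L[ℂ] OneBoson 𝒦 d) {n : ℕ} (f : (Fin n → Mom d) → 𝒦) :
    (Fin (n + 1) → Mom d) → 𝒦 := fun k =>
  (((√(n + 1))⁻¹ : ℝ) : ℂ) • ∑ j, ∑ i,
    ⟪stdOrthonormalBasis ℂ 𝒦 i, f (j.removeNth k)⟫_ℂ • α (stdOrthonormalBasis ℂ 𝒦 i) (k j)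

/-- The `n`-boson wave function of `2^{-1/2} (a(α) + a^*(α)) ψ`. -/
def fieldWave (α : 𝒦 →L[ℂ] OneBoson 𝒦 d) (ψ : FockSpace 𝒦 d) :
    ∀ n : ℕ, (Fin n → Mom d) → 𝒦
  | 0 => (((√2)⁻¹ : ℝ) : ℂ) • annihilate α (wave ψ 1)
  | n + 1 => (((√2)⁻¹ : ℝ) : ℂ) • (annihilate α (wave ψ (n + 2)) + create α (wave ψ n))

/-- If a property holds for almost all `(n+1)`-tuples, it holds for almost all slices. -/
theorem ae_slice {n : ℕ} {p : (Fin (n + 1) → Mom d) → Prop} (h : ∀ᵐ k, p k) :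
    ∀ᵐ k : Fin n → Mom d, ∀ᵐ q : Mom d, p (Fin.cons q k) := by
  have h1 := ((volume_preserving_piFinSuccAbove (fun _ : Fin (n + 1) => Mom d) 0).symm.comp
    (Measure.measurePreserving_swap (μ := (volume : Measure (Fin n → Mom d)))
      (ν := (volume : Measure (Mom d))))).quasiMeasurePreserving.ae h
  have h2 := Measure.ae_ae_of_ae_prod h1
  filter_upwards [h2] with k hk
  filter_upwards [hk] with q hq
  simpa [MeasurableEquiv.piFinSuccAbove_symm_apply, Fin.insertNthEquiv] using hq

/-- Almost all slices of a square integrable function are square integrable. -/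
theorem memLp_slice {n : ℕ} {f : (Fin (n + 1) → Mom d) → 𝒦} (hf : MemLp f 2 volume) :
    ∀ᵐ k : Fin n → Mom d, MemLp (fun q : Mom d => f (Fin.cons q k)) 2 volume := by
  have h1 := hf.comp_measurePreserving
    ((volume_preserving_piFinSuccAbove (fun _ : Fin (n + 1) => Mom d) 0).symm.comp
    (Measure.measurePreserving_swap (μ := (volume : Measure (Fin n → Mom d)))
      (ν := (volume : Measure (Mom d)))))
  have h2 := h1.integrable_norm_pow (by norm_num)
  have h3 := h2.prod_right_ae
  have h4 := h1.aestronglyMeasurable.prodMk_left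
  filter_upwards [h3, h4] with k hk hk'
  have h5 := (memLp_two_iff_integrable_sq_norm hk').2 (by simpa using hk)
  simpa [MeasurableEquiv.piFinSuccAbove_symm_apply, Fin.insertNthEquiv, Function.comp_def] using h5

theorem integrable_slice {n : ℕ} {f : (Fin (n + 1) → Mom d) → 𝒦} (hf : MemLp f 2 volume)
    (g : OneBoson 𝒦 d) :
    ∀ᵐ k : Fin n → Mom d, Integrable (fun q : Mom d => ⟪g q, f (Fin.cons q k)⟫_ℂ) := by
  filter_upwards [memLp_slice hf] with k hk
  refine (L2.integrable_inner (𝕜 := ℂ) g hk.toLp).congr ?_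
  filter_upwards [hk.coeFn_toLp] with q hq
  rw [hq]

theorem annihilate_congr (α : 𝒦 →L[ℂ] OneBoson 𝒦 d) {n : ℕ}
    {f g : (Fin (n + 1) → Mom d) → 𝒦} (h : f =ᵐ[volume] g) :
    annihilate α f =ᵐ[volume] annihilate α g := by
  filter_upwards [ae_slice h] with k hk
  simp only [annihilate]
  congr 1
  refine Finset.sum_congr rfl fun i _ => ?_
  congr 1
  refine integral_congr_ae ?_
  filter_upwards [hk] with q hq
  rw [hq]

theorem annihilate_add (α : 𝒦 →L[ℂ] OneBoson 𝒦 d) {n : ℕ}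
    {f g : (Fin (n + 1) → Mom d) → 𝒦} (hf : MemLp f 2 volume) (hg : MemLp g 2 volume) :
    annihilate α (f + g) =ᵐ[volume] annihilate α f + annihilate α g := by
  have h1 := ae_all_iff.2 fun i => integrable_slice hf (α (stdOrthonormalBasis ℂ 𝒦 i))
  have h2 := ae_all_iff.2 fun i => integrable_slice hg (α (stdOrthonormalBasis ℂ 𝒦 i))
  filter_upwards [h1, h2] with k hk1 hk2
  simp only [annihilate, Pi.add_apply, inner_add_right, ← smul_add, ← Finset.sum_add_distrib]
  congr 1
  refine Finset.sum_congr rfl fun i _ => ?_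
  rw [integral_add (hk1 i) (hk2 i), add_smul]

theorem annihilate_smul (α : 𝒦 →L[ℂ] OneBoson 𝒦 d) {n : ℕ} (c : ℂ)
    (f : (Fin (n + 1) → Mom d) → 𝒦) : annihilate α (c • f) = c • annihilate α f := by
  funext k
  simp only [annihilate, Pi.smul_apply, inner_smul_right, integral_const_mul, mul_smul,
    ← Finset.smul_sum]
  rw [smul_comm]

theorem create_congr (α : 𝒦 →L[ℂ] OneBoson 𝒦 d) {n : ℕ}
    {f g : (Fin n → Mom d) → 𝒦} (h : f =ᵐ[volume] g) :
    create α f =ᵐ[volume] create α g := by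
  have h1 : ∀ j : Fin (n + 1), ∀ᵐ k : Fin (n + 1) → Mom d,
      f (j.removeNth k) = g (j.removeNth k) := fun j => by
    have h2 := (Measure.quasiMeasurePreserving_snd.comp (volume_preserving_piFinSuccAbove
      (fun _ : Fin (n + 1) => Mom d) j).quasiMeasurePreserving).ae h
    filter_upwards [h2] with k hk
    exact hk
  filter_upwards [ae_all_iff.2 h1] with k hk
  simp only [create, hk]

theorem create_add (α : 𝒦 →L[ℂ] OneBoson 𝒦 d) {n : ℕ} (f g : (Fin n → Mom d) → 𝒦) :
    create α (f + g) = create α f + create α g := by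
  funext k
  simp only [create, Pi.add_apply, inner_add_right, add_smul, Finset.sum_add_distrib, smul_add]

theorem create_smul (α : 𝒦 →L[ℂ] OneBoson 𝒦 d) {n : ℕ} (c : ℂ) (f : (Fin n → Mom d) → 𝒦) :
    create α (c • f) = c • create α f := by
  funext k
  simp only [create, Pi.smul_apply, inner_smul_right, mul_smul, ← Finset.smul_sum]
  rw [smul_comm]

theorem fieldWave_add (α : 𝒦 →L[ℂ] OneBoson 𝒦 d) (ψ χ : FockSpace 𝒦 d) (n : ℕ) :
    fieldWave α (ψ + χ) n =ᵐ[volume] fieldWave α ψ n + fieldWave α χ n := by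
  have ha : ∀ m, annihilate α (wave (ψ + χ) (m + 1)) =ᵐ[volume]
      annihilate α (wave ψ (m + 1)) + annihilate α (wave χ (m + 1)) := fun m =>
    (annihilate_congr α (wave_add ψ χ (m + 1))).trans
      (annihilate_add α (memLp_wave ψ _) (memLp_wave χ _))
  cases n with
  | zero =>
    filter_upwards [ha 0] with k hk
    simp only [fieldWave, Pi.smul_apply, Pi.add_apply] at hk ⊢
    rw [hk, smul_add]
  | succ n =>
    filter_upwards [ha (n + 1), create_congr α (wave_add ψ χ n)] with k hk hk'
    simp only [fieldWave, Pi.smul_apply, Pi.add_apply, create_add] at hk hk' ⊢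
    rw [hk, hk', ← smul_add]
    congr 1
    abel

theorem fieldWave_smul (α : 𝒦 →L[ℂ] OneBoson 𝒦 d) (c : ℂ) (ψ : FockSpace 𝒦 d) (n : ℕ) :
    fieldWave α (c • ψ) n =ᵐ[volume] c • fieldWave α ψ n := by
  have ha : ∀ m, annihilate α (wave (c • ψ) (m + 1)) =ᵐ[volume]
      c • annihilate α (wave ψ (m + 1)) := fun m => by
    rw [← annihilate_smul]
    exact annihilate_congr α (wave_smul c ψ (m + 1))
  cases n with
  | zero =>
    filter_upwards [ha 0] with k hk
    simp only [fieldWave, Pi.smul_apply] at hk ⊢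
    rw [hk, smul_comm]
  | succ n =>
    filter_upwards [ha (n + 1), create_congr α (wave_smul c ψ n)] with k hk hk'
    simp only [fieldWave, Pi.smul_apply, Pi.add_apply, create_smul] at hk hk' ⊢
    rw [hk, hk', ← smul_add, smul_comm]

/-- The graph of `2^{-1/2} (a(α) + a^*(α))` on the domain
`𝒟(N^{1/2}) = {ψ | ∑ n ‖ψ_n‖² < ∞}`, where `N` is the number operator. -/
def fieldGraph (α : 𝒦 →L[ℂ] OneBoson 𝒦 d) :
    Submodule ℂ (FockSpace 𝒦 d × FockSpace 𝒦 d) where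
  carrier := {x | Summable (fun n : ℕ => (n : ℝ) * ‖x.1 n‖ ^ 2) ∧
    ∀ n, wave x.2 n =ᵐ[volume] fieldWave α x.1 n}
  add_mem' := fun {x y} hx hy => by
    refine ⟨?_, fun n => ?_⟩
    · refine Summable.of_nonneg_of_le (fun n => by positivity) (fun n => ?_)
        ((hx.1.add hy.1).mul_left 2)
      have h1 : ‖(x + y).1 n‖ ≤ ‖x.1 n‖ + ‖y.1 n‖ := norm_add_le _ _
      have h2 : ‖(x + y).1 n‖ ^ 2 ≤ 2 * (‖x.1 n‖ ^ 2 + ‖y.1 n‖ ^ 2) := by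
        nlinarith [norm_nonneg ((x + y).1 n), sq_nonneg (‖x.1 n‖ - ‖y.1 n‖)]
      nlinarith [Nat.cast_nonneg (α := ℝ) n]
    · filter_upwards [hx.2 n, hy.2 n, wave_add x.2 y.2 n, fieldWave_add α x.1 y.1 n]
        with k h1 h2 h3 h4
      simp only [Prod.fst_add, Prod.snd_add, h3, h4, Pi.add_apply, h1, h2]
  zero_mem' := by
    refine ⟨by simp, fun n => ?_⟩
    filter_upwards [wave_zero (𝒦 := 𝒦) (d := d) n, fieldWave_smul α 0 (0 : FockSpace 𝒦 d) n]
      with k h1 h2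
    simp only [zero_smul, Pi.zero_apply] at h1 h2
    simp only [Prod.fst_zero, Prod.snd_zero, h1, h2]
  smul_mem' := fun c x hx => by
    refine ⟨?_, fun n => ?_⟩
    · refine (hx.1.mul_left (‖c‖ ^ 2)).congr fun n => ?_
      have : ‖(c • x).1 n‖ = ‖c‖ * ‖x.1 n‖ := norm_smul c (x.1 n)
      rw [this]; ring
    · filter_upwards [hx.2 n, wave_smul c x.2 n, fieldWave_smul α c x.1 n] with k h1 h2 h3
      simp only [Prod.smul_fst, Prod.smul_snd, h2, h3, Pi.smul_apply, h1]

/-- The Segal field operator `φ(α)`: the closure of `2^{-1/2} (a(α) + a^*(α))` defined on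
`𝒟(N^{1/2})`. -/
def fieldOperator (α : 𝒦 →L[ℂ] OneBoson 𝒦 d) : FockSpace 𝒦 d →ₗ.[ℂ] FockSpace 𝒦 d :=
  (fieldGraph α).toLinearPMap.closure

theorem fieldGraph_graph (α : 𝒦 →L[ℂ] OneBoson 𝒦 d) :
    (fieldGraph α).toLinearPMap.graph = fieldGraph α := by
  refine Submodule.toLinearPMap_graph_eq _ fun x hx hx0 => ext_wave fun n => ?_
  filter_upwards [hx.2 n, wave_zero (𝒦 := 𝒦) (d := d) n,
    fieldWave_smul α 0 (0 : FockSpace 𝒦 d) n] with k h1 h2 h3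
  rw [zero_smul] at h3
  rw [h1, hx0, h2, h3]
  simp

/-- The Pauli-Fierz Hamiltonian `H_λ = H₀ + λ φ(α)`. -/
def hamiltonian (K : 𝒦 →ₗ[ℂ] 𝒦) (α : 𝒦 →L[ℂ] OneBoson 𝒦 d) (lam : ℝ) :
    FockSpace 𝒦 d →ₗ.[ℂ] FockSpace 𝒦 d :=
  freeHamiltonian d K + (lam : ℂ) • fieldOperator α

/-- The vectors `x ⊗ Ω`, where `Ω` is the vacuum. -/
def vacuum (𝒦 : Type*) [NormedAddCommGroup 𝒦] [InnerProductSpace ℂ 𝒦] (d : ℕ) :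
    𝒦 →ₗ[ℂ] FockSpace 𝒦 d :=
  haveI : IsFiniteMeasure (volume : Measure (Fin 0 → Mom d)) := by
    rw [volume_pi, Measure.pi_of_empty]; infer_instance
  (lp.lsingle (𝕜 := ℂ) 2 0).comp ((Lp.constₗ 2 (volume : Measure (Fin 0 → Mom d)) ℂ).codRestrict
    (sector 𝒦 d 0) fun x σ => by
      have h : (fun k : Fin 0 → Mom d => k ∘ σ) = id := funext fun k => Subsingleton.elim _ _
      refine Lp.ext ((Lp.coeFn_compMeasurePreserving _ (measurePreserving_perm σ)).trans ?_)
      rw [h]; rfl)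

/-- The range of `P = P_E ⊗ P_Ω`, where `P_E` is the projection onto `ker (K - E)`. -/
def levelSpace (d : ℕ) (K : 𝒦 →ₗ[ℂ] 𝒦) (E : ℝ) : Submodule ℂ (FockSpace 𝒦 d) :=
  (Module.End.eigenspace K (E : ℂ)).map (vacuum 𝒦 d)

instance instFiniteDimensionalLevelSpace (K : 𝒦 →ₗ[ℂ] 𝒦) (E : ℝ) :
    FiniteDimensional ℂ (levelSpace d K E) := by
  unfold levelSpace; infer_instance

instance instProjectionLevelSpace (K : 𝒦 →ₗ[ℂ] 𝒦) (E : ℝ) :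
    (levelSpace d K E).HasOrthogonalProjection :=
  haveI : CompleteSpace (levelSpace d K E) := FiniteDimensional.complete ℂ _
  inferInstance

/-- The complementary projection `1 - P`. -/
def complProjection (d : ℕ) (K : 𝒦 →ₗ[ℂ] 𝒦) (E : ℝ) : FockSpace 𝒦 d →L[ℂ] FockSpace 𝒦 d :=
  ContinuousLinearMap.id ℂ _ - (levelSpace d K E).starProjection

/-- `R` is the bounded two-sided inverse of `A - z`. -/
def IsResolvent (A : FockSpace 𝒦 d →ₗ.[ℂ] FockSpace 𝒦 d) (z : ℂ)
    (R : FockSpace 𝒦 d →L[ℂ] FockSpace 𝒦 d) : Prop :=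
  (∀ η, ∃ h : R η ∈ A.domain, A ⟨R η, h⟩ - z • R η = η) ∧
    ∀ ψ : A.domain, R (A ψ - z • (ψ : FockSpace 𝒦 d)) = ψ

open scoped Classical in
/-- The resolvent `(A - z)⁻¹` (zero if `z` is in the spectrum of `A`). -/
def resolventAt (A : FockSpace 𝒦 d →ₗ.[ℂ] FockSpace 𝒦 d) (z : ℂ) :
    FockSpace 𝒦 d →L[ℂ] FockSpace 𝒦 d :=
  if h : ∃ R, IsResolvent A z R then h.choose else 0

theorem coeFn_form (α : 𝒦 →L[ℂ] OneBoson 𝒦 d) (x : 𝒦) :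
    ∀ᵐ q : Mom d, α x q = ∑ i, ⟪stdOrthonormalBasis ℂ 𝒦 i, x⟫_ℂ •
      α (stdOrthonormalBasis ℂ 𝒦 i) q := by
  have h1 : α x = ∑ i, ⟪stdOrthonormalBasis ℂ 𝒦 i, x⟫_ℂ • α (stdOrthonormalBasis ℂ 𝒦 i) := by
    conv_lhs => rw [← (stdOrthonormalBasis ℂ 𝒦).sum_repr' x]
    simp only [map_sum, map_smul]
  have h2 := Lp.coeFn_finsetSum Finset.univ
    fun i => ⟪stdOrthonormalBasis ℂ 𝒦 i, x⟫_ℂ • α (stdOrthonormalBasis ℂ 𝒦 i)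
  have h3 := ae_all_iff.2 fun i => Lp.coeFn_smul ⟪stdOrthonormalBasis ℂ 𝒦 i, x⟫_ℂ
    (α (stdOrthonormalBasis ℂ 𝒦 i))
  rw [← h1] at h2
  filter_upwards [h2, h3] with q h4 h5
  rw [h4]
  simp [h5]

/-- The one-boson vector `f` as an element of the one-boson sector. -/
def oneBosonEmbed (f : OneBoson 𝒦 d) : sector 𝒦 d 1 :=
  ⟨Lp.compMeasurePreserving (MeasurableEquiv.funUnique (Fin 1) (Mom d))
    (volume_preserving_funUnique (Fin 1) (Mom d)) f, fun σ => by
      have h : (fun k : Fin 1 → Mom d => k ∘ σ) = id :=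
        funext fun k => by rw [Subsingleton.elim σ 1]; rfl
      refine Lp.ext ((Lp.coeFn_compMeasurePreserving _ (measurePreserving_perm σ)).trans ?_)
      rw [h]; rfl⟩

theorem wave_single_ne {m n : ℕ} (h : n ≠ m) (f : sector 𝒦 d m) :
    wave (lp.single 2 m f : FockSpace 𝒦 d) n =ᵐ[volume] 0 := by
  have h0 : (lp.single 2 m f : FockSpace 𝒦 d) n = 0 :=
    lp.single_apply_ne (E := fun n : ℕ => sector 𝒦 d n) 2 m f h
  unfold wave
  rw [h0]
  exact Lp.coeFn_zero 𝒦 2 (volume : Measure (Fin n → Mom d))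

theorem wave_single_self (m : ℕ) (f : sector 𝒦 d m) :
    wave (lp.single 2 m f : FockSpace 𝒦 d) m = ⇑(f : NBoson 𝒦 d m) := by
  unfold wave
  rw [lp.single_apply_self]

theorem annihilate_zero (α : 𝒦 →L[ℂ] OneBoson 𝒦 d) {n : ℕ} :
    annihilate α (0 : (Fin (n + 1) → Mom d) → 𝒦) = 0 := by
  simpa using annihilate_smul α (0 : ℂ) (0 : (Fin (n + 1) → Mom d) → 𝒦)

theorem create_zero (α : 𝒦 →L[ℂ] OneBoson 𝒦 d) {n : ℕ} :
    create α (0 : (Fin n → Mom d) → 𝒦) = 0 := by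
  simpa using create_smul α (0 : ℂ) (0 : (Fin n → Mom d) → 𝒦)

theorem wave_vacuum_zero (x : 𝒦) : wave (vacuum 𝒦 d x) 0 =ᵐ[volume] fun _ => x := by
  have : IsFiniteMeasure (volume : Measure (Fin 0 → Mom d)) := by
    rw [volume_pi, Measure.pi_of_empty]; infer_instance
  have h := Lp.coeFn_const (E := 𝒦) 2 (volume : Measure (Fin 0 → Mom d)) x
  unfold vacuum
  simp only [LinearMap.comp_apply, lp.lsingle_apply]
  rw [wave_single_self]
  exact h

theorem wave_vacuum_ne (x : 𝒦) {n : ℕ} (hn : n ≠ 0) : wave (vacuum 𝒦 d x) n =ᵐ[volume] 0 := by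
  unfold vacuum
  simp only [LinearMap.comp_apply, lp.lsingle_apply]
  exact wave_single_ne hn _

/-- `φ(α) (x ⊗ Ω) = 2^{-1/2} α x`. -/
theorem vacuum_mem_fieldGraph (α : 𝒦 →L[ℂ] OneBoson 𝒦 d) (x : 𝒦) :
    (vacuum 𝒦 d x,
      ((((√2)⁻¹ : ℝ) : ℂ) • lp.single 2 1 (oneBosonEmbed (α x)) : FockSpace 𝒦 d))
      ∈ fieldGraph α := by
  have hann : ∀ n, annihilate α (wave (vacuum 𝒦 d x) (n + 1)) =ᵐ[volume] 0 := fun n => by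
    have := annihilate_congr α (wave_vacuum_ne (d := d) x (Nat.succ_ne_zero n))
    rwa [annihilate_zero] at this
  refine ⟨?_, fun n => ?_⟩
  · refine summable_of_ne_finset_zero (s := {0}) fun n hn => ?_
    have hn' : n ≠ 0 := by simpa using hn
    have h0 : (vacuum 𝒦 d x) n = 0 := by
      unfold vacuum
      simp only [LinearMap.comp_apply, lp.lsingle_apply]
      exact lp.single_apply_ne 2 0 _ hn'
    simp [h0]
  · match n with
    | 0 =>
      refine (wave_smul _ _ _).trans ?_
      filter_upwards [hann 0, wave_single_ne (d := d) zero_ne_one (oneBosonEmbed (α x))]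
        with k h1 h2
      simp only [fieldWave, Pi.smul_apply]
      rw [h1, h2]
    | 1 =>
      refine (wave_smul _ _ _).trans ?_
      rw [wave_single_self]
      filter_upwards [hann 1, create_congr α (wave_vacuum_zero (d := d) x),
        Lp.coeFn_compMeasurePreserving (α x) (volume_preserving_funUnique (Fin 1) (Mom d)),
        (volume_preserving_funUnique (Fin 1) (Mom d)).quasiMeasurePreserving.ae
          (coeFn_form α x)] with k h1 h2 h3 h4
      simp only [fieldWave, Pi.smul_apply, Pi.add_apply]
      rw [h1, h2]
      have h5 : (oneBosonEmbed (α x) : NBoson 𝒦 d 1) k = α x (k 0) := h3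
      rw [h5]
      have h6 : α x (k 0) = ∑ i, ⟪stdOrthonormalBasis ℂ 𝒦 i, x⟫_ℂ •
        α (stdOrthonormalBasis ℂ 𝒦 i) (k 0) := h4
      rw [h6]
      simp [create]
    | n + 2 =>
      refine (wave_smul _ _ _).trans ?_
      have h3 := create_congr α (wave_vacuum_ne (d := d) x (Nat.succ_ne_zero n))
      rw [create_zero] at h3
      filter_upwards [hann (n + 2), h3,
        wave_single_ne (d := d) (show n + 2 ≠ 1 by omega) (oneBosonEmbed (α x))] with k h1 h2 h4
      simp only [fieldWave, Pi.smul_apply, Pi.add_apply]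
      rw [h1, h2, h4]
      simp

theorem levelSpace_le_domain (K : 𝒦 →ₗ[ℂ] 𝒦) (α : 𝒦 →L[ℂ] OneBoson 𝒦 d) (E : ℝ) :
    levelSpace d K E ≤ (fieldOperator α).domain := by
  rintro _ ⟨x, -, rfl⟩
  exact (LinearPMap.le_closure (fieldGraph α).toLinearPMap).1
    ⟨_, vacuum_mem_fieldGraph α x, rfl⟩

/-- `φ(α) v` for `v` in the range of `P`. -/
def fieldOnLevel (K : 𝒦 →ₗ[ℂ] 𝒦) (α : 𝒦 →L[ℂ] OneBoson 𝒦 d) (E : ℝ) (v : levelSpace d K E) :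
    FockSpace 𝒦 d :=
  fieldOperator α ⟨v, levelSpace_le_domain K α E v.2⟩

/-- The Fermi golden rule at the energy `E`: the weak limit of
`P φ(α) (1 - P) Im (H₀ - E - iε)⁻¹ (1 - P) φ(α) P`, as `ε → 0⁺`, exists and is positive definite
on the range of `P`. -/
def FermiGoldenRule (K : 𝒦 →ₗ[ℂ] 𝒦) (α : 𝒦 →L[ℂ] OneBoson 𝒦 d) (E : ℝ) : Prop :=
  ∃ T : levelSpace d K E →L[ℂ] levelSpace d K E,
    (∀ u v : levelSpace d K E, Tendsto
      (fun ε : ℝ => ⟪fieldOnLevel K α E u, complProjection d K E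
        ((ℑ (resolventAt (freeHamiltonian d K) (E + ε * Complex.I)) :
            FockSpace 𝒦 d →L[ℂ] FockSpace 𝒦 d)
          (complProjection d K E (fieldOnLevel K α E v)))⟫_ℂ)
      (𝓝[>] 0) (𝓝 ⟪u, T v⟫_ℂ)) ∧
    ∀ v : levelSpace d K E, v ≠ 0 → 0 < (⟪v, T v⟫_ℂ).re

end Operators

section FormFactors

variable {𝒦 : Type*} [NormedAddCommGroup 𝒦] [InnerProductSpace ℂ 𝒦] {d : ℕ}

/-- `(1 ⊗ ω^{-s}) α` is a bounded operator from `𝒦` to `𝒦 ⊗ L²(ℝ^d)`, where `ω(k) = |k|`. -/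
def InvPowBounded (s : ℝ) (α : 𝒦 →L[ℂ] OneBoson 𝒦 d) : Prop :=
  ∃ β : 𝒦 →L[ℂ] OneBoson 𝒦 d, ∀ x, ∀ᵐ k : Mom d, β x k = ((‖k‖ ^ (-s) : ℝ) : ℂ) • α x k

/-- The unit sphere `S^{d-1}`. -/
abbrev Sphere (d : ℕ) : Type := Metric.sphere (0 : Mom d) 1

/-- The surface measure on `S^{d-1}`. -/
abbrev sphereMeasure (d : ℕ) : Measure (Sphere d) := (volume : Measure (Mom d)).toSphere

/-- The measure `dr ⊗ dθ` on `ℝ⁺ × S^{d-1}`. -/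
def polarMeasure (d : ℕ) : Measure (ℝ × Sphere d) :=
  ((volume : Measure ℝ).restrict (Set.Ioi 0)).prod (sphereMeasure d)

/-- Polar coordinates: `(T f)(r, θ) = r^{(d-1)/2} f(rθ)`. -/
def polar (f : Mom d → 𝒦) : ℝ × Sphere d → 𝒦 := fun p =>
  ((p.1 ^ (((d : ℝ) - 1) / 2) : ℝ) : ℂ) • f (p.1 • (p.2 : Mom d))

/-- `f` belongs, in polar coordinates, to the Hilbert tensor product of `Ḣ¹(ℝ⁺)` and
`L²(S^{d-1}; 𝒦)`, and `g = ∂_r f`. Here `Ḣ¹(ℝ⁺)` is the completion of `C_c^∞(ℝ⁺)`, `ℝ⁺ = (0, ∞)`,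
in the norm `‖·‖₂ + ‖∂_r ·‖₂`, so `(f, g)` is a limit in `L² × L²` of pairs
`(∑ u_j ⊗ v_j, ∑ u_j' ⊗ v_j)`. -/
def HasRadialDeriv (f g : OneBoson 𝒦 d) : Prop :=
  ∀ δ : ℝ≥0∞, 0 < δ → ∃ (m : ℕ) (u : Fin m → ℝ → ℂ) (v : Fin m → Sphere d → 𝒦),
    (∀ j, ContDiff ℝ ∞ (u j) ∧ HasCompactSupport (u j) ∧ tsupport (u j) ⊆ Set.Ioi 0) ∧
    (∀ j, MemLp (v j) 2 (sphereMeasure d)) ∧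
    eLpNorm (fun p => polar f p - ∑ j, u j p.1 • v j p.2) 2 (polarMeasure d) < δ ∧
    eLpNorm (fun p => polar g p - ∑ j, deriv (u j) p.1 • v j p.2) 2 (polarMeasure d) < δ

/-- `α` is bounded from `𝒦` to `𝒦 ⊗ Ḣ¹(ℝ⁺) ⊗ L²(S^{d-1})`, and `(1 ⊗ ω^{-1/2}) ∂_r α` is bounded
from `𝒦` to `𝒦 ⊗ L²(ℝ^d)`. -/
def RadiallyRegular (α : 𝒦 →L[ℂ] OneBoson 𝒦 d) : Prop :=
  ∃ α' : 𝒦 →L[ℂ] OneBoson 𝒦 d,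
    (∀ x, HasRadialDeriv (α x) (α' x)) ∧ InvPowBounded (1 / 2) α'

end FormFactors

/-- `E` is an eigenvalue of the (unbounded) operator `A`. -/
def IsEigenvalue {ℋ : Type*} [AddCommGroup ℋ] [Module ℂ ℋ] (A : ℋ →ₗ.[ℂ] ℋ) (E : ℂ) : Prop :=
  ∃ ψ : A.domain, ψ ≠ 0 ∧ A ψ = E • (ψ : ℋ)

end PauliFierz

end

/-! Weak coupling confines an eigenvector to the vacuum sector up to O(λ), and the golden rule then
contradicts this. Let ψ be an eigenvector of H_λ with eigenvalue E in the interval.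

Boson number. Formally the commutator of H_λ with the second quantised generator of radial
translations is N plus λ times a field operator with form factor built from ∂_r α. Its expectation
in an eigenvector vanishes, so ⟨ψ, Nψ⟩ ≤ c|λ| ‖ψ‖ ‖N^{1/2}ψ‖, hence ‖N^{1/2}ψ‖ ≤ c|λ| ‖ψ‖
(`sum_number_le`). The rigorous version replaces the generator by the difference of the translations
by t and −t on the whole line, with wave functions extended by zero to r ≤ 0, and puts a cutoff χ_δ,
zero for r ≤ δ, on both sides. The identity is proved sector by sector (`virial_identity`); the
terms that exchange bosons between neighbouring sectors telescope. Two properties of χ_δ matter.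
Since χ_δ² ≤ r/δ, the cut-off boson number is finite as soon as ψ has finite field energy
(`summable_cutNorm`). Since |χ_δ'| ≤ 1/r for every δ, the commutator with the field is controlled by
∂_r α and α/r uniformly in δ (`l2norm_cut_diff_le`). One lets t → 0 and then δ → 0.

Low components. Consequently ψ₁ and ψ₂ are O(λ) and ψ₀ carries most of the norm. Write ψ₀ = x + y
with x in the eigenspace of K for k and y orthogonal to it. The vacuum component of the eigenvalue
equation has a right side of order λ², so the spectral gap makes y of order λ², and |k − E| is of
order λ² too (`norm_eigen_projection`). The one-boson component reads (H₀ − E)ψ₁ = −λ(u + g), with u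
= φ(α)(x ⊗ Ω) and a small remainder g.

Golden rule. For small ε the golden rule gives f with (H₀ − k − iε)f = u and ε‖f‖² = Im⟨u, f⟩ ≥
γ‖x‖² (`FermiGoldenRule.exists_solution`). Pairing the one-boson equation with f and taking
imaginary parts, where ⟨u, ψ₁⟩ is real by the vacuum equation, bounds ε‖f‖ by ‖g‖ + (|k − E| +
ε)‖ψ₁‖/|λ| (`norm_solution_le`). For λ small compared with ε this is at most 2εC‖ψ‖, whereas the
golden rule makes ε‖f‖ at least √(εγ)‖ψ‖/2. The two are incompatible once 16C²ε < γ
(`weak_coupling_contradiction`). -/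

set_option linter.unusedSectionVars false

noncomputable section

namespace PauliFierz

/-! ### Square integrable functions and Cauchy–Schwarz. -/

section SquareIntegrable

variable {X Y : Type*} [MeasurableSpace X] [MeasurableSpace Y] {μ : Measure X} {ν : Measure Y}
  {E : Type*} [NormedAddCommGroup E]

/-- The `L²` norm as a real number. -/
def l2norm (f : X → E) (μ : Measure X) : ℝ := (eLpNorm f 2 μ).toReal

theorem l2norm_nonneg (f : X → E) (μ : Measure X) : 0 ≤ l2norm f μ := ENNReal.toReal_nonneg

theorem l2norm_congr {f g : X → E} (h : f =ᵐ[μ] g) : l2norm f μ = l2norm g μ := by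
  rw [l2norm, l2norm, eLpNorm_congr_ae h]

theorem eLpNorm_two_sq (f : X → E) : eLpNorm f 2 μ ^ 2 = ∫⁻ x, ‖f x‖ₑ ^ 2 ∂μ := by
  have h := eLpNorm_nnreal_pow_eq_lintegral (μ := μ) (f := f) (p := 2) (by norm_num)
  simpa using h

theorem l2norm_sq {f : X → E} (hf : MemLp f 2 μ) : l2norm f μ ^ 2 = ∫ x, ‖f x‖ ^ 2 ∂μ := by
  have h := integral_eq_lintegral_of_nonneg_ae (μ := μ) (f := fun x => ‖f x‖ ^ 2)
    (Eventually.of_forall fun x => by positivity) (hf.1.norm.pow 2)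
  rw [l2norm, ← ENNReal.toReal_pow, eLpNorm_two_sq, h]
  congr 1
  refine lintegral_congr fun x => ?_
  rw [ENNReal.ofReal_pow (norm_nonneg _), ofReal_norm]

theorem eLpNorm_eq_ofReal_l2norm {f : X → E} (hf : MemLp f 2 μ) :
    eLpNorm f 2 μ = ENNReal.ofReal (l2norm f μ) :=
  (ENNReal.ofReal_toReal hf.2.ne).symm

theorem l2norm_le_of_eLpNorm_le {f : X → E} {c : ℝ} (hc : 0 ≤ c)
    (h : eLpNorm f 2 μ ≤ ENNReal.ofReal c) : l2norm f μ ≤ c :=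
  ENNReal.toReal_le_of_le_ofReal hc h

theorem l2norm_add_le {f g : X → E} (hf : MemLp f 2 μ) (hg : MemLp g 2 μ) :
    l2norm (f + g) μ ≤ l2norm f μ + l2norm g μ := by
  rw [l2norm, l2norm, l2norm, ← ENNReal.toReal_add hf.2.ne hg.2.ne]
  exact ENNReal.toReal_mono (ENNReal.add_ne_top.2 ⟨hf.2.ne, hg.2.ne⟩)
    (eLpNorm_add_le hf.1 hg.1 (by norm_num))

theorem memLp_sum {ι : Type*} (s : Finset ι) {f : ι → X → E} (hf : ∀ i, MemLp (f i) 2 μ) :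
    MemLp (∑ i ∈ s, f i) 2 μ := by
  classical
  induction s using Finset.induction_on with
  | empty => simp
  | insert i s hi ih =>
    rw [Finset.sum_insert hi]
    exact (hf i).add ih

theorem l2norm_sum_le {ι : Type*} (s : Finset ι) {f : ι → X → E} (hf : ∀ i ∈ s, MemLp (f i) 2 μ) :
    l2norm (∑ i ∈ s, f i) μ ≤ ∑ i ∈ s, l2norm (f i) μ := by
  have h : (∑ i ∈ s, l2norm (f i) μ) = (∑ i ∈ s, eLpNorm (f i) 2 μ).toReal :=
    (ENNReal.toReal_sum fun i hi => (hf i hi).2.ne).symm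
  rw [h]
  exact ENNReal.toReal_mono (ENNReal.sum_ne_top.2 fun i hi => (hf i hi).2.ne)
    (eLpNorm_sum_le (fun i hi => (hf i hi).1) (by norm_num))

theorem l2norm_mono {F : Type*} [NormedAddCommGroup F] {f : X → E} {g : X → F}
    (hg : MemLp g 2 μ) (h : ∀ᵐ x ∂μ, ‖f x‖ ≤ ‖g x‖) : l2norm f μ ≤ l2norm g μ :=
  ENNReal.toReal_mono hg.2.ne (eLpNorm_mono_ae h)

theorem l2norm_smul [NormedSpace ℂ E] (c : ℂ) (f : X → E) :
    l2norm (c • f) μ = ‖c‖ * l2norm f μ := by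
  rw [l2norm, eLpNorm_const_smul, ENNReal.toReal_mul, l2norm, toReal_enorm]

theorem l2norm_comp {f : Y → E} (hf : AEStronglyMeasurable f ν) {g : X → Y}
    (hg : MeasurePreserving g μ ν) : l2norm (f ∘ g) μ = l2norm f ν := by
  rw [l2norm, eLpNorm_comp_measurePreserving hf hg, l2norm]

theorem norm_Lp_eq_l2norm (f : Lp E 2 μ) : ‖f‖ = l2norm f μ := rfl

variable [InnerProductSpace ℂ E]

theorem eLpNorm_smul_prod [SFinite ν] {c : Y → ℂ} {g : X → E} (hc : AEStronglyMeasurable c ν)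
    (hg : AEStronglyMeasurable g μ) :
    eLpNorm (fun p : X × Y => c p.2 • g p.1) 2 (μ.prod ν) = eLpNorm g 2 μ * eLpNorm c 2 ν := by
  refine (ENNReal.pow_right_strictMono (n := 2) (by norm_num)).injective ?_
  show eLpNorm (fun p : X × Y => c p.2 • g p.1) 2 (μ.prod ν) ^ 2 =
    (eLpNorm g 2 μ * eLpNorm c 2 ν) ^ 2
  rw [mul_pow, eLpNorm_two_sq, eLpNorm_two_sq, eLpNorm_two_sq,
    ← lintegral_prod_mul (hg.enorm.pow_const 2) (hc.enorm.pow_const 2)]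
  refine lintegral_congr fun p => ?_
  rw [enorm_smul, mul_pow, mul_comm]

theorem lintegral_enorm_inner_le {f g : X → E} (hf : AEStronglyMeasurable f μ)
    (hg : AEStronglyMeasurable g μ) :
    ∫⁻ x, ‖⟪f x, g x⟫_ℂ‖ₑ ∂μ ≤ eLpNorm f 2 μ * eLpNorm g 2 μ := by
  refine (lintegral_mono (g := fun x => ‖f x‖ₑ * ‖g x‖ₑ) fun x => ?_).trans ?_
  · show _ ≤ ‖f x‖ₑ * ‖g x‖ₑ
    rw [← enorm_norm (f x), ← enorm_norm (g x), ← enorm_mul]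
    refine enorm_le_iff_norm_le.2 ?_
    simpa using norm_inner_le_norm (𝕜 := ℂ) (f x) (g x)
  · have h := ENNReal.lintegral_mul_le_Lp_mul_Lq μ (p := 2) (q := 2)
      ⟨by norm_num, by norm_num, by norm_num⟩ hf.enorm hg.enorm
    refine h.trans (le_of_eq ?_)
    rw [eLpNorm_eq_lintegral_rpow_enorm_toReal (by norm_num) (by norm_num),
      eLpNorm_eq_lintegral_rpow_enorm_toReal (by norm_num) (by norm_num)]
    simp

theorem enorm_integral_inner_le {f g : X → E} (hf : AEStronglyMeasurable f μ)
    (hg : AEStronglyMeasurable g μ) :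
    ‖∫ x, ⟪f x, g x⟫_ℂ ∂μ‖ₑ ≤ eLpNorm f 2 μ * eLpNorm g 2 μ :=
  (enorm_integral_le_lintegral_enorm _).trans (lintegral_enorm_inner_le hf hg)

theorem integrable_inner {f g : X → E} (hf : MemLp f 2 μ) (hg : MemLp g 2 μ) :
    Integrable (fun x => ⟪f x, g x⟫_ℂ) μ :=
  ⟨hf.1.inner hg.1, (lintegral_enorm_inner_le hf.1 hg.1).trans_lt
    (ENNReal.mul_lt_top hf.2 hg.2)⟩

theorem norm_integral_inner_le {f g : X → E} (hf : MemLp f 2 μ) (hg : MemLp g 2 μ) :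
    ‖∫ x, ⟪f x, g x⟫_ℂ ∂μ‖ ≤ l2norm f μ * l2norm g μ := by
  have h := enorm_integral_inner_le hf.1 hg.1
  have h' := ENNReal.toReal_mono (ENNReal.mul_lt_top hf.2 hg.2).ne h
  rwa [toReal_enorm, ENNReal.toReal_mul] at h'

theorem integral_inner_self (f : X → E) :
    ∫ x, ⟪f x, f x⟫_ℂ ∂μ = ((∫ x, ‖f x‖ ^ 2 ∂μ : ℝ) : ℂ) := by
  rw [← integral_complex_ofReal]
  refine integral_congr_ae (Eventually.of_forall fun x => ?_)
  simp only [inner_self_eq_norm_sq_to_K]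
  push_cast
  rfl

theorem integral_inner_conj (f g : X → E) :
    ∫ x, ⟪f x, g x⟫_ℂ ∂μ = starRingEnd ℂ (∫ x, ⟪g x, f x⟫_ℂ ∂μ) := by
  rw [← integral_conj]
  simp only [inner_conj_symm]

theorem re_integral_inner_comm (f g : X → E) :
    (∫ x, ⟪f x, g x⟫_ℂ ∂μ).re = (∫ x, ⟪g x, f x⟫_ℂ ∂μ).re := by
  rw [integral_inner_conj, Complex.conj_re]

theorem im_integral_inner_comm (f g : X → E) :
    (∫ x, ⟪f x, g x⟫_ℂ ∂μ).im = -(∫ x, ⟪g x, f x⟫_ℂ ∂μ).im := by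
  rw [integral_inner_conj, Complex.conj_im]

end SquareIntegrable

/-! ### Splitting off one momentum: partial inner products and products. -/

section Slices

variable {d : ℕ}

theorem measurePreserving_insertNth {n : ℕ} (i : Fin (n + 1)) :
    MeasurePreserving (fun p : (Fin n → Mom d) × Mom d =>
      (i.insertNth p.2 p.1 : Fin (n + 1) → Mom d)) (volume.prod volume) volume := by
  have h := (volume_preserving_piFinSuccAbove (fun _ : Fin (n + 1) => Mom d) i).symm.comp
    (Measure.measurePreserving_swap (μ := (volume : Measure (Fin n → Mom d)))
      (ν := (volume : Measure (Mom d))))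
  have h' : (fun p : (Fin n → Mom d) × Mom d =>
      (i.insertNth p.2 p.1 : Fin (n + 1) → Mom d)) =
      (MeasurableEquiv.piFinSuccAbove (fun _ : Fin (n + 1) => Mom d) i).symm ∘ Prod.swap := by
    funext p
    simp [MeasurableEquiv.piFinSuccAbove_symm_apply, Fin.insertNthEquiv]
  rw [h']
  exact h

theorem measurePreserving_cons {n : ℕ} :
    MeasurePreserving (fun p : (Fin n → Mom d) × Mom d =>
      (Fin.cons p.2 p.1 : Fin (n + 1) → Mom d)) (volume.prod volume) volume := by
  simpa [Fin.insertNth_zero'] using measurePreserving_insertNth (d := d) (0 : Fin (n + 1))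

theorem lintegral_insertNth {n : ℕ} (i : Fin (n + 1)) {Φ : (Fin (n + 1) → Mom d) → ℝ≥0∞}
    (hΦ : AEMeasurable Φ volume) :
    ∫⁻ z, Φ z = ∫⁻ k : Fin n → Mom d, ∫⁻ q : Mom d, Φ (i.insertNth q k) := by
  have h := measurePreserving_insertNth (d := d) i
  rw [← h.map_eq, lintegral_map' (by rwa [h.map_eq]) h.aemeasurable, lintegral_prod]
  exact AEMeasurable.comp_measurable (by rwa [h.map_eq]) h.measurable

/-- A permutation that moves the `i`-th entry to the front. -/
theorem insertNth_comp_cycleRange_symm {n : ℕ} {β : Type*} (i : Fin (n + 1)) (q : β)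
    (k : Fin n → β) :
    (i.insertNth q k : Fin (n + 1) → β) ∘ i.cycleRange.symm = Fin.cons q k :=
  funext fun j => Fin.insertNth_apply_cycleRange_symm i q k j

theorem cons_insertNth {n : ℕ} {β : Type*} (i : Fin (n + 1)) (x q : β) (k : Fin n → β) :
    (Fin.cons x (i.insertNth q k : Fin (n + 1) → β) : Fin (n + 2) → β) =
      i.succ.insertNth q (Fin.cons x k : Fin (n + 1) → β) := by
  rw [Fin.eq_insertNth_iff]
  refine ⟨by simp, funext fun j => ?_⟩
  refine Fin.cases ?_ (fun j => ?_) j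
  · simp [Fin.removeNth]
  · simp [Fin.removeNth]

variable {𝒦 : Type*} [NormedAddCommGroup 𝒦] [InnerProductSpace ℂ 𝒦]

/-- The partial inner product with a one-boson function in the first momentum. -/
def contract {n : ℕ} (g : Mom d → 𝒦) (H : (Fin (n + 1) → Mom d) → 𝒦) :
    (Fin n → Mom d) → ℂ := fun k => ∫ q, ⟪g q, H (Fin.cons q k)⟫_ℂ

theorem aestronglyMeasurable_comp_cons {n : ℕ} {H : (Fin (n + 1) → Mom d) → 𝒦}
    (hH : AEStronglyMeasurable H volume) :
    AEStronglyMeasurable (fun p : (Fin n → Mom d) × Mom d => H (Fin.cons p.2 p.1))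
      (volume.prod volume) :=
  hH.comp_measurePreserving measurePreserving_cons

theorem aestronglyMeasurable_contract {n : ℕ} {g : Mom d → 𝒦}
    {H : (Fin (n + 1) → Mom d) → 𝒦} (hg : AEStronglyMeasurable g volume)
    (hH : AEStronglyMeasurable H volume) :
    AEStronglyMeasurable (contract g H) volume := by
  have h : AEStronglyMeasurable (fun p : (Fin n → Mom d) × Mom d =>
      ⟪g p.2, H (Fin.cons p.2 p.1)⟫_ℂ) (volume.prod volume) :=
    hg.comp_snd.inner (aestronglyMeasurable_comp_cons hH)
  exact h.integral_prod_right'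

/-- Cauchy–Schwarz in the first momentum for almost every value of the others, then integration over
the others. -/
theorem eLpNorm_contract_le {n : ℕ} {g : Mom d → 𝒦} {H : (Fin (n + 1) → Mom d) → 𝒦}
    (hg : AEStronglyMeasurable g volume) (hH : AEStronglyMeasurable H volume) :
    eLpNorm (contract g H) 2 volume ≤ eLpNorm g 2 volume * eLpNorm H 2 volume := by
  rw [← ENNReal.pow_le_pow_left_iff (n := 2) (by norm_num), mul_pow, eLpNorm_two_sq,
    eLpNorm_two_sq H, lintegral_insertNth 0 (hH.enorm.pow_const 2)]
  have h := (aestronglyMeasurable_comp_cons hH).prodMk_left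
  rw [← lintegral_const_mul'' _ (by
    simp only [Fin.insertNth_zero']
    exact ((aestronglyMeasurable_comp_cons hH).enorm.pow_const 2).lintegral_prod_right')]
  refine lintegral_mono_ae ?_
  filter_upwards [h] with k hk
  have h1 := enorm_integral_inner_le hg hk
  rw [contract]
  calc _ ≤ (eLpNorm g 2 volume * eLpNorm (fun q => H (Fin.cons q k)) 2 volume) ^ 2 := by gcongr
    _ = _ := by rw [mul_pow, eLpNorm_two_sq (fun q => H (Fin.cons q k))]; simp

theorem memLp_contract {n : ℕ} {g : Mom d → 𝒦} {H : (Fin (n + 1) → Mom d) → 𝒦}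
    (hg : MemLp g 2 volume) (hH : MemLp H 2 volume) : MemLp (contract g H) 2 volume :=
  ⟨aestronglyMeasurable_contract hg.1 hH.1, (eLpNorm_contract_le hg.1 hH.1).trans_lt
    (ENNReal.mul_lt_top hg.2 hH.2)⟩

/-- The product of a scalar function of all momenta but the `j`-th one with a function of the
`j`-th momentum. -/
def tensorAt {n : ℕ} (j : Fin (n + 1)) (c : (Fin n → Mom d) → ℂ) (g : Mom d → 𝒦) :
    (Fin (n + 1) → Mom d) → 𝒦 := fun z => c (j.removeNth z) • g (z j)

theorem measurePreserving_removeNth_prod {n : ℕ} (j : Fin (n + 1)) :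
    MeasurePreserving (fun z : Fin (n + 1) → Mom d => (z j, j.removeNth z)) volume
      (volume.prod volume) :=
  volume_preserving_piFinSuccAbove (fun _ : Fin (n + 1) => Mom d) j

theorem aestronglyMeasurable_tensorAt {n : ℕ} (j : Fin (n + 1)) {c : (Fin n → Mom d) → ℂ}
    {g : Mom d → 𝒦} (hc : AEStronglyMeasurable c volume) (hg : AEStronglyMeasurable g volume) :
    AEStronglyMeasurable (tensorAt j c g) volume :=
  (hc.comp_snd.smul hg.comp_fst).comp_measurePreserving (measurePreserving_removeNth_prod j)

theorem eLpNorm_tensorAt {n : ℕ} (j : Fin (n + 1)) {c : (Fin n → Mom d) → ℂ}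
    {g : Mom d → 𝒦} (hc : AEStronglyMeasurable c volume) (hg : AEStronglyMeasurable g volume) :
    eLpNorm (tensorAt j c g) 2 volume = eLpNorm g 2 volume * eLpNorm c 2 volume := by
  have h : tensorAt j c g = (fun p : Mom d × (Fin n → Mom d) => c p.2 • g p.1) ∘
      fun z : Fin (n + 1) → Mom d => (z j, j.removeNth z) := rfl
  have h1 : AEStronglyMeasurable (fun p : Mom d × (Fin n → Mom d) => c p.2 • g p.1)
      (volume.prod volume) := hc.comp_snd.smul hg.comp_fst
  rw [h, eLpNorm_comp_measurePreserving h1 (measurePreserving_removeNth_prod j),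
    eLpNorm_smul_prod hc hg]

theorem memLp_tensorAt {n : ℕ} (j : Fin (n + 1)) {c : (Fin n → Mom d) → ℂ}
    {g : Mom d → 𝒦} (hc : MemLp c 2 volume) (hg : MemLp g 2 volume) :
    MemLp (tensorAt j c g) 2 volume :=
  ⟨aestronglyMeasurable_tensorAt j hc.1 hg.1, by
    rw [eLpNorm_tensorAt j hc.1 hg.1]; exact ENNReal.mul_lt_top hg.2 hc.2⟩

end Slices

/-! ### Bounds for annihilation and creation; the eigenvalue equation in components. -/

section FieldBounds

variable {𝒦 : Type*} [NormedAddCommGroup 𝒦] [InnerProductSpace ℂ 𝒦] {d : ℕ}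

theorem l2norm_wave (ψ : FockSpace 𝒦 d) (n : ℕ) : l2norm (wave ψ n) volume = ‖ψ n‖ := rfl

theorem norm_component_le (ψ : FockSpace 𝒦 d) (n : ℕ) : ‖ψ n‖ ≤ ‖ψ‖ :=
  lp.norm_apply_le_norm (by norm_num) ψ n

theorem hasSum_norm_sq (ψ : FockSpace 𝒦 d) : HasSum (fun n => ‖ψ n‖ ^ 2) (‖ψ‖ ^ 2) := by
  simpa using lp.hasSum_norm (p := 2) (by norm_num) ψ

theorem wave_perm (ψ : FockSpace 𝒦 d) (n : ℕ) (σ : Equiv.Perm (Fin n)) :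
    (fun k => wave ψ n (k ∘ σ)) =ᵐ[volume] wave ψ n := by
  have h1 : permute 𝒦 d n σ (ψ n : NBoson 𝒦 d n) = ψ n := (ψ n).2 σ
  have h2 := Lp.coeFn_compMeasurePreserving (ψ n : NBoson 𝒦 d n) (measurePreserving_perm σ)
  have h3 : Lp.compMeasurePreserving (fun k : Fin n → Mom d => k ∘ σ) (measurePreserving_perm σ)
      (ψ n : NBoson 𝒦 d n) = ψ n := h1
  rw [h3] at h2
  exact h2.symm

variable [FiniteDimensional ℂ 𝒦]

/-- The sum of the norms of the values of the form factor on an orthonormal basis. -/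
def formNorm (α : 𝒦 →L[ℂ] OneBoson 𝒦 d) : ℝ := ∑ i, ‖α (stdOrthonormalBasis ℂ 𝒦 i)‖

theorem formNorm_nonneg (α : 𝒦 →L[ℂ] OneBoson 𝒦 d) : 0 ≤ formNorm α :=
  Finset.sum_nonneg fun _ _ => norm_nonneg _

theorem annihilate_eq (α : 𝒦 →L[ℂ] OneBoson 𝒦 d) {n : ℕ} (f : (Fin (n + 1) → Mom d) → 𝒦) :
    annihilate α f = ((√(n + 1) : ℝ) : ℂ) • ∑ i, fun k =>
      contract (α (stdOrthonormalBasis ℂ 𝒦 i)) f k • stdOrthonormalBasis ℂ 𝒦 i := by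
  funext k
  simp [annihilate, contract]

theorem create_eq (α : 𝒦 →L[ℂ] OneBoson 𝒦 d) {n : ℕ} (f : (Fin n → Mom d) → 𝒦) :
    create α f = (((√(n + 1))⁻¹ : ℝ) : ℂ) • ∑ j, ∑ i,
      tensorAt j (fun z => ⟪stdOrthonormalBasis ℂ 𝒦 i, f z⟫_ℂ)
        (α (stdOrthonormalBasis ℂ 𝒦 i)) := by
  funext k
  simp [create, tensorAt]

theorem memLp_smul_const {X : Type*} [MeasurableSpace X] {μ : Measure X} {c : X → ℂ}
    (hc : MemLp c 2 μ) (x : 𝒦) : MemLp (fun k => c k • x) 2 μ := by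
  refine MemLp.of_le_mul (c := ‖x‖) hc (hc.1.smul_const x) (Eventually.of_forall fun k => ?_)
  rw [norm_smul, mul_comm]

theorem l2norm_smul_basis_le {X : Type*} [MeasurableSpace X] {μ : Measure X} {c : X → ℂ}
    (hc : MemLp c 2 μ) (i) :
    l2norm (fun k => c k • stdOrthonormalBasis ℂ 𝒦 i) μ ≤ l2norm c μ :=
  l2norm_mono hc (Eventually.of_forall fun k => by simp [norm_smul])

theorem memLp_coeff {X : Type*} [MeasurableSpace X] {μ : Measure X} {f : X → 𝒦}
    (hf : MemLp f 2 μ) (x : 𝒦) : MemLp (fun k => ⟪x, f k⟫_ℂ) 2 μ :=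
  hf.const_inner x

theorem l2norm_coeff_le {X : Type*} [MeasurableSpace X] {μ : Measure X} {f : X → 𝒦}
    (hf : MemLp f 2 μ) (i) :
    l2norm (fun k => ⟪stdOrthonormalBasis ℂ 𝒦 i, f k⟫_ℂ) μ ≤ l2norm f μ :=
  l2norm_mono hf (Eventually.of_forall fun k => by
    simpa using norm_inner_le_norm (𝕜 := ℂ) (stdOrthonormalBasis ℂ 𝒦 i) (f k))

theorem memLp_form (α : 𝒦 →L[ℂ] OneBoson 𝒦 d) (x : 𝒦) : MemLp (α x) 2 volume := Lp.memLp (α x)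

theorem memLp_annihilate_term (α : 𝒦 →L[ℂ] OneBoson 𝒦 d) {n : ℕ}
    {f : (Fin (n + 1) → Mom d) → 𝒦} (hf : MemLp f 2 volume) (i) :
    MemLp (fun k => contract (α (stdOrthonormalBasis ℂ 𝒦 i)) f k • stdOrthonormalBasis ℂ 𝒦 i)
      2 volume :=
  memLp_smul_const (memLp_contract (memLp_form α _) hf) _

theorem memLp_annihilate (α : 𝒦 →L[ℂ] OneBoson 𝒦 d) {n : ℕ} {f : (Fin (n + 1) → Mom d) → 𝒦}
    (hf : MemLp f 2 volume) : MemLp (annihilate α f) 2 volume := by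
  rw [annihilate_eq]
  exact MemLp.const_smul (memLp_sum Finset.univ fun i => memLp_annihilate_term α hf i) _

/-- Summing over a basis of the atomic space replaces the operator norm of α by the cruder
`formNorm`; only the finiteness of this constant matters later. -/
theorem l2norm_annihilate_le (α : 𝒦 →L[ℂ] OneBoson 𝒦 d) {n : ℕ}
    {f : (Fin (n + 1) → Mom d) → 𝒦} (hf : MemLp f 2 volume) :
    l2norm (annihilate α f) volume ≤ √(n + 1) * (formNorm α * l2norm f volume) := by
  rw [annihilate_eq, l2norm_smul, formNorm, Finset.sum_mul]
  have h : ‖((√(n + 1) : ℝ) : ℂ)‖ = √(n + 1) := by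
    rw [Complex.norm_real, Real.norm_of_nonneg (Real.sqrt_nonneg _)]
  rw [h]
  gcongr
  refine (l2norm_sum_le _ fun i _ => memLp_annihilate_term α hf i).trans
    (Finset.sum_le_sum fun i _ => ?_)
  refine (l2norm_smul_basis_le (memLp_contract (memLp_form α _) hf) i).trans ?_
  rw [norm_Lp_eq_l2norm, l2norm, l2norm, l2norm, ← ENNReal.toReal_mul]
  exact ENNReal.toReal_mono (ENNReal.mul_lt_top (memLp_form α _).2 hf.2).ne
    (eLpNorm_contract_le (memLp_form α _).1 hf.1)

theorem l2norm_tensorAt {n : ℕ} (j : Fin (n + 1)) {c : (Fin n → Mom d) → ℂ}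
    {g : Mom d → 𝒦} (hc : MemLp c 2 volume) (hg : MemLp g 2 volume) :
    l2norm (tensorAt j c g) volume = l2norm g volume * l2norm c volume := by
  rw [l2norm, eLpNorm_tensorAt j hc.1 hg.1, ENNReal.toReal_mul, l2norm, l2norm]

theorem memLp_create_term (α : 𝒦 →L[ℂ] OneBoson 𝒦 d) {n : ℕ}
    {f : (Fin n → Mom d) → 𝒦} (hf : MemLp f 2 volume) (j : Fin (n + 1)) (i) :
    MemLp (tensorAt j (fun z => ⟪stdOrthonormalBasis ℂ 𝒦 i, f z⟫_ℂ)
      (α (stdOrthonormalBasis ℂ 𝒦 i))) 2 volume :=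
  memLp_tensorAt j (memLp_coeff hf _) (memLp_form α _)

theorem memLp_create (α : 𝒦 →L[ℂ] OneBoson 𝒦 d) {n : ℕ} {f : (Fin n → Mom d) → 𝒦}
    (hf : MemLp f 2 volume) : MemLp (create α f) 2 volume := by
  rw [create_eq]
  exact MemLp.const_smul (memLp_sum Finset.univ fun j =>
    memLp_sum Finset.univ fun i => memLp_create_term α hf j i) _

/-- The triangle inequality over the n+1 positions of the new boson costs n+1, of which the
prefactor (n+1)^{-1/2} leaves √(n+1). -/
theorem l2norm_create_le (α : 𝒦 →L[ℂ] OneBoson 𝒦 d) {n : ℕ}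
    {f : (Fin n → Mom d) → 𝒦} (hf : MemLp f 2 volume) :
    l2norm (create α f) volume ≤ √(n + 1) * (formNorm α * l2norm f volume) := by
  have hm := memLp_create_term α hf
  have h : ‖(((√(n + 1))⁻¹ : ℝ) : ℂ)‖ = (√(n + 1))⁻¹ := by
    rw [Complex.norm_real, Real.norm_of_nonneg (by positivity)]
  have h1 : l2norm (∑ j : Fin (n + 1), ∑ i, tensorAt j
      (fun z => ⟪stdOrthonormalBasis ℂ 𝒦 i, f z⟫_ℂ) (α (stdOrthonormalBasis ℂ 𝒦 i))) volume ≤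
      (n + 1) * (formNorm α * l2norm f volume) := by
    refine (l2norm_sum_le _ fun j _ => memLp_sum Finset.univ fun i => hm j i).trans ?_
    refine (Finset.sum_le_card_nsmul _ _ (formNorm α * l2norm f volume) fun j _ => ?_).trans ?_
    · refine (l2norm_sum_le _ fun i _ => hm j i).trans ?_
      rw [formNorm, Finset.sum_mul]
      refine Finset.sum_le_sum fun i _ => ?_
      rw [l2norm_tensorAt j (memLp_coeff hf _) (memLp_form α _), norm_Lp_eq_l2norm]
      exact mul_le_mul_of_nonneg_left (l2norm_coeff_le hf i) (l2norm_nonneg _ _)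
    · simp
  rw [create_eq, l2norm_smul, h]
  calc _ ≤ (√(n + 1))⁻¹ * ((n + 1) * (formNorm α * l2norm f volume)) := by gcongr
    _ = ((√(n + 1))⁻¹ * (√(n + 1) * √(n + 1))) * (formNorm α * l2norm f volume) := by
      rw [Real.mul_self_sqrt (by positivity)]; ring
    _ = _ := by rw [inv_mul_cancel_left₀ (by positivity)]

theorem memLp_fieldWave (α : 𝒦 →L[ℂ] OneBoson 𝒦 d) (ψ : FockSpace 𝒦 d) (n : ℕ) :
    MemLp (fieldWave α ψ n) 2 volume := by
  cases n with
  | zero => exact (memLp_annihilate α (memLp_wave ψ 1)).const_smul _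
  | succ n =>
    exact ((memLp_annihilate α (memLp_wave ψ _)).add
      (memLp_create α (memLp_wave ψ n))).const_smul _

theorem norm_inv_sqrt_two : ‖(((√2)⁻¹ : ℝ) : ℂ)‖ ≤ 1 := by
  rw [Complex.norm_real, Real.norm_of_nonneg (by positivity)]
  exact inv_le_one_of_one_le₀ (Real.one_le_sqrt.2 (by norm_num))

/-- The field is unbounded on Fock space, but each output component depends on at most two
neighbouring components and is therefore bounded. This is enough to pass to limits in the graph, one
component at a time. -/
theorem exists_l2norm_fieldWave_le (α : 𝒦 →L[ℂ] OneBoson 𝒦 d) (n : ℕ) :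
    ∃ C : ℝ, 0 ≤ C ∧ ∀ ψ : FockSpace 𝒦 d, l2norm (fieldWave α ψ n) volume ≤ C * ‖ψ‖ := by
  have hn := formNorm_nonneg α
  have hann : ∀ (m : ℕ) (ψ : FockSpace 𝒦 d), l2norm (annihilate α (wave ψ (m + 1))) volume ≤
      √(m + 1) * (formNorm α * ‖ψ‖) := fun m ψ => by
    refine (l2norm_annihilate_le α (memLp_wave ψ _)).trans ?_
    rw [l2norm_wave]
    gcongr
    exact norm_component_le ψ _
  cases n with
  | zero =>
    refine ⟨√((0 : ℕ) + 1) * formNorm α, by positivity, fun ψ => ?_⟩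
    have h1 := hann 0 ψ
    simp only [fieldWave]
    rw [l2norm_smul, mul_assoc]
    exact (mul_le_of_le_one_left (l2norm_nonneg _ _) norm_inv_sqrt_two).trans h1
  | succ n =>
    refine ⟨√((n + 1 : ℕ) + 1) * formNorm α + √(n + 1) * formNorm α, by positivity, fun ψ => ?_⟩
    have h1 := hann (n + 1) ψ
    have h2 : l2norm (create α (wave ψ n)) volume ≤ √(n + 1) * (formNorm α * ‖ψ‖) := by
      refine (l2norm_create_le α (memLp_wave ψ _)).trans ?_
      rw [l2norm_wave]
      gcongr
      exact norm_component_le ψ _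
    simp only [fieldWave]
    rw [l2norm_smul]
    refine (mul_le_of_le_one_left (l2norm_nonneg _ _) norm_inv_sqrt_two).trans ?_
    refine (l2norm_add_le (memLp_annihilate α (memLp_wave ψ _))
      (memLp_create α (memLp_wave ψ n))).trans ?_
    linarith

/-- On its whole domain the field operator is given by the explicit formula. -/
theorem wave_eq_fieldWave_of_mem_closure (α : 𝒦 →L[ℂ] OneBoson 𝒦 d)
    {x : FockSpace 𝒦 d × FockSpace 𝒦 d} (hx : x ∈ closure (fieldGraph α : Set _)) (n : ℕ) :
    wave x.2 n =ᵐ[volume] fieldWave α x.1 n := by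
  obtain ⟨C, hC0, hC⟩ := exists_l2norm_fieldWave_le α n
  have hm : MemLp (wave x.2 n - fieldWave α x.1 n) 2 volume :=
    (memLp_wave _ _).sub (memLp_fieldWave α _ _)
  have key : l2norm (wave x.2 n - fieldWave α x.1 n) volume ≤ 0 := by
    refine le_of_forall_pos_le_add fun ε hε => ?_
    obtain ⟨y, hy, hxy⟩ := Metric.mem_closure_iff.1 hx (ε / (1 + C)) (by positivity)
    have h1 : wave x.2 n - fieldWave α x.1 n =ᵐ[volume]
        wave (x.2 - y.2) n + (-1 : ℂ) • fieldWave α (x.1 - y.1) n := by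
      have ha := wave_add (x.2 - y.2) y.2 n
      have hb := fieldWave_add α (x.1 - y.1) y.1 n
      rw [sub_add_cancel] at ha hb
      filter_upwards [ha, hb, hy.2 n] with k h1 h2 h3
      simp only [Pi.sub_apply, Pi.add_apply, h1, h2, h3, neg_smul, one_smul, Pi.neg_apply]
      abel
    have h2 : ‖x.2 - y.2‖ ≤ dist x y := by
      rw [← dist_eq_norm]; exact (le_max_right _ _ : _ ≤ max (dist x.1 y.1) (dist x.2 y.2))
    have h3 : ‖x.1 - y.1‖ ≤ dist x y := by
      rw [← dist_eq_norm]; exact (le_max_left _ _ : _ ≤ max (dist x.1 y.1) (dist x.2 y.2))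
    rw [l2norm_congr h1]
    refine (l2norm_add_le (memLp_wave _ _) ((memLp_fieldWave α _ _).const_smul _)).trans ?_
    rw [l2norm_smul, l2norm_wave]
    have h4 := (norm_component_le (x.2 - y.2) n).trans h2
    have h5 := (hC (x.1 - y.1)).trans (mul_le_mul_of_nonneg_left h3 hC0)
    have h6 : (1 + C) * dist x y ≤ ε := by
      rw [mul_comm]; exact (le_div_iff₀ (by positivity)).1 hxy.le
    simp only [norm_neg, norm_one, one_mul, zero_add]
    linarith
  have h0 : eLpNorm (wave x.2 n - fieldWave α x.1 n) 2 volume = 0 := by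
    rw [eLpNorm_eq_ofReal_l2norm hm, ENNReal.ofReal_eq_zero]; exact key
  have h1 := (eLpNorm_eq_zero_iff hm.1 (by norm_num)).1 h0
  filter_upwards [h1] with k hk
  exact sub_eq_zero.1 hk

theorem wave_fieldOperator (α : 𝒦 →L[ℂ] OneBoson 𝒦 d) (ψ : (fieldOperator α).domain) (n : ℕ) :
    wave (fieldOperator α ψ) n =ᵐ[volume] fieldWave α ψ n := by
  have h1 : ((ψ : FockSpace 𝒦 d), fieldOperator α ψ) ∈
      (fieldGraph α).toLinearPMap.closure.graph :=
    (fieldOperator α).mem_graph ψ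
  refine wave_eq_fieldWave_of_mem_closure α (x := ((ψ : FockSpace 𝒦 d), fieldOperator α ψ)) ?_ n
  rw [← fieldGraph_graph]
  -- By convention the closure of a non-closable operator is the operator itself, so the formula
  -- holds in either case and closability need not be proved.
  by_cases h : (fieldGraph α).toLinearPMap.IsClosable
  · rw [← h.graph_closure_eq_closure_graph] at h1
    exact h1
  · rw [LinearPMap.closure_def' h] at h1
    exact subset_closure h1

theorem wave_multiplication (M : ∀ n : ℕ, (Fin n → Mom d) → (𝒦 →ₗ[ℂ] 𝒦))
    (ψ : (multiplication M).domain) (n : ℕ) :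
    ∀ᵐ k, wave (multiplication M ψ) n k = M n k (wave (ψ : FockSpace 𝒦 d) n k) := by
  have h1 : ((ψ : FockSpace 𝒦 d), multiplication M ψ) ∈ (multiplication M).graph :=
    (multiplication M).mem_graph ψ
  rw [multiplication_graph] at h1
  exact h1 n

theorem wave_atomHamiltonian (K : 𝒦 →ₗ[ℂ] 𝒦) (ψ : (atomHamiltonian d K).domain) (n : ℕ) :
    ∀ᵐ k, wave (atomHamiltonian d K ψ) n k = K (wave (ψ : FockSpace 𝒦 d) n k) :=
  wave_multiplication (fun _ _ => K) ψ n

theorem wave_fieldEnergy (ψ : (fieldEnergy 𝒦 d).domain) (n : ℕ) :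
    ∀ᵐ k, wave (fieldEnergy 𝒦 d ψ) n k =
      ((∑ j, ‖k j‖ : ℝ) : ℂ) • wave (ψ : FockSpace 𝒦 d) n k :=
  wave_multiplication (fun _ k => ((∑ j, ‖k j‖ : ℝ) : ℂ) • LinearMap.id) ψ n

/-- The fibre of the free Hamiltonian, minus an energy. -/
def fibre (K : 𝒦 →ₗ[ℂ] 𝒦) (E : ℝ) {n : ℕ} (k : Fin n → Mom d) : 𝒦 →ₗ[ℂ] 𝒦 :=
  K + ((∑ j, ‖k j‖ - E : ℝ) : ℂ) • LinearMap.id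

theorem wave_freeHamiltonian (K : 𝒦 →ₗ[ℂ] 𝒦) (ψ : (freeHamiltonian d K).domain) (n : ℕ) :
    ∀ᵐ k, wave (freeHamiltonian d K ψ) n k = fibre K 0 k (wave (ψ : FockSpace 𝒦 d) n k) := by
  obtain ⟨ψ, h⟩ := ψ
  have h1 : freeHamiltonian d K ⟨ψ, h⟩ = atomHamiltonian d K ⟨ψ, h.1⟩ + fieldEnergy 𝒦 d ⟨ψ, h.2⟩ :=
    LinearPMap.add_apply _ _ _
  rw [h1]
  filter_upwards [wave_add (atomHamiltonian d K ⟨ψ, h.1⟩) (fieldEnergy 𝒦 d ⟨ψ, h.2⟩) n,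
    wave_atomHamiltonian K ⟨ψ, h.1⟩ n, wave_fieldEnergy ⟨ψ, h.2⟩ n] with k h2 h3 h4
  rw [h2, Pi.add_apply, h3, h4]
  simp [fibre]

/-- The eigenvalue equation in components. -/
theorem eigenvector_equation {K : 𝒦 →ₗ[ℂ] 𝒦} {α : 𝒦 →L[ℂ] OneBoson 𝒦 d} {lam E : ℝ}
    {ψ : (hamiltonian K α lam).domain}
    (h : hamiltonian K α lam ψ = (E : ℂ) • (ψ : FockSpace 𝒦 d)) (n : ℕ) :
    ∀ᵐ k, fibre K E k (wave (ψ : FockSpace 𝒦 d) n k) =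
      (-(lam : ℂ)) • fieldWave α (ψ : FockSpace 𝒦 d) n k := by
  obtain ⟨ψ, hψ⟩ := ψ
  have h1 : hamiltonian K α lam ⟨ψ, hψ⟩ =
      freeHamiltonian d K ⟨ψ, hψ.1⟩ + (lam : ℂ) • fieldOperator α ⟨ψ, hψ.2⟩ :=
    LinearPMap.add_apply _ _ _
  rw [h1] at h
  filter_upwards [wave_add (freeHamiltonian d K ⟨ψ, hψ.1⟩)
      ((lam : ℂ) • fieldOperator α ⟨ψ, hψ.2⟩) n,
    wave_smul (lam : ℂ) (fieldOperator α ⟨ψ, hψ.2⟩) n, wave_smul (E : ℂ) ψ n,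
    wave_freeHamiltonian K ⟨ψ, hψ.1⟩ n, wave_fieldOperator α ⟨ψ, hψ.2⟩ n] with k h2 h3 h4 h5 h6
  rw [h, h4, Pi.add_apply, h3, Pi.smul_apply, Pi.smul_apply, h5, h6] at h2
  have h7 : fibre K E k (wave ψ n k) = fibre K 0 k (wave ψ n k) - (E : ℂ) • wave ψ n k := by
    simp only [fibre, LinearMap.add_apply, LinearMap.smul_apply, LinearMap.id_apply]
    push_cast
    module
  show fibre K E k (wave ψ n k) = _
  rw [h7, h2]
  module

/-- The domain of the Hamiltonian is an intersection, so an eigenvector has finite field energy.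
Besides the eigenvalue equation, this is all the virial argument needs to know about it. -/
theorem exists_fieldEnergy {K : 𝒦 →ₗ[ℂ] 𝒦} {α : 𝒦 →L[ℂ] OneBoson 𝒦 d} {lam : ℝ}
    (ψ : (hamiltonian K α lam).domain) :
    ∃ Θ : FockSpace 𝒦 d, ∀ n, ∀ᵐ k, wave Θ n k =
      ((∑ j, ‖k j‖ : ℝ) : ℂ) • wave (ψ : FockSpace 𝒦 d) n k := by
  obtain ⟨ψ, hψ⟩ := ψ
  exact ⟨fieldEnergy 𝒦 d ⟨ψ, hψ.1.2⟩, wave_fieldEnergy ⟨ψ, hψ.1.2⟩⟩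

end FieldBounds

/-! ### Polar coordinates for the first momentum on the full line, and radial translations. -/

section Polar

variable {d : ℕ}

/-- The measure `dr ⊗ dθ` on `ℝ × S^{d-1}`. -/
abbrev lineSphere (d : ℕ) : Measure (ℝ × Sphere d) :=
  (volume : Measure ℝ).prod (sphereMeasure d)

/-- The square root of the density of Lebesgue measure in polar coordinates. -/
def polarWeight (d : ℕ) (r : ℝ) : ℝ := if 0 < r then r ^ (((d : ℝ) - 1) / 2) else 0

theorem measurable_polarWeight : Measurable (polarWeight d) :=
  Measurable.ite measurableSet_Ioi (measurable_id.pow_const _) measurable_const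

theorem polarWeight_nonneg (r : ℝ) : 0 ≤ polarWeight d r := by
  unfold polarWeight; split_ifs <;> positivity

theorem polarWeight_sq (hd : 0 < d) (r : ℝ) :
    polarWeight d r ^ 2 = (Set.Ioi (0 : ℝ)).indicator (fun r => r ^ (d - 1)) r := by
  unfold polarWeight
  split_ifs with h
  · rw [Set.indicator_of_mem (show r ∈ Set.Ioi 0 from h), ← Real.rpow_natCast,
      ← Real.rpow_mul h.le, ← Real.rpow_natCast]
    congr 1
    push_cast [Nat.cast_sub (show 1 ≤ d from hd)]
    ring
  · rw [Set.indicator_of_notMem (show r ∉ Set.Ioi 0 from h)]; simp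

theorem map_val_volumeIoiPow (n : ℕ) :
    (Measure.volumeIoiPow n).map Subtype.val =
      ((volume : Measure ℝ).restrict (Set.Ioi 0)).withDensity fun r => ENNReal.ofReal (r ^ n) := by
  ext s hs
  rw [Measure.map_apply measurable_subtype_coe hs, Measure.volumeIoiPow,
    withDensity_apply _ (measurable_subtype_coe hs), withDensity_apply _ hs,
    setLIntegral_subtype measurableSet_Ioi _ fun a : ℝ => ENNReal.ofReal (a ^ n),
    Measure.restrict_restrict hs]
  simp [Subtype.image_preimage_coe, Set.inter_comm]

/-- The squared weight is r^{d-1} for r > 0 and zero otherwise. Absorbing its root into the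
functions leaves dr ⊗ dθ on all of ℝ × S^{d-1}, which radial translations preserve. -/
theorem measurePreserving_polar (hd : 0 < d) :
    MeasurePreserving (fun q : ℝ × Sphere d => q.1 • (q.2 : Mom d))
      ((lineSphere d).withDensity fun q => ENNReal.ofReal (polarWeight d q.1 ^ 2)) volume := by
  have : Nonempty (Fin d) := ⟨⟨0, hd⟩⟩
  have hne : Nontrivial (Mom d) := inferInstance
  set ρ : Measure ℝ := ((volume : Measure ℝ).restrict (Set.Ioi 0)).withDensity
    fun r => ENNReal.ofReal (r ^ (d - 1)) with hρ
  have hdim : Module.finrank ℝ (Mom d) = d := by simp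
  have h1 : MeasurePreserving (Subtype.val : ({0}ᶜ : Set (Mom d)) → Mom d)
      ((volume : Measure (Mom d)).comap (↑)) volume := by
    have h := measurePreserving_subtype_coe (μa := (volume : Measure (Mom d)))
      (s := ({0}ᶜ : Set (Mom d))) (measurableSet_singleton _).compl
    have h' : (volume : Measure (Mom d)).restrict ({0}ᶜ) = volume :=
      Measure.restrict_eq_self_of_ae_mem (by
        rw [ae_iff]; simp)
    rwa [h'] at h
  have h2 := ((volume : Measure (Mom d)).measurePreserving_homeomorphUnitSphereProd.symm
    (homeomorphUnitSphereProd (Mom d)).toMeasurableEquiv)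
  have h3 := h1.comp h2
  rw [hdim] at h3
  have h4 : MeasurePreserving (fun x : Sphere d × Set.Ioi (0 : ℝ) => (x.2.1, x.1))
      ((sphereMeasure d).prod (Measure.volumeIoiPow (d - 1))) (ρ.prod (sphereMeasure d)) := by
    have h5 : MeasurePreserving (Subtype.val : Set.Ioi (0 : ℝ) → ℝ)
        (Measure.volumeIoiPow (d - 1)) ρ :=
      ⟨measurable_subtype_coe, map_val_volumeIoiPow _⟩
    exact (h5.prod (MeasurePreserving.id _)).comp Measure.measurePreserving_swap
  have h6 : Measurable fun q : ℝ × Sphere d => q.1 • (q.2 : Mom d) := by fun_prop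
  have h7 : (lineSphere d).withDensity (fun q => ENNReal.ofReal (polarWeight d q.1 ^ 2)) =
      ρ.prod (sphereMeasure d) := by
    have h8 : ρ = (volume : Measure ℝ).withDensity
        fun r => ENNReal.ofReal (polarWeight d r ^ 2) := by
      rw [hρ, ← withDensity_indicator measurableSet_Ioi]
      congr 1
      funext r
      rw [polarWeight_sq hd]
      by_cases hr : r ∈ Set.Ioi (0 : ℝ) <;> simp [hr]
    rw [h8, prod_withDensity_left (by
      exact (measurable_polarWeight.pow_const 2).ennreal_ofReal)]
  refine ⟨h6, ?_⟩
  rw [h7, ← h4.map_eq, Measure.map_map h6 h4.measurable, ← h3.map_eq]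
  congr 1

/-- The point with first momentum `rθ` and remaining momenta `k`. -/
def polarCons {n : ℕ} (p : (ℝ × Sphere d) × (Fin n → Mom d)) : Fin (n + 1) → Mom d :=
  Fin.cons (p.1.1 • (p.1.2 : Mom d)) p.2

/-- The measure `dr ⊗ dθ ⊗ dk` for a first momentum in polar coordinates. -/
abbrev polarVolume (d n : ℕ) : Measure ((ℝ × Sphere d) × (Fin n → Mom d)) :=
  (lineSphere d).prod volume

instance instSigmaFiniteLineSphere : SigmaFinite (lineSphere d) := Measure.prod.instSigmaFinite

instance instSigmaFinitePolarVolume (n : ℕ) : SigmaFinite (polarVolume d n) :=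
  Measure.prod.instSigmaFinite

instance instIsFiniteMeasureOnCompactsLineSphere : IsFiniteMeasureOnCompacts (lineSphere d) :=
  Measure.prod.instIsFiniteMeasureOnCompacts _ _

instance instIsFiniteMeasureOnCompactsPolarVolume (n : ℕ) :
    IsFiniteMeasureOnCompacts (polarVolume d n) :=
  Measure.prod.instIsFiniteMeasureOnCompacts _ _

theorem measurePreserving_polarCons (hd : 0 < d) (n : ℕ) :
    MeasurePreserving (polarCons (d := d) (n := n))
      ((polarVolume d n).withDensity fun p => ENNReal.ofReal (polarWeight d p.1.1 ^ 2))
      volume := by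
  have h1 := (measurePreserving_cons (d := d) (n := n)).comp
    ((Measure.measurePreserving_swap (μ := (volume : Measure (Mom d)))
      (ν := (volume : Measure (Fin n → Mom d)))).comp
    ((measurePreserving_polar hd).prod (MeasurePreserving.id volume)))
  have h2 : Measurable fun q : ℝ × Sphere d => ENNReal.ofReal (polarWeight d q.1 ^ 2) :=
    ((measurable_polarWeight.comp measurable_fst).pow_const 2).ennreal_ofReal
  rw [prod_withDensity_left h2] at h1
  exact h1

theorem measurable_polarCons {n : ℕ} : Measurable (polarCons (d := d) (n := n)) := by
  have h : Measurable fun p : (ℝ × Sphere d) × (Fin n → Mom d) =>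
      (p.2, p.1.1 • (p.1.2 : Mom d)) := by fun_prop
  exact measurePreserving_cons.measurable.comp h

theorem norm_polarCons_zero {n : ℕ} {p : (ℝ × Sphere d) × (Fin n → Mom d)} (hp : 0 ≤ p.1.1) :
    ‖polarCons p 0‖ = p.1.1 := by
  have h : ‖(p.1.2 : Mom d)‖ = 1 := norm_eq_of_mem_sphere p.1.2
  simp [polarCons, norm_smul, h, abs_of_nonneg hp]

/-- The density vanishes for r ≤ 0, so null sets transfer only at positive radii; elsewhere `radial`
is zero anyway. -/
theorem ae_polarCons (hd : 0 < d) {n : ℕ} {P : (Fin (n + 1) → Mom d) → Prop}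
    (h : ∀ᵐ z, P z) : ∀ᵐ p ∂polarVolume d n, 0 < p.1.1 → P (polarCons p) := by
  have h1 := (measurePreserving_polarCons hd n).quasiMeasurePreserving.ae h
  have h2 : Measurable fun p : (ℝ × Sphere d) × (Fin n → Mom d) =>
      ENNReal.ofReal (polarWeight d p.1.1 ^ 2) :=
    ((measurable_polarWeight.comp (measurable_fst.comp measurable_fst)).pow_const 2).ennreal_ofReal
  rw [ae_withDensity_iff h2] at h1
  filter_upwards [h1] with p hp h0
  refine hp ?_
  have : 0 < polarWeight d p.1.1 := by
    rw [polarWeight, if_pos h0]; exact Real.rpow_pos_of_pos h0 _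
  rw [Ne, ENNReal.ofReal_eq_zero, not_le]
  positivity

variable {𝒦 : Type*} [NormedAddCommGroup 𝒦] [InnerProductSpace ℂ 𝒦]

/-- The wave function in polar coordinates for the first momentum, multiplied by a function of
the radius. -/
def radial (w : ℝ → ℝ) {n : ℕ} (G : (Fin (n + 1) → Mom d) → 𝒦) :
    (ℝ × Sphere d) × (Fin n → Mom d) → 𝒦 := fun p =>
  ((w p.1.1 * polarWeight d p.1.1 : ℝ) : ℂ) • G (polarCons p)

theorem radial_congr (hd : 0 < d) (w : ℝ → ℝ) {n : ℕ} {G H : (Fin (n + 1) → Mom d) → 𝒦}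
    (h : G =ᵐ[volume] H) : radial w G =ᵐ[polarVolume d n] radial w H := by
  filter_upwards [ae_polarCons hd h] with p hp
  unfold radial
  by_cases h0 : 0 < p.1.1
  · rw [hp h0]
  · simp [polarWeight, h0]

theorem aestronglyMeasurable_radial (hd : 0 < d) {w : ℝ → ℝ} (hw : Measurable w) {n : ℕ}
    {G : (Fin (n + 1) → Mom d) → 𝒦} (hG : AEStronglyMeasurable G volume) :
    AEStronglyMeasurable (radial w G) (polarVolume d n) := by
  refine AEStronglyMeasurable.congr ?_ (radial_congr hd w hG.ae_eq_mk.symm)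
  refine StronglyMeasurable.aestronglyMeasurable ?_
  refine StronglyMeasurable.smul ?_ (hG.stronglyMeasurable_mk.comp_measurable measurable_polarCons)
  refine Measurable.stronglyMeasurable ?_
  have h1 := hw.mul (measurable_polarWeight (d := d))
  exact Complex.measurable_ofReal.comp (h1.comp (measurable_fst.comp measurable_fst))

theorem lintegral_enorm_radial (hd : 0 < d) {w : ℝ → ℝ} (hw : Measurable w) {n : ℕ}
    {G : (Fin (n + 1) → Mom d) → 𝒦} (hG : AEStronglyMeasurable G volume) :
    ∫⁻ p, ‖radial w G p‖ₑ ^ 2 ∂polarVolume d n =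
      ∫⁻ z, ENNReal.ofReal (w ‖z 0‖ ^ 2) * ‖G z‖ₑ ^ 2 := by
  have hmp := measurePreserving_polarCons hd n
  have hm : Measurable fun p : (ℝ × Sphere d) × (Fin n → Mom d) =>
      ENNReal.ofReal (polarWeight d p.1.1 ^ 2) :=
    ((measurable_polarWeight.comp (measurable_fst.comp measurable_fst)).pow_const 2).ennreal_ofReal
  have h0 : AEMeasurable (fun z : Fin (n + 1) → Mom d =>
      ENNReal.ofReal (w ‖z 0‖ ^ 2) * ‖G z‖ₑ ^ 2) volume := by
    refine AEMeasurable.mul (Measurable.aemeasurable ?_) (hG.enorm.pow_const 2)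
    exact ((hw.comp (measurable_norm.comp (measurable_pi_apply 0))).pow_const 2).ennreal_ofReal
  rw [← hmp.map_eq, lintegral_map' (by rwa [hmp.map_eq]) hmp.aemeasurable,
    lintegral_withDensity_eq_lintegral_mul_non_measurable _ hm
      (Eventually.of_forall fun p => ENNReal.ofReal_lt_top)]
  refine lintegral_congr fun p => ?_
  simp only [Pi.mul_apply, radial]
  rw [enorm_smul, mul_pow, ← mul_assoc]
  congr 1
  by_cases h : 0 < p.1.1
  · rw [norm_polarCons_zero h.le, ← ENNReal.ofReal_mul (by positivity), ← ofReal_norm,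
      Complex.norm_real, Real.norm_eq_abs, ← ENNReal.ofReal_pow (abs_nonneg _), sq_abs]
    ring_nf
  · simp [polarWeight, h]

theorem memLp_radial (hd : 0 < d) {w : ℝ → ℝ} (hw : Measurable w) {C : ℝ}
    (hC : ∀ r, |w r| ≤ C) {n : ℕ} {G : (Fin (n + 1) → Mom d) → 𝒦} (hG : MemLp G 2 volume) :
    MemLp (radial w G) 2 (polarVolume d n) := by
  refine ⟨aestronglyMeasurable_radial hd hw hG.1, ?_⟩
  have h : eLpNorm (radial w G) 2 (polarVolume d n) ^ 2 < ⊤ := by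
    rw [eLpNorm_two_sq, lintegral_enorm_radial hd hw hG.1]
    calc _ ≤ ∫⁻ z, ENNReal.ofReal (C ^ 2) * ‖G z‖ₑ ^ 2 := by
          refine lintegral_mono fun z => ?_
          gcongr ENNReal.ofReal ?_ * _
          exact sq_le_sq' (by linarith [neg_abs_le (w ‖z 0‖), hC ‖z 0‖])
            ((le_abs_self _).trans (hC _))
      _ = ENNReal.ofReal (C ^ 2) * eLpNorm G 2 volume ^ 2 := by
          rw [lintegral_const_mul'' _ (hG.1.enorm.pow_const 2), eLpNorm_two_sq]
      _ < ⊤ := ENNReal.mul_lt_top ENNReal.ofReal_lt_top (ENNReal.pow_lt_top hG.2)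
  exact lt_top_iff_ne_top.2 fun h' => by simp [h'] at h

theorem integral_norm_radial_sq (hd : 0 < d) {w : ℝ → ℝ} (hw : Measurable w) {n : ℕ} {G : (Fin (n + 1) → Mom d) → 𝒦} (hG : MemLp G 2 volume) :
    l2norm (radial w G) (polarVolume d n) ^ 2 = ∫ z, w ‖z 0‖ ^ 2 * ‖G z‖ ^ 2 := by
  rw [l2norm, ← ENNReal.toReal_pow, eLpNorm_two_sq, lintegral_enorm_radial hd hw hG.1,
    integral_eq_lintegral_of_nonneg_ae (Eventually.of_forall fun z => by positivity)]
  · congr 1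
    refine lintegral_congr fun z => ?_
    rw [ENNReal.ofReal_mul (by positivity), ENNReal.ofReal_pow (norm_nonneg _), ofReal_norm]
  · exact ((hw.comp (measurable_norm.comp
      (measurable_pi_apply 0))).pow_const 2).aestronglyMeasurable.mul (hG.1.norm.pow 2)

/-- The translation of the radius of the first momentum. -/
def shift {n : ℕ} (s : ℝ) (p : (ℝ × Sphere d) × (Fin n → Mom d)) :
    (ℝ × Sphere d) × (Fin n → Mom d) := ((p.1.1 + s, p.1.2), p.2)

theorem measurePreserving_lineShift (s : ℝ) :
    MeasurePreserving (fun q : ℝ × Sphere d => (q.1 + s, q.2)) (lineSphere d) (lineSphere d) :=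
  (measurePreserving_add_right volume s).prod (MeasurePreserving.id _)

theorem measurePreserving_shift {n : ℕ} (s : ℝ) :
    MeasurePreserving (shift (d := d) (n := n) s) (polarVolume d n) (polarVolume d n) :=
  (measurePreserving_lineShift s).prod (MeasurePreserving.id _)

theorem shift_neg_shift {n : ℕ} (s : ℝ) (p : (ℝ × Sphere d) × (Fin n → Mom d)) :
    shift (-s) (shift s p) = p := by simp [shift]

theorem shift_shift_neg {n : ℕ} (s : ℝ) (p : (ℝ × Sphere d) × (Fin n → Mom d)) :
    shift s (shift (-s) p) = p := by simp [shift]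

theorem integral_shift {E : Type*} [NormedAddCommGroup E] [NormedSpace ℝ E] {n : ℕ} (s : ℝ)
    (f : (ℝ × Sphere d) × (Fin n → Mom d) → E) :
    ∫ p, f (shift s p) ∂polarVolume d n = ∫ p, f p ∂polarVolume d n := by
  let e : (ℝ × Sphere d) × (Fin n → Mom d) ≃ᵐ (ℝ × Sphere d) × (Fin n → Mom d) :=
    { toFun := shift s
      invFun := shift (-s)
      left_inv := shift_neg_shift s
      right_inv := shift_shift_neg s
      measurable_toFun := (measurePreserving_shift s).measurable
      measurable_invFun := (measurePreserving_shift (-s)).measurable }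
  exact (measurePreserving_shift s).integral_comp e.measurableEmbedding f

end Polar

/-! ### The cutoff near zero momentum. -/

section Cutoff

/-- A cutoff that vanishes near the origin. -/
def cutoff (δ r : ℝ) : ℝ := if r ≤ δ then 0 else 1 - δ / r

theorem measurable_cutoff (δ : ℝ) : Measurable (cutoff δ) :=
  Measurable.ite measurableSet_Iic measurable_const
    (measurable_const.sub (measurable_const.div measurable_id))

theorem cutoff_nonneg {δ : ℝ} (hδ : 0 < δ) (r : ℝ) : 0 ≤ cutoff δ r := by
  unfold cutoff
  split_ifs with h
  · exact le_rfl
  · push Not at h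
    rw [sub_nonneg, div_le_one (by linarith)]
    exact h.le

theorem cutoff_le_one {δ : ℝ} (hδ : 0 < δ) (r : ℝ) : cutoff δ r ≤ 1 := by
  unfold cutoff
  split_ifs with h
  · exact zero_le_one
  · push Not at h
    have : 0 ≤ δ / r := by have := hδ.trans h; positivity
    linarith

theorem abs_cutoff_le {δ : ℝ} (hδ : 0 < δ) (r : ℝ) : |cutoff δ r| ≤ 1 := by
  rw [abs_of_nonneg (cutoff_nonneg hδ r)]; exact cutoff_le_one hδ r

/-- This lets the field energy dominate the cut-off boson number, at a cost 1/δ that does not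
survive in the final estimate. -/
theorem cutoff_sq_le {δ : ℝ} (hδ : 0 < δ) {r : ℝ} (hr : 0 ≤ r) : cutoff δ r ^ 2 ≤ δ⁻¹ * r := by
  by_cases h : r ≤ δ
  · rw [cutoff, if_pos h]; simp; positivity
  · push Not at h
    calc cutoff δ r ^ 2 ≤ 1 := pow_le_one₀ (cutoff_nonneg hδ r) (cutoff_le_one hδ r)
      _ ≤ δ⁻¹ * r := by rw [inv_mul_eq_div, one_le_div hδ]; exact h.le

theorem tendsto_cutoff {r : ℝ} (hr : 0 < r) :
    Tendsto (fun δ => cutoff δ r) (𝓝[>] 0) (𝓝 1) := by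
  have h : Tendsto (fun δ : ℝ => 1 - δ / r) (𝓝[>] 0) (𝓝 1) := by
    have h' : Tendsto (fun δ : ℝ => 1 - δ / r) (𝓝 0) (𝓝 (1 - 0 / r)) :=
      (continuous_const.sub (continuous_id.div_const r)).tendsto 0
    simpa using h'.mono_left nhdsWithin_le_nhds
  refine h.congr' ?_
  filter_upwards [nhdsWithin_le_nhds (Iio_mem_nhds hr)] with δ hδ
  rw [cutoff, if_neg (not_le.2 hδ)]

end Cutoff

/-! ### Matrix elements of radial translations and their commutator with the free Hamiltonian. -/

section ShiftForm

variable {d : ℕ} {𝒦 : Type*} [NormedAddCommGroup 𝒦] [InnerProductSpace ℂ 𝒦]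

/-- The matrix element of a radial translation of the first boson, with cutoffs near the origin. -/
def shiftForm (δ s : ℝ) {n : ℕ} (G H : (Fin (n + 1) → Mom d) → 𝒦) : ℂ :=
  ∫ p, ⟪radial (cutoff δ) G p, radial (cutoff δ) H (shift s p)⟫_ℂ ∂polarVolume d n

theorem radial_add (w : ℝ → ℝ) {n : ℕ} (G H : (Fin (n + 1) → Mom d) → 𝒦) :
    radial w (G + H) = radial w G + radial w H := by
  funext p; simp [radial]

theorem radial_smul (w : ℝ → ℝ) {n : ℕ} (c : ℂ) (G : (Fin (n + 1) → Mom d) → 𝒦) :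
    radial w (c • G) = c • radial w G := by
  funext p; simp only [radial, Pi.smul_apply]; rw [smul_comm]

theorem memLp_cut (hd : 0 < d) {δ : ℝ} (hδ : 0 < δ) {n : ℕ} {G : (Fin (n + 1) → Mom d) → 𝒦}
    (hG : MemLp G 2 volume) : MemLp (radial (cutoff δ) G) 2 (polarVolume d n) :=
  memLp_radial hd (measurable_cutoff δ) (abs_cutoff_le hδ) hG

theorem memLp_cut_shift (hd : 0 < d) {δ : ℝ} (hδ : 0 < δ) (s : ℝ) {n : ℕ}
    {G : (Fin (n + 1) → Mom d) → 𝒦} (hG : MemLp G 2 volume) :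
    MemLp (fun p => radial (cutoff δ) G (shift s p)) 2 (polarVolume d n) :=
  (memLp_cut hd hδ hG).comp_measurePreserving (measurePreserving_shift s)

theorem integrable_shiftForm (hd : 0 < d) {δ : ℝ} (hδ : 0 < δ) (s : ℝ) {n : ℕ}
    {G H : (Fin (n + 1) → Mom d) → 𝒦} (hG : MemLp G 2 volume) (hH : MemLp H 2 volume) :
    Integrable (fun p => ⟪radial (cutoff δ) G p, radial (cutoff δ) H (shift s p)⟫_ℂ)
      (polarVolume d n) :=
  integrable_inner (memLp_cut hd hδ hG) (memLp_cut_shift hd hδ s hH)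

theorem shiftForm_eq_integral_left (δ s : ℝ) {n : ℕ} (G H : (Fin (n + 1) → Mom d) → 𝒦) :
    shiftForm δ s G H =
      ∫ p, ⟪radial (cutoff δ) G (shift (-s) p), radial (cutoff δ) H p⟫_ℂ ∂polarVolume d n := by
  rw [shiftForm, ← integral_shift (-s)]
  simp only [shift_shift_neg]

theorem shiftForm_conj (δ s : ℝ) {n : ℕ} (G H : (Fin (n + 1) → Mom d) → 𝒦) :
    shiftForm δ s G H = starRingEnd ℂ (shiftForm δ (-s) H G) := by
  rw [shiftForm_eq_integral_left, shiftForm, ← integral_inner_conj]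

theorem norm_shiftForm_le (hd : 0 < d) {δ : ℝ} (hδ : 0 < δ) (s : ℝ) {n : ℕ}
    {G H : (Fin (n + 1) → Mom d) → 𝒦} (hG : MemLp G 2 volume) (hH : MemLp H 2 volume) :
    ‖shiftForm δ s G H‖ ≤ l2norm (radial (cutoff δ) G) (polarVolume d n) *
      l2norm (radial (cutoff δ) H) (polarVolume d n) := by
  refine (norm_integral_inner_le (memLp_cut hd hδ hG) (memLp_cut_shift hd hδ s hH)).trans_eq ?_
  congr 1
  exact l2norm_comp (memLp_cut hd hδ hH).1 (measurePreserving_shift s)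

theorem shiftForm_congr_left (hd : 0 < d) (δ s : ℝ) {n : ℕ}
    {G G' : (Fin (n + 1) → Mom d) → 𝒦} (H : (Fin (n + 1) → Mom d) → 𝒦) (h : G =ᵐ[volume] G') :
    shiftForm δ s G H = shiftForm δ s G' H := by
  refine integral_congr_ae ?_
  filter_upwards [radial_congr hd (cutoff δ) h] with p hp
  rw [hp]

theorem shiftForm_congr_right (hd : 0 < d) (δ s : ℝ) {n : ℕ}
    (G : (Fin (n + 1) → Mom d) → 𝒦) {H H' : (Fin (n + 1) → Mom d) → 𝒦} (h : H =ᵐ[volume] H') :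
    shiftForm δ s G H = shiftForm δ s G H' := by
  rw [shiftForm_conj, shiftForm_congr_left hd δ (-s) G h, ← shiftForm_conj]

theorem shiftForm_add_left (hd : 0 < d) {δ : ℝ} (hδ : 0 < δ) (s : ℝ) {n : ℕ}
    {G G' H : (Fin (n + 1) → Mom d) → 𝒦} (hG : MemLp G 2 volume) (hG' : MemLp G' 2 volume)
    (hH : MemLp H 2 volume) :
    shiftForm δ s (G + G') H = shiftForm δ s G H + shiftForm δ s G' H := by
  rw [shiftForm, shiftForm, shiftForm, ← integral_add (integrable_shiftForm hd hδ s hG hH)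
    (integrable_shiftForm hd hδ s hG' hH), radial_add]
  simp only [Pi.add_apply, inner_add_left]

theorem shiftForm_smul_left (δ s : ℝ) {n : ℕ} (c : ℂ) (G H : (Fin (n + 1) → Mom d) → 𝒦) :
    shiftForm δ s (c • G) H = starRingEnd ℂ c * shiftForm δ s G H := by
  rw [shiftForm, shiftForm, ← integral_const_mul, radial_smul]
  simp only [Pi.smul_apply, inner_smul_left]

theorem shiftForm_sum_left (hd : 0 < d) {δ : ℝ} (hδ : 0 < δ) (s : ℝ) {n : ℕ} {ι : Type*}
    (S : Finset ι) {G : ι → (Fin (n + 1) → Mom d) → 𝒦} {H : (Fin (n + 1) → Mom d) → 𝒦}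
    (hG : ∀ i, MemLp (G i) 2 volume) (hH : MemLp H 2 volume) :
    shiftForm δ s (∑ i ∈ S, G i) H = ∑ i ∈ S, shiftForm δ s (G i) H := by
  classical
  induction S using Finset.induction_on with
  | empty =>
    have := shiftForm_smul_left δ s 0 (0 : (Fin (n + 1) → Mom d) → 𝒦) H
    simpa using this
  | insert i S hi ih =>
    rw [Finset.sum_insert hi, Finset.sum_insert hi,
      shiftForm_add_left hd hδ s (hG i) (memLp_sum S hG) hH, ih]

theorem shiftForm_smul_right (δ s : ℝ) {n : ℕ} (c : ℂ) (G H : (Fin (n + 1) → Mom d) → 𝒦) :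
    shiftForm δ s G (c • H) = c * shiftForm δ s G H := by
  rw [shiftForm_conj, shiftForm_smul_left, map_mul, ← shiftForm_conj]
  simp

theorem shiftForm_sum_right (hd : 0 < d) {δ : ℝ} (hδ : 0 < δ) (s : ℝ) {n : ℕ} {ι : Type*}
    (S : Finset ι) {G : (Fin (n + 1) → Mom d) → 𝒦} {H : ι → (Fin (n + 1) → Mom d) → 𝒦}
    (hG : MemLp G 2 volume) (hH : ∀ i, MemLp (H i) 2 volume) :
    shiftForm δ s G (∑ i ∈ S, H i) = ∑ i ∈ S, shiftForm δ s G (H i) := by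
  rw [shiftForm_conj, shiftForm_sum_left hd hδ _ S hH hG, map_sum]
  exact Finset.sum_congr rfl fun i _ => (shiftForm_conj _ _ _ _).symm

theorem shiftForm_smul_const_right (δ s : ℝ) {n : ℕ} (G : (Fin (n + 1) → Mom d) → 𝒦)
    (f : (Fin (n + 1) → Mom d) → ℂ) (x : 𝒦) :
    shiftForm δ s G (fun k => f k • x) = shiftForm δ s (fun k => ⟪x, G k⟫_ℂ) f := by
  refine integral_congr_ae (Eventually.of_forall fun p => ?_)
  simp only [radial, inner_smul_left, inner_smul_right, smul_eq_mul, RCLike.inner_apply, map_mul,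
    inner_conj_symm]
  ring

/-- Translations act strongly continuously on L², and at t = 0 the form is the squared norm. -/
theorem tendsto_shiftForm (hd : 0 < d) {δ : ℝ} (hδ : 0 < δ) {n : ℕ}
    {G : (Fin (n + 1) → Mom d) → 𝒦} (hG : MemLp G 2 volume) :
    Tendsto (fun t => (shiftForm δ t G G).re) (𝓝 0)
      (𝓝 (l2norm (radial (cutoff δ) G) (polarVolume d n) ^ 2)) := by
  have hφ := memLp_cut hd hδ hG
  let S : ℝ → C((ℝ × Sphere d) × (Fin n → Mom d), (ℝ × Sphere d) × (Fin n → Mom d)) :=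
    fun t => ⟨shift t, by unfold shift; fun_prop⟩
  have hS : Continuous S := by
    refine ContinuousMap.continuous_of_continuous_uncurry _ ?_
    show Continuous fun x : ℝ × ((ℝ × Sphere d) × (Fin n → Mom d)) => shift x.1 x.2
    unfold shift; fun_prop
  have hc : Continuous fun t => ⟪hφ.toLp, Lp.compMeasurePreserving (S t)
      (measurePreserving_shift t) hφ.toLp⟫_ℂ :=
    continuous_const.inner (Continuous.compMeasurePreservingLp (f := fun _ => hφ.toLp)
      continuous_const hS (fun t => measurePreserving_shift t) (by norm_num))
  have he : ∀ t, ⟪hφ.toLp, Lp.compMeasurePreserving (S t)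
      (measurePreserving_shift t) hφ.toLp⟫_ℂ = shiftForm δ t G G := fun t => by
    rw [L2.inner_def, shiftForm]
    refine integral_congr_ae ?_
    filter_upwards [hφ.coeFn_toLp, Lp.coeFn_compMeasurePreserving hφ.toLp
      (measurePreserving_shift t), (measurePreserving_shift t).quasiMeasurePreserving.ae
        hφ.coeFn_toLp] with p h1 h2 h3
    have h2' : (Lp.compMeasurePreserving (S t) (measurePreserving_shift t) hφ.toLp) p =
      (hφ.toLp) (shift t p) := h2
    rw [h2', h1, h3]
  simp only [he] at hc
  have h0 : (shiftForm δ 0 G G).re = l2norm (radial (cutoff δ) G) (polarVolume d n) ^ 2 := by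
    have h1 : shiftForm δ 0 G G =
        ∫ p, ⟪radial (cutoff δ) G p, radial (cutoff δ) G p⟫_ℂ ∂polarVolume d n := by
      simp [shiftForm, shift]
    rw [h1, integral_inner_self, Complex.ofReal_re, l2norm_sq hφ]
  rw [← h0]
  exact (Complex.continuous_re.comp hc).tendsto 0

/-- Twice the matrix element of the antisymmetric difference of radial translations. -/
def diffForm (δ t : ℝ) {n : ℕ} (G H : (Fin (n + 1) → Mom d) → 𝒦) : ℂ :=
  shiftForm δ t G H - shiftForm δ (-t) G H

/-- Conjugation exchanges t and −t, so the difference is anti-Hermitian. This sign makes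
annihilation and creation terms of neighbouring sectors cancel in the virial sum. -/
theorem re_diffForm_comm (δ t : ℝ) {n : ℕ} (G H : (Fin (n + 1) → Mom d) → 𝒦) :
    (diffForm δ t G H).re = -(diffForm δ t H G).re := by
  rw [diffForm, diffForm, shiftForm_conj δ t G H, shiftForm_conj δ (-t) G H, neg_neg]
  simp

/-- The commutator of the free Hamiltonian with the difference of radial translations. -/
theorem re_diffForm_fibre (hd : 0 < d) {δ : ℝ} (hδ : 0 < δ) (t : ℝ) {K : 𝒦 →ₗ[ℂ] 𝒦}
    (hK : K.IsSymmetric) (E : ℝ) {n : ℕ} {ψ : (Fin (n + 1) → Mom d) → 𝒦}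
    (hψ : MemLp ψ 2 volume) (hAψ : MemLp (fun k => fibre K E k (ψ k)) 2 volume) :
    (diffForm δ t (fun k => fibre K E k (ψ k)) ψ).re = -t * (shiftForm δ t ψ ψ).re := by
  set φ := radial (cutoff δ) ψ with hφ
  -- The energy is continued to negative radii as r rather than |r|, so translation by t changes it
  -- by exactly t everywhere; the cut wave function vanishes there, so the continuation is harmless.
  set A : (ℝ × Sphere d) × (Fin n → Mom d) → 𝒦 →ₗ[ℂ] 𝒦 := fun p =>
    K + ((p.1.1 + ∑ j, ‖p.2 j‖ - E : ℝ) : ℂ) • LinearMap.id with hA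
  have hcut : ∀ p, radial (cutoff δ) (fun k => fibre K E k (ψ k)) p = A p (φ p) := fun p => by
    by_cases h : 0 < p.1.1
    · have h1 : ∑ j, ‖polarCons p j‖ = p.1.1 + ∑ j, ‖p.2 j‖ := by
        rw [Fin.sum_univ_succ, norm_polarCons_zero h.le]
        simp [polarCons]
      simp only [hφ, radial, map_smul, fibre, hA, h1]
    · simp [hφ, radial, polarWeight, h]
  have hsymm : ∀ p x y, ⟪A p x, y⟫_ℂ = ⟪x, A p y⟫_ℂ := fun p x y => by
    simp only [hA, LinearMap.add_apply, LinearMap.smul_apply, LinearMap.id_apply, inner_add_left,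
      inner_add_right, inner_smul_left, inner_smul_right, Complex.conj_ofReal]
    rw [hK x y]
  have hshift : ∀ p x, A (shift t p) x = A p x + (t : ℂ) • x := fun p x => by
    simp only [hA, shift, LinearMap.add_apply, LinearMap.smul_apply, LinearMap.id_apply]
    push_cast
    module
  have h1 : shiftForm δ (-t) (fun k => fibre K E k (ψ k)) ψ =
      (∫ p, ⟪φ (shift t p), A p (φ p)⟫_ℂ ∂polarVolume d n) +
        t * ∫ p, ⟪φ (shift t p), φ p⟫_ℂ ∂polarVolume d n := by
    have i1 : Integrable (fun p => ⟪φ (shift t p), A p (φ p)⟫_ℂ) (polarVolume d n) := by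
      have := integrable_inner (memLp_cut_shift hd hδ t hψ) (memLp_cut hd hδ hAψ)
      simpa only [hcut] using this
    have i2 : Integrable (fun p => ⟪φ (shift t p), φ p⟫_ℂ) (polarVolume d n) :=
      integrable_inner (memLp_cut_shift hd hδ t hψ) (memLp_cut hd hδ hψ)
    rw [shiftForm_eq_integral_left, neg_neg, ← integral_const_mul,
      ← integral_add i1 (i2.const_mul _)]
    refine integral_congr_ae (Eventually.of_forall fun p => ?_)
    simp only [hcut, hshift, inner_add_left, inner_smul_left, Complex.conj_ofReal, hsymm]
    rfl
  have h2 : (shiftForm δ t (fun k => fibre K E k (ψ k)) ψ).re =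
      (∫ p, ⟪φ (shift t p), A p (φ p)⟫_ℂ ∂polarVolume d n).re := by
    rw [shiftForm, re_integral_inner_comm]
    simp only [hcut]
    rfl
  have h3 : (shiftForm δ t ψ ψ).re = (∫ p, ⟪φ (shift t p), φ p⟫_ℂ ∂polarVolume d n).re := by
    rw [shiftForm, re_integral_inner_comm]
  rw [diffForm, Complex.sub_re, h1, h2, h3]
  simp

theorem measurePreserving_insertNth_polar {n : ℕ} (i : Fin (n + 1)) :
    MeasurePreserving (fun x : ((ℝ × Sphere d) × (Fin n → Mom d)) × Mom d =>
      (x.1.1, (i.insertNth x.2 x.1.2 : Fin (n + 1) → Mom d)))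
      ((polarVolume d n).prod volume) (polarVolume d (n + 1)) :=
  ((MeasurePreserving.id (lineSphere d)).prod (measurePreserving_insertNth i)).comp
    (measurePreserving_prodAssoc (lineSphere d) volume volume)

/-- Creating a boson that is not translated is adjoint to annihilating it. -/
theorem shiftForm_tensorAt_succ (hd : 0 < d) {δ : ℝ} (hδ : 0 < δ) (s : ℝ) {n : ℕ}
    (i : Fin (n + 1)) {c : (Fin (n + 1) → Mom d) → ℂ} {g : Mom d → 𝒦}
    {H : (Fin (n + 2) → Mom d) → 𝒦} (hc : MemLp c 2 volume) (hg : MemLp g 2 volume)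
    (hH : MemLp H 2 volume)
    (hsymm : ∀ σ : Equiv.Perm (Fin (n + 2)), (fun k => H (k ∘ σ)) =ᵐ[volume] H) :
    shiftForm δ s (tensorAt i.succ c g) H = shiftForm δ s c (contract g H) := by
  -- Permutation symmetry of H brings the created, untranslated boson to the front, where `contract`
  -- integrates it out.
  set σ : Equiv.Perm (Fin (n + 2)) := i.succ.cycleRange.symm
  rw [← shiftForm_congr_right hd δ s _ (hsymm σ)]
  have hHσ : MemLp (fun k => H (k ∘ σ)) 2 volume := (memLp_congr_ae (hsymm σ)).2 hH
  have hint := integrable_shiftForm hd hδ s (memLp_tensorAt i.succ hc hg) hHσ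
  have hmp := measurePreserving_insertNth_polar (d := d) i
  have hint' := hmp.integrable_comp_of_integrable hint
  rw [shiftForm, shiftForm, ← hmp.map_eq, integral_map hmp.aemeasurable
    (by rw [hmp.map_eq]; exact hint.aestronglyMeasurable)]
  refine (integral_prod _ hint').trans ?_
  refine integral_congr_ae (Eventually.of_forall fun p => ?_)
  have hL : ∀ q : Mom d, radial (cutoff δ) (tensorAt i.succ c g)
      (p.1, (i.insertNth q p.2 : Fin (n + 1) → Mom d)) = (radial (cutoff δ) c p) • g q := fun q => by
    simp only [radial, tensorAt, polarCons, cons_insertNth]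
    rw [Fin.insertNth_apply_same, Fin.removeNth_insertNth, smul_smul, smul_eq_mul]
  have hR : ∀ q : Mom d, radial (cutoff δ) (fun k => H (k ∘ σ))
      (shift s (p.1, (i.insertNth q p.2 : Fin (n + 1) → Mom d))) =
      ((cutoff δ (p.1.1 + s) * polarWeight d (p.1.1 + s) : ℝ) : ℂ) •
        H (Fin.cons q (polarCons (shift s p))) := fun q => by
    simp only [radial, polarCons, shift, cons_insertNth]
    rw [insertNth_comp_cycleRange_symm]
  simp only [Function.comp_apply, hL, hR, inner_smul_left, inner_smul_right]
  rw [integral_const_mul, integral_const_mul]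
  simp only [radial, contract, RCLike.inner_apply, smul_eq_mul, shift]
  ring

end ShiftForm

/-! ### Difference quotients of the form factor, uniformly in the cutoff. -/

section OneBody

variable {d : ℕ} {𝒦 : Type*} [NormedAddCommGroup 𝒦] [InnerProductSpace ℂ 𝒦]

/-- A one-boson function in polar coordinates, multiplied by a function of the radius and
extended by zero to negative radii. -/
def oneRadial (w : ℝ → ℝ) (g : Mom d → 𝒦) : ℝ × Sphere d → 𝒦 := fun q =>
  ((w q.1 * polarWeight d q.1 : ℝ) : ℂ) • g (q.1 • (q.2 : Mom d))

theorem radial_tensorAt_zero (w : ℝ → ℝ) {n : ℕ} (c : (Fin n → Mom d) → ℂ) (g : Mom d → 𝒦)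
    (p : (ℝ × Sphere d) × (Fin n → Mom d)) :
    radial w (tensorAt 0 c g) p = c p.2 • oneRadial w g p.1 := by
  have h : (Fin.removeNth 0 (polarCons p) : Fin n → Mom d) = p.2 := by
    funext j; simp [polarCons, Fin.removeNth]
  simp only [radial, tensorAt, oneRadial, h]
  rw [smul_comm]
  rfl

theorem measurable_ofReal_polarWeight :
    Measurable fun q : ℝ × Sphere d => ENNReal.ofReal (polarWeight d q.1 ^ 2) :=
  ((measurable_polarWeight.comp measurable_fst).pow_const 2).ennreal_ofReal

theorem ae_polar (hd : 0 < d) {P : Mom d → Prop} (h : ∀ᵐ x, P x) :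
    ∀ᵐ q ∂lineSphere d, 0 < q.1 → P (q.1 • (q.2 : Mom d)) := by
  have h1 := (measurePreserving_polar hd).quasiMeasurePreserving.ae h
  rw [ae_withDensity_iff measurable_ofReal_polarWeight] at h1
  filter_upwards [h1] with q hq h0
  refine hq ?_
  have : 0 < polarWeight d q.1 := by
    rw [polarWeight, if_pos h0]; exact Real.rpow_pos_of_pos h0 _
  rw [Ne, ENNReal.ofReal_eq_zero, not_le]
  positivity

theorem oneRadial_of_nonpos (w : ℝ → ℝ) (g : Mom d → 𝒦) {q : ℝ × Sphere d} (hq : ¬ 0 < q.1) :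
    oneRadial w g q = 0 := by simp [oneRadial, polarWeight, hq]

theorem aestronglyMeasurable_oneRadial (hd : 0 < d) {w : ℝ → ℝ} (hw : Measurable w)
    {g : Mom d → 𝒦} (hg : AEStronglyMeasurable g volume) :
    AEStronglyMeasurable (oneRadial w g) (lineSphere d) := by
  have h : oneRadial w (hg.mk g) =ᵐ[lineSphere d] oneRadial w g := by
    filter_upwards [ae_polar hd hg.ae_eq_mk] with q hq
    by_cases h0 : 0 < q.1
    · simp only [oneRadial, hq h0]
    · rw [oneRadial_of_nonpos _ _ h0, oneRadial_of_nonpos _ _ h0]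
  refine AEStronglyMeasurable.congr (StronglyMeasurable.aestronglyMeasurable ?_) h
  refine StronglyMeasurable.smul ?_
    (hg.stronglyMeasurable_mk.comp_measurable (measurePreserving_polar hd).measurable)
  exact (Complex.measurable_ofReal.comp ((hw.mul (measurable_polarWeight (d := d))).comp
    measurable_fst)).stronglyMeasurable

theorem eLpNorm_oneRadial_one (hd : 0 < d) {g : Mom d → 𝒦} (hg : AEStronglyMeasurable g volume) :
    eLpNorm (oneRadial (fun _ => 1) g) 2 (lineSphere d) = eLpNorm g 2 volume := by
  refine (ENNReal.pow_right_strictMono (n := 2) (by norm_num)).injective ?_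
  have hmp := measurePreserving_polar hd
  show eLpNorm (oneRadial (fun _ => 1) g) 2 (lineSphere d) ^ 2 = eLpNorm g 2 volume ^ 2
  rw [eLpNorm_two_sq, eLpNorm_two_sq, ← hmp.map_eq,
    lintegral_map' (by rw [hmp.map_eq]; exact hg.enorm.pow_const 2) hmp.aemeasurable,
    lintegral_withDensity_eq_lintegral_mul_non_measurable _ measurable_ofReal_polarWeight
      (Eventually.of_forall fun p => ENNReal.ofReal_lt_top)]
  refine lintegral_congr fun q => ?_
  simp only [Pi.mul_apply, oneRadial, one_mul]
  rw [enorm_smul, mul_pow]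
  congr 1
  rw [← ofReal_norm, Complex.norm_real, Real.norm_of_nonneg (polarWeight_nonneg _),
    ← ENNReal.ofReal_pow (polarWeight_nonneg _)]

theorem memLp_oneRadial_one (hd : 0 < d) {g : Mom d → 𝒦} (hg : MemLp g 2 volume) :
    MemLp (oneRadial (fun _ => 1) g) 2 (lineSphere d) :=
  ⟨aestronglyMeasurable_oneRadial hd measurable_const hg.1, by
    rw [eLpNorm_oneRadial_one hd hg.1]; exact hg.2⟩

theorem eLpNorm_polarMeasure_eq {F : ℝ × Sphere d → 𝒦} (hF : ∀ q, ¬ 0 < q.1 → F q = 0) :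
    eLpNorm F 2 (polarMeasure d) = eLpNorm F 2 (lineSphere d) := by
  have h1 : polarMeasure d = (lineSphere d).restrict (Set.Ioi 0 ×ˢ Set.univ) := by
    rw [polarMeasure, lineSphere, ← Measure.prod_restrict, Measure.restrict_univ]
  rw [h1, ← eLpNorm_indicator_eq_eLpNorm_restrict (measurableSet_Ioi.prod MeasurableSet.univ)]
  congr 1
  funext q
  by_cases h : 0 < q.1
  · rw [Set.indicator_of_mem (by simpa using h)]
  · rw [Set.indicator_of_notMem (by simpa using h), hF q h]

theorem polarMeasure_ae_pos : ∀ᵐ q ∂polarMeasure d, 0 < q.1 := by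
  have h := ae_restrict_mem (μ := (volume : Measure ℝ)) (measurableSet_Ioi (a := (0 : ℝ)))
  exact (Measure.quasiMeasurePreserving_fst (ν := sphereMeasure d)).ae h

theorem polar_eq_oneRadial {g : Mom d → 𝒦} {q : ℝ × Sphere d} (hq : 0 < q.1) :
    polar g q = oneRadial (fun _ => 1) g q := by
  simp [polar, oneRadial, polarWeight, hq]

theorem lintegral_sq_le {X : Type*} [MeasurableSpace X] {μ : Measure X} {f : X → ℝ≥0∞}
    (hf : AEMeasurable f μ) : (∫⁻ x, f x ∂μ) ^ 2 ≤ μ Set.univ * ∫⁻ x, f x ^ 2 ∂μ := by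
  have h := ENNReal.lintegral_mul_le_Lp_mul_Lq μ (p := 2) (q := 2)
    ⟨by norm_num, by norm_num, by norm_num⟩ hf (aemeasurable_const (b := (1 : ℝ≥0∞)))
  have h2 : ∀ x : ℝ≥0∞, (x ^ (1 / 2 : ℝ)) ^ 2 = x := fun x => by
    rw [← ENNReal.rpow_natCast, ← ENNReal.rpow_mul]; norm_num
  calc (∫⁻ x, f x ∂μ) ^ 2 ≤ ((∫⁻ x, f x ^ (2 : ℝ) ∂μ) ^ (1 / 2 : ℝ) *
        (∫⁻ _, 1 ^ (2 : ℝ) ∂μ) ^ (1 / 2 : ℝ)) ^ 2 := by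
        gcongr
        simpa using h
    _ = _ := by
      rw [mul_pow, h2, h2, mul_comm]
      simp

/-- The difference quotient bound for sums of products of a smooth function of the radius and a
function of the angle. -/
theorem eLpNorm_smooth_diff_le [CompleteSpace 𝒦] {m : ℕ} {u : Fin m → ℝ → ℂ} {v : Fin m → Sphere d → 𝒦}
    (hu : ∀ j, ContDiff ℝ ∞ (u j)) (hv : ∀ j, MemLp (v j) 2 (sphereMeasure d)) {t : ℝ}
    (ht : 0 ≤ t) :
    eLpNorm (fun q : ℝ × Sphere d => ∑ j, u j (q.1 + t) • v j q.2 - ∑ j, u j (q.1 - t) • v j q.2)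
      2 (lineSphere d) ≤ ENNReal.ofReal (2 * t) *
    eLpNorm (fun q : ℝ × Sphere d => ∑ j, deriv (u j) q.1 • v j q.2) 2 (lineSphere d) := by
  have hdc : ∀ j, Continuous (deriv (u j)) := fun j => (hu j).continuous_deriv (by simp)
  have hG : ∀ θ : Sphere d, Continuous fun r : ℝ => ∑ j, deriv (u j) r • v j θ := fun θ => by
    exact continuous_finsetSum _ fun j _ => (hdc j).smul continuous_const
  -- The difference is the integral of the derivative over an interval of length 2t. Cauchy–Schwarz
  -- costs one factor 2t here; Fubini and translation invariance produce the second one below.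
  have hpt : ∀ q : ℝ × Sphere d, ‖∑ j, u j (q.1 + t) • v j q.2 - ∑ j, u j (q.1 - t) • v j q.2‖ₑ ^ 2
      ≤ ENNReal.ofReal (2 * t) * ∫⁻ s in Set.Ioc (-t) t,
        ‖∑ j, deriv (u j) (q.1 + s) • v j q.2‖ₑ ^ 2 := fun q => by
    have hder : ∀ r : ℝ, HasDerivAt (fun r => ∑ j, u j r • v j q.2)
        (∑ j, deriv (u j) r • v j q.2) r := fun r => by
      refine HasDerivAt.fun_sum fun j _ => ?_
      exact (((hu j).differentiable (by simp)) r).hasDerivAt.smul_const _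
    have hftc : ∑ j, u j (q.1 + t) • v j q.2 - ∑ j, u j (q.1 - t) • v j q.2 =
        ∫ s in (-t)..t, ∑ j, deriv (u j) (q.1 + s) • v j q.2 := by
      rw [intervalIntegral.integral_comp_add_left (fun r => ∑ j, deriv (u j) r • v j q.2) q.1,
        intervalIntegral.integral_eq_sub_of_hasDerivAt (fun r _ => hder r)
          ((hG q.2).intervalIntegrable _ _)]
      rfl
    have hvol : (volume.restrict (Set.Ioc (-t) t)) Set.univ = ENNReal.ofReal (2 * t) := by
      rw [Measure.restrict_apply_univ, Real.volume_Ioc]; congr 1; ring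
    rw [hftc, intervalIntegral.integral_of_le (by linarith), ← hvol]
    refine le_trans ?_ (lintegral_sq_le ?_)
    · gcongr
      exact enorm_integral_le_lintegral_enorm _
    · exact (((hG q.2).comp (continuous_const.add continuous_id)).enorm).aemeasurable
  have hmeas : AEStronglyMeasurable (fun x : (ℝ × Sphere d) × ℝ =>
      ∑ j, deriv (u j) (x.1.1 + x.2) • v j x.1.2)
      ((lineSphere d).prod (volume.restrict (Set.Ioc (-t) t))) := by
    refine Finset.aestronglyMeasurable_fun_sum _ fun j _ => ?_
    refine AEStronglyMeasurable.smul ?_ ((hv j).1.comp_snd.comp_fst)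
    exact ((hdc j).comp (by fun_prop : Continuous fun x : (ℝ × Sphere d) × ℝ =>
      x.1.1 + x.2)).aestronglyMeasurable
  have hmeas' : AEStronglyMeasurable (fun q : ℝ × Sphere d =>
      ∑ j, deriv (u j) q.1 • v j q.2) (lineSphere d) := by
    refine Finset.aestronglyMeasurable_fun_sum _ fun j _ => ?_
    exact AEStronglyMeasurable.smul ((hdc j).comp continuous_fst).aestronglyMeasurable
      (hv j).1.comp_snd
  rw [← ENNReal.pow_le_pow_left_iff (n := 2) (by norm_num), mul_pow, eLpNorm_two_sq,
    eLpNorm_two_sq]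
  calc _ ≤ ∫⁻ q, ENNReal.ofReal (2 * t) * (∫⁻ s in Set.Ioc (-t) t,
        ‖∑ j, deriv (u j) (q.1 + s) • v j q.2‖ₑ ^ 2) ∂lineSphere d := lintegral_mono hpt
    _ = ENNReal.ofReal (2 * t) * ∫⁻ q, (∫⁻ s in Set.Ioc (-t) t,
        ‖∑ j, deriv (u j) (q.1 + s) • v j q.2‖ₑ ^ 2) ∂lineSphere d :=
      lintegral_const_mul' _ _ ENNReal.ofReal_ne_top
    _ = ENNReal.ofReal (2 * t) * ∫⁻ s in Set.Ioc (-t) t, ∫⁻ q,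
        ‖∑ j, deriv (u j) (q.1 + s) • v j q.2‖ₑ ^ 2 ∂lineSphere d := by
      rw [lintegral_lintegral_swap (hmeas.enorm.pow_const 2)]
    _ = ENNReal.ofReal (2 * t) * ∫⁻ _ in Set.Ioc (-t) t, ∫⁻ q,
        ‖∑ j, deriv (u j) q.1 • v j q.2‖ₑ ^ 2 ∂lineSphere d := by
      congr 1
      refine lintegral_congr fun s => ?_
      have h := measurePreserving_lineShift (d := d) s
      conv_rhs => rw [← h.map_eq]
      rw [lintegral_map' (by rw [h.map_eq]; exact hmeas'.enorm.pow_const 2) h.aemeasurable]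
    _ = _ := by
      rw [lintegral_const, Measure.restrict_apply_univ, Real.volume_Ioc, sub_neg_eq_add, ← two_mul]
      ring

/-- The difference quotient bound for functions with a radial derivative. -/
theorem eLpNorm_diff_le_of_hasRadialDeriv [CompleteSpace 𝒦] (hd : 0 < d) {f g : OneBoson 𝒦 d}
    (h : HasRadialDeriv f g) {t : ℝ} (ht : 0 ≤ t) :
    eLpNorm (fun q : ℝ × Sphere d => oneRadial (fun _ => 1) f (q.1 + t, q.2) -
      oneRadial (fun _ => 1) f (q.1 - t, q.2)) 2 (lineSphere d) ≤
    ENNReal.ofReal (2 * t) * eLpNorm g 2 volume := by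
  -- The two translated copies of f contribute an approximation error ε each, and the derivative
  -- contributes 2tε.
  have key : ∀ ε : ℝ≥0∞, 0 < ε → eLpNorm (fun q : ℝ × Sphere d =>
      oneRadial (fun _ => 1) f (q.1 + t, q.2) - oneRadial (fun _ => 1) f (q.1 - t, q.2)) 2
      (lineSphere d) ≤ ENNReal.ofReal (2 * t) * eLpNorm g 2 volume +
        (2 + ENNReal.ofReal (2 * t)) * ε := fun ε hε => by
    obtain ⟨m, u, v, hu, hv, h1, h2⟩ := h ε hε
    set F := oneRadial (fun _ => 1) (f : Mom d → 𝒦) with hF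
    set G := oneRadial (fun _ => 1) (g : Mom d → 𝒦) with hG
    set Fj : ℝ × Sphere d → 𝒦 := fun q => ∑ j, u j q.1 • v j q.2 with hFj
    set Gj : ℝ × Sphere d → 𝒦 := fun q => ∑ j, deriv (u j) q.1 • v j q.2 with hGj
    -- The approximants are supported in (0, ∞), so extending by zero to r ≤ 0 creates no jump at
    -- the origin: this is the boundary condition encoded in Ḣ¹.
    have hu0 : ∀ j r, ¬ 0 < r → u j r = 0 := fun j r hr =>
      image_eq_zero_of_notMem_tsupport fun hmem => hr ((hu j).2.2 hmem)
    have hu0' : ∀ j r, ¬ 0 < r → deriv (u j) r = 0 := fun j r hr =>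
      image_eq_zero_of_notMem_tsupport fun hmem =>
        hr ((hu j).2.2 (tsupport_deriv_subset hmem))
    have hFm : AEStronglyMeasurable F (lineSphere d) :=
      aestronglyMeasurable_oneRadial hd measurable_const (Lp.memLp f).1
    have hGm : AEStronglyMeasurable G (lineSphere d) :=
      aestronglyMeasurable_oneRadial hd measurable_const (Lp.memLp g).1
    have hdc : ∀ j, Continuous (deriv (u j)) := fun j => (hu j).1.continuous_deriv (by simp)
    have hFjm : AEStronglyMeasurable Fj (lineSphere d) := by
      refine Finset.aestronglyMeasurable_fun_sum _ fun j _ => ?_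
      exact AEStronglyMeasurable.smul ((hu j).1.continuous.comp continuous_fst).aestronglyMeasurable
        (hv j).1.comp_snd
    have hGjm : AEStronglyMeasurable Gj (lineSphere d) := by
      refine Finset.aestronglyMeasurable_fun_sum _ fun j _ => ?_
      exact AEStronglyMeasurable.smul ((hdc j).comp continuous_fst).aestronglyMeasurable
        (hv j).1.comp_snd
    have e1 : eLpNorm (F - Fj) 2 (lineSphere d) ≤ ε := by
      rw [← eLpNorm_polarMeasure_eq fun q hq => by
        simp only [Pi.sub_apply, hF, hFj, oneRadial_of_nonpos _ _ hq, zero_sub, neg_eq_zero]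
        exact Finset.sum_eq_zero fun j _ => by rw [hu0 j _ hq, zero_smul]]
      refine le_of_eq_of_le (eLpNorm_congr_ae ?_) h1.le
      filter_upwards [polarMeasure_ae_pos] with q hq
      simp only [Pi.sub_apply, hF, hFj, polar_eq_oneRadial hq]
    have e2 : eLpNorm (Gj - G) 2 (lineSphere d) ≤ ε := by
      rw [eLpNorm_sub_comm, ← eLpNorm_polarMeasure_eq fun q hq => by
        simp only [Pi.sub_apply, hG, hGj, oneRadial_of_nonpos _ _ hq, zero_sub, neg_eq_zero]
        exact Finset.sum_eq_zero fun j _ => by rw [hu0' j _ hq, zero_smul]]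
      refine le_of_eq_of_le (eLpNorm_congr_ae ?_) h2.le
      filter_upwards [polarMeasure_ae_pos] with q hq
      simp only [Pi.sub_apply, hG, hGj, polar_eq_oneRadial hq]
    have e3 : eLpNorm Gj 2 (lineSphere d) ≤ eLpNorm g 2 volume + ε := by
      have : Gj = G + (Gj - G) := by abel
      rw [this]
      refine (eLpNorm_add_le hGm (hGjm.sub hGm) (by norm_num)).trans ?_
      rw [hG, eLpNorm_oneRadial_one hd (Lp.memLp g).1]
      gcongr
    have e4 := eLpNorm_smooth_diff_le (fun j => (hu j).1) hv ht
    have hsh : ∀ s, eLpNorm (fun q : ℝ × Sphere d => (F - Fj) (q.1 + s, q.2)) 2 (lineSphere d) =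
        eLpNorm (F - Fj) 2 (lineSphere d) := fun s =>
      eLpNorm_comp_measurePreserving (hFm.sub hFjm) (measurePreserving_lineShift s)
    have hdec : (fun q : ℝ × Sphere d => F (q.1 + t, q.2) - F (q.1 - t, q.2)) =
        ((fun q : ℝ × Sphere d => (F - Fj) (q.1 + t, q.2)) -
          fun q : ℝ × Sphere d => (F - Fj) (q.1 + (-t), q.2)) +
        fun q : ℝ × Sphere d => Fj (q.1 + t, q.2) - Fj (q.1 + (-t), q.2) := by
      funext q
      simp only [Pi.add_apply, Pi.sub_apply, sub_eq_add_neg q.1]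
      abel
    have hms : ∀ s, AEStronglyMeasurable (fun q : ℝ × Sphere d => (F - Fj) (q.1 + s, q.2))
        (lineSphere d) := fun s =>
      (hFm.sub hFjm).comp_measurePreserving (measurePreserving_lineShift s)
    have hms' : ∀ s, AEStronglyMeasurable (fun q : ℝ × Sphere d => Fj (q.1 + s, q.2))
        (lineSphere d) := fun s => hFjm.comp_measurePreserving (measurePreserving_lineShift s)
    rw [hdec]
    refine (eLpNorm_add_le ((hms t).sub (hms _)) ((hms' t).sub (hms' _)) (by norm_num)).trans ?_
    have e5 := eLpNorm_sub_le (μ := lineSphere d) (hms t) (hms (-t)) (p := 2) (by norm_num)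
    rw [hsh, hsh] at e5
    have e6 : eLpNorm (fun q : ℝ × Sphere d => Fj (q.1 + t, q.2) - Fj (q.1 + (-t), q.2)) 2
        (lineSphere d) ≤ ENNReal.ofReal (2 * t) * (eLpNorm g 2 volume + ε) :=
      e4.trans (by gcongr)
    calc _ ≤ (ε + ε) + ENNReal.ofReal (2 * t) * (eLpNorm g 2 volume + ε) := by
          exact add_le_add (e5.trans (by gcongr)) e6
      _ = _ := by ring
  refine ENNReal.le_of_forall_pos_le_add fun ε hε _ => ?_
  have h2 : (2 + ENNReal.ofReal (2 * t)) ≠ 0 := by simp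
  have h3 : (2 + ENNReal.ofReal (2 * t)) ≠ ⊤ :=
    ENNReal.add_ne_top.2 ⟨by norm_num, ENNReal.ofReal_ne_top⟩
  have h4 := key (ε / (2 + ENNReal.ofReal (2 * t))) (ENNReal.div_pos (by simpa using hε.ne') h3)
  rwa [ENNReal.mul_div_cancel h2 h3] at h4

/-- Finite difference version of χ' = δ/r² ≤ 1/r on r > δ. The bound does not involve δ, which keeps
the number estimate uniform while the cutoff is removed. -/
theorem abs_cutoff_sub_le {δ t r : ℝ} (hδ : 0 < δ) (ht : 0 ≤ t) (hr : 0 < r - t) :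
    |cutoff δ (r + t) - cutoff δ (r - t)| ≤ 2 * t * (r - t)⁻¹ := by
  have hrt : 0 < r + t := by linarith
  have h0 : 0 ≤ 2 * t * (r - t)⁻¹ := by positivity
  by_cases h1 : r + t ≤ δ
  · rw [cutoff, cutoff, if_pos h1, if_pos (by linarith)]
    simpa using h0
  push Not at h1
  by_cases h2 : r - t ≤ δ
  · rw [cutoff, cutoff, if_neg (not_le.2 h1), if_pos h2, sub_zero, abs_of_nonneg (by
      rw [sub_nonneg, div_le_one hrt]; exact h1.le), ← div_eq_mul_inv, one_sub_div hrt.ne']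
    exact div_le_div₀ (by linarith) (by linarith) hr (by linarith)
  · push Not at h2
    have h3 : 1 - δ / (r + t) - (1 - δ / (r - t)) = (2 * t * (r - t)⁻¹) * (δ / (r + t)) := by
      field_simp; ring
    rw [cutoff, cutoff, if_neg (not_le.2 h1), if_neg (not_le.2 h2), h3, abs_of_nonneg
      (by positivity)]
    exact mul_le_of_le_one_right h0 ((div_le_one hrt).2 h1.le)

theorem oneRadial_eq_smul (w : ℝ → ℝ) (g : Mom d → 𝒦) (q : ℝ × Sphere d) :
    oneRadial w g q = (w q.1 : ℂ) • oneRadial (fun _ => 1) g q := by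
  simp only [oneRadial, one_mul, smul_smul, Complex.ofReal_mul]

/-- A discrete product rule, with the variation of the cutoff charged to f/r. The condition 2t < δ
settles the radii r ≤ t: there r + t ≤ 2t < δ, so both cut terms vanish. -/
theorem norm_cut_diff_le {δ t : ℝ} (hδ : 0 < δ) (ht : 0 ≤ t) (htδ : 2 * t < δ) (f : Mom d → 𝒦)
    (q : ℝ × Sphere d) :
    ‖oneRadial (cutoff δ) f (q.1 + t, q.2) - oneRadial (cutoff δ) f (q.1 - t, q.2)‖ ≤
      ‖oneRadial (fun _ => 1) f (q.1 + t, q.2) - oneRadial (fun _ => 1) f (q.1 - t, q.2)‖ +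
        2 * t * ‖oneRadial (fun r => r⁻¹) f (q.1 - t, q.2)‖ := by
  by_cases h : 0 < q.1 - t
  · rw [oneRadial_eq_smul (cutoff δ), oneRadial_eq_smul (cutoff δ),
      oneRadial_eq_smul fun r => r⁻¹]
    simp only
    set A := oneRadial (fun _ => 1) f (q.1 + t, q.2)
    set B := oneRadial (fun _ => 1) f (q.1 - t, q.2)
    have h1 : (cutoff δ (q.1 + t) : ℂ) • A - (cutoff δ (q.1 - t) : ℂ) • B =
        (cutoff δ (q.1 + t) : ℂ) • (A - B) +
          ((cutoff δ (q.1 + t) - cutoff δ (q.1 - t) : ℝ) : ℂ) • B := by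
      push_cast; module
    rw [h1]
    refine (norm_add_le _ _).trans ?_
    rw [norm_smul, norm_smul, norm_smul, Complex.norm_real, Complex.norm_real, Complex.norm_real,
      Real.norm_eq_abs, Real.norm_eq_abs, Real.norm_eq_abs, abs_of_pos (inv_pos.2 h), ← mul_assoc]
    gcongr
    · exact mul_le_of_le_one_left (norm_nonneg _) (abs_cutoff_le hδ _)
    · exact abs_cutoff_sub_le hδ ht h
  · have h1 : cutoff δ (q.1 + t) = 0 := by rw [cutoff, if_pos (by linarith)]
    have h2 : oneRadial (cutoff δ) f (q.1 - t, q.2) = 0 := oneRadial_of_nonpos _ _ h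
    rw [h2, oneRadial_eq_smul, h1]
    simp only [Complex.ofReal_zero, zero_smul, sub_zero, norm_zero]
    positivity

theorem l2norm_cut_diff_le [CompleteSpace 𝒦] (hd : 0 < d) {f g : OneBoson 𝒦 d}
    (h : HasRadialDeriv f g) (hinv : MemLp (oneRadial (fun r => r⁻¹) f) 2 (lineSphere d))
    {δ t : ℝ} (hδ : 0 < δ) (ht : 0 ≤ t) (htδ : 2 * t < δ) :
    l2norm (fun q : ℝ × Sphere d => oneRadial (cutoff δ) f (q.1 + t, q.2) -
      oneRadial (cutoff δ) f (q.1 - t, q.2)) (lineSphere d) ≤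
    2 * t * (‖g‖ + l2norm (oneRadial (fun r => r⁻¹) f) (lineSphere d)) := by
  set D : ℝ × Sphere d → 𝒦 := fun q => oneRadial (fun _ => 1) f (q.1 + t, q.2) -
      oneRadial (fun _ => 1) f (q.1 - t, q.2) with hD
  set I : ℝ × Sphere d → 𝒦 := fun q => oneRadial (fun r => r⁻¹) f (q.1 - t, q.2) with hI
  have hF := memLp_oneRadial_one hd (Lp.memLp f)
  have hDm : MemLp D 2 (lineSphere d) := by
    have h1 := (hF.comp_measurePreserving (measurePreserving_lineShift t)).sub
      (hF.comp_measurePreserving (measurePreserving_lineShift (-t)))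
    exact h1
  have hIm : MemLp I 2 (lineSphere d) :=
    hinv.comp_measurePreserving (measurePreserving_lineShift (-t))
  have hI2 : l2norm I (lineSphere d) = l2norm (oneRadial (fun r => r⁻¹) f) (lineSphere d) :=
    l2norm_comp hinv.1 (measurePreserving_lineShift (-t))
  have hD2 : l2norm D (lineSphere d) ≤ 2 * t * ‖g‖ := by
    refine l2norm_le_of_eLpNorm_le (by positivity)
      ((eLpNorm_diff_le_of_hasRadialDeriv hd h ht).trans_eq ?_)
    rw [eLpNorm_eq_ofReal_l2norm (Lp.memLp g), ← norm_Lp_eq_l2norm,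
      ← ENNReal.ofReal_mul (by positivity : (0 : ℝ) ≤ 2 * t)]
  have hn1 : l2norm (fun q => ‖D q‖) (lineSphere d) = l2norm D (lineSphere d) := by
    rw [l2norm, eLpNorm_norm, l2norm]
  have hn2 : l2norm (((2 * t : ℝ) : ℂ) • I) (lineSphere d) = 2 * t * l2norm I (lineSphere d) := by
    rw [l2norm_smul, Complex.norm_real, Real.norm_of_nonneg (by positivity)]
  have hn3 : l2norm (fun q => ‖(((2 * t : ℝ) : ℂ) • I) q‖) (lineSphere d) =
      2 * t * l2norm I (lineSphere d) := by
    rw [← hn2, l2norm, eLpNorm_norm, l2norm]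
  have hm2 := (hIm.const_smul ((2 * t : ℝ) : ℂ)).norm
  calc _ ≤ l2norm ((fun q => ‖D q‖) + fun q => ‖(((2 * t : ℝ) : ℂ) • I) q‖) (lineSphere d) := by
        refine l2norm_mono (hDm.norm.add hm2) (Eventually.of_forall fun q => ?_)
        refine (norm_cut_diff_le hδ ht htδ f q).trans ((le_abs_self _).trans_eq' ?_)
        simp only [Pi.add_apply, Pi.smul_apply, norm_smul, Complex.norm_real,
          Real.norm_of_nonneg (show 0 ≤ 2 * t by positivity)]
        rfl
    _ ≤ _ := by
        refine (l2norm_add_le hDm.norm hm2).trans ?_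
        rw [hn1, hn3, hI2]
        linarith

/-- Since a > 1, 1/r ≤ 1 + r^{-a}, as one sees separately for r ≥ 1 and r ≤ 1. Hypothesis (I1b) thus
controls the term f/r produced by the cutoff. -/
theorem memLp_oneRadial_inv (hd : 0 < d) {f β : OneBoson 𝒦 d} {a : ℝ} (ha : 1 < a)
    (h : ∀ᵐ k : Mom d, β k = ((‖k‖ ^ (-a) : ℝ) : ℂ) • f k) :
    MemLp (oneRadial (fun r => r⁻¹) f) 2 (lineSphere d) := by
  refine MemLp.mono ((memLp_oneRadial_one hd (Lp.memLp f)).norm.add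
    (memLp_oneRadial_one hd (Lp.memLp β)).norm)
    (aestronglyMeasurable_oneRadial hd measurable_inv (Lp.memLp f).1) ?_
  filter_upwards [ae_polar hd h] with q hq
  by_cases h0 : 0 < q.1
  · have hs : ‖(q.2 : Mom d)‖ = 1 := norm_eq_of_mem_sphere q.2
    have h1 : oneRadial (fun _ => 1) β q =
        ((q.1 ^ (-a) : ℝ) : ℂ) • oneRadial (fun _ => 1) f q := by
      simp only [oneRadial, hq h0, norm_smul, hs, mul_one, Real.norm_of_nonneg h0.le]
      rw [smul_comm]
    have h2 : q.1⁻¹ ≤ 1 + q.1 ^ (-a) := by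
      rcases le_total 1 q.1 with h3 | h3
      · have := inv_le_one_of_one_le₀ h3
        have : 0 ≤ q.1 ^ (-a) := by positivity
        linarith
      · have : q.1 ^ (-1 : ℝ) ≤ q.1 ^ (-a) :=
          Real.rpow_le_rpow_of_exponent_ge h0 h3 (by linarith)
        rw [Real.rpow_neg_one] at this
        linarith
    have h4 : 0 ≤ q.1 ^ (-a) := by positivity
    rw [oneRadial_eq_smul]
    simp only [Pi.add_apply, h1, norm_smul, Complex.norm_real]
    rw [Real.norm_of_nonneg (inv_pos.2 h0).le, Real.norm_of_nonneg h4, Real.norm_eq_abs,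
      abs_of_nonneg (by positivity)]
    nlinarith [norm_nonneg (oneRadial (fun _ => 1) (f : Mom d → 𝒦) q)]
  · rw [oneRadial_of_nonpos _ _ h0]
    simp

/-- The commutator of the creation operator with the difference of radial translations. -/
theorem norm_diffForm_tensorAt_zero_le (hd : 0 < d) {δ t : ℝ} (hδ : 0 < δ) {n : ℕ}
    {c : (Fin n → Mom d) → ℂ} {g : Mom d → 𝒦} {H : (Fin (n + 1) → Mom d) → 𝒦}
    (hc : MemLp c 2 volume) (hg : MemLp g 2 volume) (hH : MemLp H 2 volume) :
    ‖diffForm δ t (tensorAt 0 c g) H‖ ≤ l2norm (fun q : ℝ × Sphere d =>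
      oneRadial (cutoff δ) g (q.1 + t, q.2) - oneRadial (cutoff δ) g (q.1 - t, q.2))
        (lineSphere d) * l2norm c volume * l2norm (radial (cutoff δ) H) (polarVolume d n) := by
  set Δ : ℝ × Sphere d → 𝒦 := fun q =>
    oneRadial (cutoff δ) g (q.1 + t, q.2) - oneRadial (cutoff δ) g (q.1 - t, q.2) with hΔ
  have hT := memLp_tensorAt (0 : Fin (n + 1)) hc hg
  have hsub : MemLp (fun p => radial (cutoff δ) (tensorAt 0 c g) (shift (-t) p) -
      radial (cutoff δ) (tensorAt 0 c g) (shift (- -t) p)) 2 (polarVolume d n) :=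
    (memLp_cut_shift hd hδ (-t) hT).sub (memLp_cut_shift hd hδ (- -t) hT)
  -- Both translations are moved to the left argument, where they act only on the one-body function
  -- g; no regularity of H in the radius is needed.
  have h1 : diffForm δ t (tensorAt 0 c g) H =
      ∫ p, ⟪radial (cutoff δ) (tensorAt 0 c g) (shift (-t) p) -
        radial (cutoff δ) (tensorAt 0 c g) (shift (- -t) p), radial (cutoff δ) H p⟫_ℂ
          ∂polarVolume d n := by
    rw [diffForm, shiftForm_eq_integral_left, shiftForm_eq_integral_left, ← integral_sub
      (integrable_inner (memLp_cut_shift hd hδ (-t) hT) (memLp_cut hd hδ hH))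
      (integrable_inner (memLp_cut_shift hd hδ (- -t) hT) (memLp_cut hd hδ hH))]
    simp only [inner_sub_left]
  rw [h1]
  refine (norm_integral_inner_le hsub (memLp_cut hd hδ hH)).trans ?_
  refine mul_le_mul_of_nonneg_right ?_ (l2norm_nonneg _ _)
  have h2 : (fun p => radial (cutoff δ) (tensorAt 0 c g) (shift (-t) p) -
      radial (cutoff δ) (tensorAt 0 c g) (shift (- -t) p)) =
      (-1 : ℂ) • fun p : (ℝ × Sphere d) × (Fin n → Mom d) => c p.2 • Δ p.1 := by
    funext p
    simp only [radial_tensorAt_zero, shift, neg_neg, Pi.smul_apply, hΔ, ← sub_eq_add_neg]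
    module
  have hgm : AEStronglyMeasurable (oneRadial (cutoff δ) g) (lineSphere d) :=
    aestronglyMeasurable_oneRadial hd (measurable_cutoff δ) hg.1
  have hΔm : AEStronglyMeasurable Δ (lineSphere d) :=
    (hgm.comp_measurePreserving (measurePreserving_lineShift t)).sub
      (hgm.comp_measurePreserving (measurePreserving_lineShift (-t)))
  rw [h2, l2norm_smul, norm_neg, norm_one, one_mul, l2norm, eLpNorm_smul_prod hc.1 hΔm,
    ENNReal.toReal_mul, l2norm, l2norm]

end OneBody

/-! ### The commutator of translations with the creation operator. -/

section Creation

variable {d : ℕ} {𝒦 : Type*} [NormedAddCommGroup 𝒦] [InnerProductSpace ℂ 𝒦]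
  [FiniteDimensional ℂ 𝒦]

/-- The part of the creation operator in which the first boson is created, up to the factor
`(n+1)^{-1/2}`. -/
def createFirst (α : 𝒦 →L[ℂ] OneBoson 𝒦 d) {n : ℕ} (G : (Fin n → Mom d) → 𝒦) :
    (Fin (n + 1) → Mom d) → 𝒦 :=
  ∑ i, tensorAt 0 (fun z => ⟪stdOrthonormalBasis ℂ 𝒦 i, G z⟫_ℂ) (α (stdOrthonormalBasis ℂ 𝒦 i))

theorem shiftForm_create_zero (δ s : ℝ) (α : 𝒦 →L[ℂ] OneBoson 𝒦 d)
    (G : (Fin 0 → Mom d) → 𝒦) (H : (Fin 1 → Mom d) → 𝒦) :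
    shiftForm δ s (create α G) H = shiftForm δ s (createFirst α G) H := by
  congr 1
  rw [create_eq, createFirst]
  simp

/-- Of the n+2 places for the new boson, place 0 is translated and gives `createFirst`. The other
n+1 are not translated, and by symmetry each yields the same annihilation term on the right. With
the weight n+2 counting bosons, this is [dΓ(T), a*(α)] = a*(Tα) in components. -/
theorem shiftForm_create_succ (hd : 0 < d) {δ : ℝ} (hδ : 0 < δ) (s : ℝ)
    (α : 𝒦 →L[ℂ] OneBoson 𝒦 d) {n : ℕ} {G : (Fin (n + 1) → Mom d) → 𝒦}
    {H : (Fin (n + 2) → Mom d) → 𝒦} (hG : MemLp G 2 volume) (hH : MemLp H 2 volume)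
    (hsymm : ∀ σ : Equiv.Perm (Fin (n + 2)), (fun k => H (k ∘ σ)) =ᵐ[volume] H) :
    ((n : ℂ) + 2) * shiftForm δ s (create α G) H =
      (√((n : ℝ) + 2) : ℝ) * shiftForm δ s (createFirst α G) H +
        ((n : ℂ) + 1) * shiftForm δ s G (annihilate α H) := by
  have hm := memLp_create_term α hG
  have hsq : (√((n + 1 : ℕ) + 1 : ℝ)) = √((n : ℝ) + 2) := by
    congr 1; push_cast; ring
  have hpos : (0 : ℝ) < √((n : ℝ) + 2) := by positivity
  have hss : ((√((n : ℝ) + 2) : ℝ) : ℂ) * (√((n : ℝ) + 2) : ℝ) = (n : ℂ) + 2 := by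
    rw [← Complex.ofReal_mul, Real.mul_self_sqrt (by positivity)]; push_cast; ring
  have hne : ((√((n : ℝ) + 2) : ℝ) : ℂ) ≠ 0 := by exact_mod_cast hpos.ne'
  have h1 : ∀ j : Fin (n + 1), ∑ i, shiftForm δ s (tensorAt j.succ
      (fun z => ⟪stdOrthonormalBasis ℂ 𝒦 i, G z⟫_ℂ) (α (stdOrthonormalBasis ℂ 𝒦 i))) H =
      ((√((n : ℝ) + 2) : ℝ) : ℂ)⁻¹ * shiftForm δ s G (annihilate α H) := fun j => by
    rw [annihilate_eq, shiftForm_smul_right, hsq, inv_mul_cancel_left₀ hne,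
      shiftForm_sum_right hd hδ s _ hG fun i => memLp_annihilate_term α hH i]
    refine Finset.sum_congr rfl fun i _ => ?_
    rw [shiftForm_tensorAt_succ hd hδ s j (memLp_coeff hG _) (memLp_form α _) hH hsymm,
      shiftForm_smul_const_right]
  have h2 : shiftForm δ s (create α G) H = ((√((n : ℝ) + 2) : ℝ) : ℂ)⁻¹ *
      (shiftForm δ s (createFirst α G) H + ((n : ℂ) + 1) *
        (((√((n : ℝ) + 2) : ℝ) : ℂ)⁻¹ * shiftForm δ s G (annihilate α H))) := by
    have h3 : ∀ j : Fin (n + 2), MemLp (∑ i, tensorAt j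
        (fun z => ⟪stdOrthonormalBasis ℂ 𝒦 i, G z⟫_ℂ) (α (stdOrthonormalBasis ℂ 𝒦 i))) 2 volume :=
      fun j => memLp_sum Finset.univ fun i => hm j i
    have h4 := (shiftForm_sum_left hd hδ s Finset.univ h3 hH).trans (Fin.sum_univ_succ _)
    have h5 : ∀ j : Fin (n + 1), shiftForm δ s (∑ i, tensorAt j.succ
        (fun z => ⟪stdOrthonormalBasis ℂ 𝒦 i, G z⟫_ℂ) (α (stdOrthonormalBasis ℂ 𝒦 i))) H =
        ((√((n : ℝ) + 2) : ℝ) : ℂ)⁻¹ * shiftForm δ s G (annihilate α H) := fun j =>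
      (shiftForm_sum_left hd hδ s Finset.univ (fun i => hm j.succ i) hH).trans (h1 j)
    rw [Finset.sum_congr rfl fun j _ => h5 j] at h4
    rw [create_eq, shiftForm_smul_left, h4, createFirst, Complex.conj_ofReal, hsq,
      Complex.ofReal_inv]
    simp
  rw [h2]
  generalize shiftForm δ s G (annihilate α H) = X
  generalize shiftForm δ s (createFirst α G) H = Y
  rw [← hss]
  field_simp

/-- A bound for the radial derivative of the form factor with a cutoff near the origin. -/
def radialNorm (α α' : 𝒦 →L[ℂ] OneBoson 𝒦 d) : ℝ :=
  ∑ i, (‖α' (stdOrthonormalBasis ℂ 𝒦 i)‖ +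
    l2norm (oneRadial (fun r => r⁻¹) (α (stdOrthonormalBasis ℂ 𝒦 i))) (lineSphere d))

theorem radialNorm_nonneg (α α' : 𝒦 →L[ℂ] OneBoson 𝒦 d) : 0 ≤ radialNorm α α' :=
  Finset.sum_nonneg fun _ _ => add_nonneg (norm_nonneg _) (l2norm_nonneg _ _)

theorem norm_diffForm_createFirst_le (hd : 0 < d) {α α' : 𝒦 →L[ℂ] OneBoson 𝒦 d}
    (hder : ∀ x, HasRadialDeriv (α x) (α' x))
    (hinv : ∀ x, MemLp (oneRadial (fun r => r⁻¹) (α x)) 2 (lineSphere d))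
    {δ t : ℝ} (hδ : 0 < δ) (ht : 0 ≤ t) (htδ : 2 * t < δ) {n : ℕ} {G : (Fin n → Mom d) → 𝒦}
    {H : (Fin (n + 1) → Mom d) → 𝒦} (hG : MemLp G 2 volume) (hH : MemLp H 2 volume) :
    ‖diffForm δ t (createFirst α G) H‖ ≤ 2 * t * radialNorm α α' * l2norm G volume *
      l2norm (radial (cutoff δ) H) (polarVolume d n) := by
  have : CompleteSpace 𝒦 := FiniteDimensional.complete ℂ 𝒦
  have hm := memLp_create_term α hG 0
  have h1 : diffForm δ t (createFirst α G) H = ∑ i, diffForm δ t (tensorAt 0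
      (fun z => ⟪stdOrthonormalBasis ℂ 𝒦 i, G z⟫_ℂ) (α (stdOrthonormalBasis ℂ 𝒦 i))) H := by
    simp only [diffForm, createFirst]
    rw [shiftForm_sum_left hd hδ _ _ hm hH, shiftForm_sum_left hd hδ _ _ hm hH,
      Finset.sum_sub_distrib]
  rw [h1]
  refine (norm_sum_le _ _).trans ?_
  rw [radialNorm, Finset.mul_sum, Finset.sum_mul, Finset.sum_mul]
  refine Finset.sum_le_sum fun i _ => ?_
  refine (norm_diffForm_tensorAt_zero_le hd hδ (memLp_coeff hG _) (memLp_form α _) hH).trans ?_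
  refine mul_le_mul_of_nonneg_right ?_ (l2norm_nonneg _ _)
  refine mul_le_mul (l2norm_cut_diff_le hd (hder _) (hinv _) hδ ht htδ) (l2norm_coeff_le hG i)
    (l2norm_nonneg _ _) ?_
  exact mul_nonneg (by positivity) (add_nonneg (norm_nonneg _) (l2norm_nonneg _ _))

end Creation

/-! ### Finiteness of the cut-off boson number and removal of the cutoff. -/

section Virial

variable {d : ℕ} {𝒦 : Type*} [NormedAddCommGroup 𝒦] [InnerProductSpace ℂ 𝒦]

/-- The norm of the `(n+1)`-boson component after a cutoff of the first momentum. -/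
def cutNorm (δ : ℝ) (ψ : FockSpace 𝒦 d) (n : ℕ) : ℝ :=
  l2norm (radial (cutoff δ) (wave ψ (n + 1))) (polarVolume d n)

theorem cutNorm_nonneg (δ : ℝ) (ψ : FockSpace 𝒦 d) (n : ℕ) : 0 ≤ cutNorm δ ψ n := l2norm_nonneg _ _

theorem cutNorm_sq (hd : 0 < d) (δ : ℝ) (ψ : FockSpace 𝒦 d) (n : ℕ) :
    cutNorm δ ψ n ^ 2 = ∫ z, cutoff δ ‖z 0‖ ^ 2 * ‖wave ψ (n + 1) z‖ ^ 2 :=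
  integral_norm_radial_sq hd (measurable_cutoff δ) (memLp_wave ψ _)

theorem integrable_norm_mul (ψ Θ : FockSpace 𝒦 d)
    (hΘ : ∀ n, ∀ᵐ k, wave Θ n k = ((∑ j, ‖k j‖ : ℝ) : ℂ) • wave ψ n k) {n : ℕ} (j : Fin n) :
    Integrable fun z : Fin n → Mom d => ‖z j‖ * ‖wave ψ n z‖ ^ 2 := by
  have h1 := (memLp_wave Θ n).norm.integrable_mul (memLp_wave ψ n).norm
  refine h1.mono ?_ ?_
  · exact (measurable_norm.comp (measurable_pi_apply j)).aestronglyMeasurable.mul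
      ((memLp_wave ψ n).1.norm.pow 2)
  · filter_upwards [hΘ n] with z hz
    simp only [Pi.mul_apply]
    rw [hz, norm_smul, Complex.norm_real]
    have h2 : ‖z j‖ ≤ ∑ j, ‖z j‖ :=
      Finset.single_le_sum (f := fun j => ‖z j‖) (fun _ _ => norm_nonneg _) (Finset.mem_univ j)
    have h3 : ‖∑ j, ‖z j‖‖ = ∑ j, ‖z j‖ :=
      Real.norm_of_nonneg (Finset.sum_nonneg fun _ _ => norm_nonneg _)
    rw [h3, Real.norm_of_nonneg (by positivity), Real.norm_of_nonneg (by positivity)]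
    nlinarith [sq_nonneg ‖wave ψ n z‖]

theorem integral_norm_mul_eq (ψ : FockSpace 𝒦 d) {n : ℕ} (i j : Fin n) :
    ∫ z : Fin n → Mom d, ‖z i‖ * ‖wave ψ n z‖ ^ 2 = ∫ z, ‖z j‖ * ‖wave ψ n z‖ ^ 2 := by
  classical
  set σ := Equiv.swap i j
  have hmp := measurePreserving_perm (d := d) σ
  have hm : AEStronglyMeasurable (fun z : Fin n → Mom d => ‖z i‖ * ‖wave ψ n z‖ ^ 2) volume :=
    (measurable_norm.comp (measurable_pi_apply i)).aestronglyMeasurable.mul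
      ((memLp_wave ψ n).1.norm.pow 2)
  rw [← hmp.map_eq, integral_map hmp.aemeasurable (by rwa [hmp.map_eq]), hmp.map_eq]
  refine integral_congr_ae ?_
  filter_upwards [wave_perm ψ n σ] with z hz
  rw [hz]
  simp [σ]

/-- By symmetry n+1 times the energy of the first boson is the total field energy, which is ⟨ψ, Θ⟩
on the sector; the cutoff is bounded by the energy of the first boson over δ. -/
theorem sq_cutNorm_le (hd : 0 < d) {δ : ℝ} (hδ : 0 < δ) (ψ Θ : FockSpace 𝒦 d)
    (hΘ : ∀ n, ∀ᵐ k, wave Θ n k = ((∑ j, ‖k j‖ : ℝ) : ℂ) • wave ψ n k) (n : ℕ) :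
    ((n : ℝ) + 1) * cutNorm δ ψ n ^ 2 ≤ δ⁻¹ * (‖ψ (n + 1)‖ * ‖Θ (n + 1)‖) := by
  have hint := fun j => integrable_norm_mul ψ Θ hΘ (n := n + 1) j
  have h1 : cutNorm δ ψ n ^ 2 ≤ δ⁻¹ * ∫ z : Fin (n + 1) → Mom d, ‖z 0‖ * ‖wave ψ (n + 1) z‖ ^ 2 := by
    rw [cutNorm_sq hd, ← integral_const_mul]
    refine integral_mono_of_nonneg (Eventually.of_forall fun z => by positivity)
      ((hint 0).const_mul _) (Eventually.of_forall fun z => ?_)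
    simp only
    rw [← mul_assoc]
    exact mul_le_mul_of_nonneg_right (cutoff_sq_le hδ (norm_nonneg _)) (by positivity)
  have h2 : ((n : ℝ) + 1) * ∫ z : Fin (n + 1) → Mom d, ‖z 0‖ * ‖wave ψ (n + 1) z‖ ^ 2 =
      ∫ z : Fin (n + 1) → Mom d, ∑ j, ‖z j‖ * ‖wave ψ (n + 1) z‖ ^ 2 := by
    rw [integral_finsetSum _ fun j _ => hint j, Finset.sum_congr rfl fun j _ =>
      integral_norm_mul_eq ψ j 0]
    simp
  have h3 : ∫ z : Fin (n + 1) → Mom d, ∑ j, ‖z j‖ * ‖wave ψ (n + 1) z‖ ^ 2 ≤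
      ‖ψ (n + 1)‖ * ‖Θ (n + 1)‖ := by
    have h4 : ∫ z : Fin (n + 1) → Mom d, ∑ j, ‖z j‖ * ‖wave ψ (n + 1) z‖ ^ 2 =
        (∫ z, ⟪wave ψ (n + 1) z, wave Θ (n + 1) z⟫_ℂ).re := by
      have h5 : ∫ z, ⟪wave ψ (n + 1) z, wave Θ (n + 1) z⟫_ℂ =
          ((∫ z : Fin (n + 1) → Mom d, ∑ j, ‖z j‖ * ‖wave ψ (n + 1) z‖ ^ 2 : ℝ) : ℂ) := by
        rw [← integral_complex_ofReal]
        refine integral_congr_ae ?_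
        filter_upwards [hΘ (n + 1)] with z hz
        rw [hz, inner_smul_right, inner_self_eq_norm_sq_to_K, ← Finset.sum_mul]
        push_cast
        rfl
      rw [h5, Complex.ofReal_re]
    rw [h4]
    exact (Complex.re_le_norm _).trans
      (norm_integral_inner_le (memLp_wave ψ _) (memLp_wave Θ _))
  calc _ ≤ ((n : ℝ) + 1) * (δ⁻¹ * ∫ z : Fin (n + 1) → Mom d, ‖z 0‖ * ‖wave ψ (n + 1) z‖ ^ 2) := by
        gcongr
    _ = δ⁻¹ * (((n : ℝ) + 1) * ∫ z : Fin (n + 1) → Mom d, ‖z 0‖ * ‖wave ψ (n + 1) z‖ ^ 2) := by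
        ring
    _ ≤ _ := by
        rw [h2]
        gcongr

theorem summable_norm_mul_norm (ψ Θ : FockSpace 𝒦 d) : Summable fun n => ‖ψ n‖ * ‖Θ n‖ := by
  refine Summable.of_nonneg_of_le (fun n => by positivity) (fun n => ?_)
    ((hasSum_norm_sq ψ).summable.add (hasSum_norm_sq Θ).summable)
  nlinarith [sq_nonneg (‖ψ n‖ - ‖Θ n‖), sq_nonneg ‖ψ n‖, sq_nonneg ‖Θ n‖]

theorem summable_cutNorm (hd : 0 < d) {δ : ℝ} (hδ : 0 < δ) (ψ Θ : FockSpace 𝒦 d)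
    (hΘ : ∀ n, ∀ᵐ k, wave Θ n k = ((∑ j, ‖k j‖ : ℝ) : ℂ) • wave ψ n k) :
    Summable fun n : ℕ => ((n : ℝ) + 1) * cutNorm δ ψ n ^ 2 :=
  Summable.of_nonneg_of_le (fun n => by positivity) (sq_cutNorm_le hd hδ ψ Θ hΘ)
    (((summable_nat_add_iff 1).2 (summable_norm_mul_norm ψ Θ)).mul_left _)

theorem tendsto_cutNorm (hd : 0 < d) (ψ : FockSpace 𝒦 d) (n : ℕ) :
    Tendsto (fun δ => cutNorm δ ψ n ^ 2) (𝓝[>] 0) (𝓝 (‖ψ (n + 1)‖ ^ 2)) := by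
  have : Nonempty (Fin d) := ⟨⟨0, hd⟩⟩
  have hne : ∀ᵐ z : Fin (n + 1) → Mom d, z 0 ≠ 0 := by
    have h1 : ∀ᵐ x : Mom d, x ≠ 0 := by rw [ae_iff]; simp
    exact (Measure.quasiMeasurePreserving_fst.comp
      (measurePreserving_removeNth_prod (d := d) (0 : Fin (n + 1))).quasiMeasurePreserving).ae h1
  have h2 : ‖ψ (n + 1)‖ ^ 2 = ∫ z, ‖wave ψ (n + 1) z‖ ^ 2 := by
    rw [← l2norm_wave, l2norm_sq (memLp_wave ψ _)]
  simp only [cutNorm_sq hd]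
  rw [h2]
  refine tendsto_integral_filter_of_dominated_convergence (fun z => ‖wave ψ (n + 1) z‖ ^ 2)
    (Eventually.of_forall fun δ => ?_) ?_ ?_ ?_
  · exact (((measurable_cutoff δ).comp (measurable_norm.comp
      (measurable_pi_apply 0))).pow_const 2).aestronglyMeasurable.mul
        ((memLp_wave ψ _).1.norm.pow 2)
  · filter_upwards [self_mem_nhdsWithin] with δ hδ
    refine Eventually.of_forall fun z => ?_
    rw [Real.norm_of_nonneg (by positivity)]
    exact mul_le_of_le_one_left (by positivity)
      (pow_le_one₀ (cutoff_nonneg hδ _) (cutoff_le_one hδ _))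
  · exact (memLp_wave ψ _).integrable_norm_pow (by norm_num)
  · filter_upwards [hne] with z hz
    have := ((tendsto_cutoff (norm_pos_iff.2 hz)).pow 2).mul_const (‖wave ψ (n + 1) z‖ ^ 2)
    simpa using this

end Virial

/-- Otherwise s would dominate a multiple of the harmonic series. This makes the boundary term of
the telescoping sum small along infinitely many sectors, which suffices. -/
theorem frequently_mul_lt {s : ℕ → ℝ} (hs : Summable s) {ε : ℝ} (hε : 0 < ε) :
    ∃ᶠ n : ℕ in atTop, ((n : ℝ) + 2) * s n < ε := by
  intro h
  have h1 : Summable fun n : ℕ => ε * (1 / ((n : ℝ) + 2)) := by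
    refine Summable.of_norm_bounded_eventually_nat (g := s) hs ?_
    filter_upwards [h] with n hn
    rw [not_lt] at hn
    have : (0 : ℝ) < (n : ℝ) + 2 := by positivity
    rw [Real.norm_of_nonneg (by positivity), mul_one_div, div_le_iff₀ this]
    linarith
  have h2 : Summable fun n : ℕ => 1 / ((n : ℝ) + 2) := by
    simpa [hε.ne'] using h1.mul_left ε⁻¹
  have h3 := (summable_nat_add_iff (f := fun n : ℕ => 1 / (n : ℝ)) 2).1 (by simpa using h2)
  exact Real.not_summable_one_div_natCast h3

theorem sum_mul_le_sqrt_tsum {a b : ℕ → ℝ} (ha : Summable fun n => a n ^ 2)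
    (hb : Summable fun n => b n ^ 2) (M : ℕ) :
    ∑ n ∈ Finset.range M, a n * b n ≤ √(∑' n, a n ^ 2) * √(∑' n, b n ^ 2) := by
  refine (Real.sum_mul_le_sqrt_mul_sqrt _ _ _).trans ?_
  gcongr
  · exact ha.sum_le_tsum _ fun _ _ => sq_nonneg _
  · exact hb.sum_le_tsum _ fun _ _ => sq_nonneg _

/-! ### The virial identity and the bound on the boson number. -/

section Virial

variable {d : ℕ} {𝒦 : Type*} [NormedAddCommGroup 𝒦] [InnerProductSpace ℂ 𝒦]
  [FiniteDimensional ℂ 𝒦]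

/-- The telescoping term of the virial identity. -/
def virialFlux (α : 𝒦 →L[ℂ] OneBoson 𝒦 d) (δ t : ℝ) (ψ : FockSpace 𝒦 d) : ℕ → ℝ
  | 0 => 0
  | n + 1 => ((n : ℝ) + 1) * (diffForm δ t (annihilate α (wave ψ (n + 2))) (wave ψ (n + 1))).re

/-- The creation term, weighted by the boson number, is the one-body commutator minus the
annihilation term of the sector below, so summation over sectors telescopes. -/
theorem diffForm_create (hd : 0 < d) {δ : ℝ} (hδ : 0 < δ) (t : ℝ)
    (α : 𝒦 →L[ℂ] OneBoson 𝒦 d) (ψ : FockSpace 𝒦 d) (n : ℕ) :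
    ((n : ℝ) + 1) * (diffForm δ t (create α (wave ψ n)) (wave ψ (n + 1))).re =
      √((n : ℝ) + 1) * (diffForm δ t (createFirst α (wave ψ n)) (wave ψ (n + 1))).re -
        virialFlux α δ t ψ n := by
  cases n with
  | zero => simp [diffForm, virialFlux, shiftForm_create_zero]
  | succ n =>
    have h1 := shiftForm_create_succ hd hδ t α (memLp_wave ψ (n + 1)) (memLp_wave ψ (n + 2))
      (wave_perm ψ (n + 2))
    have h2 := shiftForm_create_succ hd hδ (-t) α (memLp_wave ψ (n + 1)) (memLp_wave ψ (n + 2))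
      (wave_perm ψ (n + 2))
    have h3 : ((((n : ℝ) + 2 : ℝ)) : ℂ) *
        diffForm δ t (create α (wave ψ (n + 1))) (wave ψ (n + 2)) =
        (√((n : ℝ) + 2) : ℝ) * diffForm δ t (createFirst α (wave ψ (n + 1))) (wave ψ (n + 2)) +
        (((n : ℝ) + 1 : ℝ) : ℂ) *
          diffForm δ t (wave ψ (n + 1)) (annihilate α (wave ψ (n + 2))) := by
      simp only [diffForm]
      push_cast at h1 h2 ⊢
      linear_combination h1 - h2
    have h4 := congrArg Complex.re h3
    rw [Complex.add_re, Complex.re_ofReal_mul, Complex.re_ofReal_mul, Complex.re_ofReal_mul,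
      re_diffForm_comm δ t (wave ψ (n + 1))] at h4
    have h5 : ((n + 1 : ℕ) : ℝ) + 1 = (n : ℝ) + 2 := by push_cast; ring
    rw [h5, virialFlux]
    linarith

/-- The eigenvalue equation on a sector is paired with the translation difference applied to ψ. Only
the first boson is translated, so the factor n+1 stands for the sum over all bosons. -/
theorem virial_identity (hd : 0 < d) {δ : ℝ} (hδ : 0 < δ) (t : ℝ) {K : 𝒦 →ₗ[ℂ] 𝒦}
    (hK : K.IsSymmetric) {α : 𝒦 →L[ℂ] OneBoson 𝒦 d} {lam E : ℝ} {ψ : FockSpace 𝒦 d}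
    (h : ∀ n, ∀ᵐ k, fibre K E k (wave ψ n k) = (-(lam : ℂ)) • fieldWave α ψ n k) (n : ℕ) :
    t * (((n : ℝ) + 1) * (shiftForm δ t (wave ψ (n + 1)) (wave ψ (n + 1))).re) =
      lam * (√2)⁻¹ * (virialFlux α δ t ψ (n + 1) - virialFlux α δ t ψ n +
        √((n : ℝ) + 1) * (diffForm δ t (createFirst α (wave ψ n)) (wave ψ (n + 1))).re) := by
  have hm : MemLp (fun k => fibre K E k (wave ψ (n + 1) k)) 2 volume :=
    (memLp_congr_ae (h (n + 1))).2 ((memLp_fieldWave α ψ (n + 1)).const_smul _)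
  have h1 := re_diffForm_fibre hd hδ t hK E (memLp_wave ψ (n + 1)) hm
  have ha := memLp_annihilate α (memLp_wave ψ (n + 2))
  have hc := memLp_create α (memLp_wave ψ n)
  have h2 : diffForm δ t (fun k => fibre K E k (wave ψ (n + 1) k)) (wave ψ (n + 1)) =
      ((-lam * (√2)⁻¹ : ℝ) : ℂ) * (diffForm δ t (annihilate α (wave ψ (n + 2))) (wave ψ (n + 1)) +
        diffForm δ t (create α (wave ψ n)) (wave ψ (n + 1))) := by
    have h3 : ∀ s, shiftForm δ s (fun k => fibre K E k (wave ψ (n + 1) k)) (wave ψ (n + 1)) =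
        ((-lam * (√2)⁻¹ : ℝ) : ℂ) *
          (shiftForm δ s (annihilate α (wave ψ (n + 2))) (wave ψ (n + 1)) +
            shiftForm δ s (create α (wave ψ n)) (wave ψ (n + 1))) := fun s => by
      have h4 : (fun k => fibre K E k (wave ψ (n + 1) k)) =ᵐ[volume]
          ((-lam * (√2)⁻¹ : ℝ) : ℂ) • (annihilate α (wave ψ (n + 2)) + create α (wave ψ n)) := by
        filter_upwards [h (n + 1)] with k hk
        rw [hk]
        simp only [fieldWave, Pi.smul_apply, smul_smul]
        push_cast
        rfl
      rw [shiftForm_congr_left hd δ s _ h4, shiftForm_smul_left,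
        shiftForm_add_left hd hδ s ha hc (memLp_wave ψ _), Complex.conj_ofReal]
    rw [diffForm, h3, h3, diffForm, diffForm]
    ring
  rw [h2, Complex.re_ofReal_mul, Complex.add_re] at h1
  have h5 := diffForm_create hd hδ t α ψ n
  rw [virialFlux]
  linear_combination ((n : ℝ) + 1) * h1 + lam * (√2)⁻¹ * h5

theorem l2norm_cut_le (hd : 0 < d) {δ : ℝ} (hδ : 0 < δ) {n : ℕ}
    {G : (Fin (n + 1) → Mom d) → 𝒦} (hG : MemLp G 2 volume) :
    l2norm (radial (cutoff δ) G) (polarVolume d n) ≤ l2norm G volume := by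
  refine le_of_sq_le_sq ?_ (l2norm_nonneg _ _)
  rw [integral_norm_radial_sq hd (measurable_cutoff δ) hG, l2norm_sq hG]
  refine integral_mono_of_nonneg (Eventually.of_forall fun z => by positivity)
    (hG.integrable_norm_pow (by norm_num)) (Eventually.of_forall fun z => ?_)
  exact mul_le_of_le_one_left (by positivity)
    (pow_le_one₀ (cutoff_nonneg hδ _) (cutoff_le_one hδ _))

theorem norm_diffForm_le (hd : 0 < d) {δ : ℝ} (hδ : 0 < δ) (t : ℝ) {n : ℕ}
    {G H : (Fin (n + 1) → Mom d) → 𝒦} (hG : MemLp G 2 volume) (hH : MemLp H 2 volume) :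
    ‖diffForm δ t G H‖ ≤ 2 * (l2norm G volume *
      l2norm (radial (cutoff δ) H) (polarVolume d n)) := by
  have h : l2norm (radial (cutoff δ) G) (polarVolume d n) *
      l2norm (radial (cutoff δ) H) (polarVolume d n) ≤ l2norm G volume *
      l2norm (radial (cutoff δ) H) (polarVolume d n) :=
    mul_le_mul_of_nonneg_right (l2norm_cut_le hd hδ hG) (l2norm_nonneg _ _)
  refine (norm_sub_le _ _).trans ?_
  have h1 := norm_shiftForm_le hd hδ t hG hH
  have h2 := norm_shiftForm_le hd hδ (-t) hG hH
  linarith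

/-- The bound is arranged as n+2 times a product of two square summable sequences, the form to which
`frequently_mul_lt` applies. -/
theorem abs_virialFlux_le (hd : 0 < d) {δ : ℝ} (hδ : 0 < δ) (t : ℝ)
    (α : 𝒦 →L[ℂ] OneBoson 𝒦 d) (ψ : FockSpace 𝒦 d) (n : ℕ) :
    |virialFlux α δ t ψ (n + 1)| ≤ 2 * formNorm α *
      (((n : ℝ) + 2) * (‖ψ (n + 2)‖ * (√((n : ℝ) + 1) * cutNorm δ ψ n))) := by
  have h1 := norm_diffForm_le hd hδ t (memLp_annihilate α (memLp_wave ψ (n + 2)))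
    (memLp_wave ψ (n + 1))
  have h2 := l2norm_annihilate_le α (memLp_wave ψ (n + 2))
  rw [l2norm_wave] at h2
  have hc := cutNorm_nonneg δ ψ n
  have hF := formNorm_nonneg α
  have h3 : ((n : ℝ) + 1) * √((n : ℝ) + 2) ≤ ((n : ℝ) + 2) * √((n : ℝ) + 1) := by
    have ha := Real.mul_self_sqrt (show (0 : ℝ) ≤ (n : ℝ) + 1 by positivity)
    have hb := Real.mul_self_sqrt (show (0 : ℝ) ≤ (n : ℝ) + 2 by positivity)
    have hab : √((n : ℝ) + 1) ≤ √((n : ℝ) + 2) := Real.sqrt_le_sqrt (by linarith)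
    calc _ = (√((n : ℝ) + 1) * √((n : ℝ) + 2)) * √((n : ℝ) + 1) := by
          linear_combination (-√((n : ℝ) + 2)) * ha
      _ ≤ (√((n : ℝ) + 2) * √((n : ℝ) + 2)) * √((n : ℝ) + 1) := by gcongr
      _ = _ := by rw [hb]
  have h4 : (((n + 1 : ℕ) : ℝ) + 1) = (n : ℝ) + 2 := by push_cast; ring
  rw [h4] at h2
  rw [virialFlux, abs_mul, abs_of_nonneg (by positivity : (0 : ℝ) ≤ (n : ℝ) + 1)]
  calc _ ≤ ((n : ℝ) + 1) * (2 * ((√((n : ℝ) + 2) * (formNorm α * ‖ψ (n + 2)‖)) *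
        cutNorm δ ψ n)) := by
        refine mul_le_mul_of_nonneg_left ((Complex.abs_re_le_norm _).trans (h1.trans ?_))
          (by positivity)
        exact mul_le_mul_of_nonneg_left (mul_le_mul_of_nonneg_right h2 hc) (by norm_num)
    _ = 2 * formNorm α * ‖ψ (n + 2)‖ * cutNorm δ ψ n * (((n : ℝ) + 1) * √((n : ℝ) + 2)) := by
        ring
    _ ≤ 2 * formNorm α * ‖ψ (n + 2)‖ * cutNorm δ ψ n * (((n : ℝ) + 2) * √((n : ℝ) + 1)) := by
        gcongr
    _ = _ := by ring

/-- Summing the virial identity over sectors leaves one boundary flux and the one-body commutators.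
The latter are O(t) by regularity of the form factor, and Cauchy–Schwarz over sectors gives ‖ψ‖
times the root of the cut-off number; then t is divided out. -/
theorem tsum_shiftForm_le (hd : 0 < d) {K : 𝒦 →ₗ[ℂ] 𝒦}
    (hK : K.IsSymmetric) {α α' : 𝒦 →L[ℂ] OneBoson 𝒦 d}
    (hder : ∀ x, HasRadialDeriv (α x) (α' x))
    (hinv : ∀ x, MemLp (oneRadial (fun r => r⁻¹) (α x)) 2 (lineSphere d))
    {δ t : ℝ} (ht : 0 < t) (htδ : 2 * t < δ) {lam E : ℝ} {ψ : FockSpace 𝒦 d}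
    (h : ∀ n, ∀ᵐ k, fibre K E k (wave ψ n k) = (-(lam : ℂ)) • fieldWave α ψ n k)
    (hY : Summable fun n : ℕ => ((n : ℝ) + 1) * cutNorm δ ψ n ^ 2) :
    ∑' n : ℕ, ((n : ℝ) + 1) * (shiftForm δ t (wave ψ (n + 1)) (wave ψ (n + 1))).re ≤
      |lam| * (2 * radialNorm α α' *
        (‖ψ‖ * √(∑' n : ℕ, ((n : ℝ) + 1) * cutNorm δ ψ n ^ 2))) := by
  have hδ : 0 < δ := by linarith
  have hB := radialNorm_nonneg α α'
  have hF := formNorm_nonneg α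
  set Y := √(∑' n : ℕ, ((n : ℝ) + 1) * cutNorm δ ψ n ^ 2) with hYdef
  set R : ℕ → ℝ := fun n =>
    ((n : ℝ) + 1) * (shiftForm δ t (wave ψ (n + 1)) (wave ψ (n + 1))).re with hR
  have hsq : ∀ n : ℕ, (√((n : ℝ) + 1) * cutNorm δ ψ n) ^ 2 = ((n : ℝ) + 1) * cutNorm δ ψ n ^ 2 :=
    fun n => by rw [mul_pow, Real.sq_sqrt (by positivity)]
  have hy : Summable fun n : ℕ => (√((n : ℝ) + 1) * cutNorm δ ψ n) ^ 2 := by simpa only [hsq]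
  have hRs : Summable R := by
    refine Summable.of_norm_bounded hY fun n => ?_
    rw [hR, norm_mul, Real.norm_of_nonneg (by positivity : (0 : ℝ) ≤ (n : ℝ) + 1), sq]
    exact mul_le_mul_of_nonneg_left ((Complex.abs_re_le_norm _).trans
      (norm_shiftForm_le hd hδ t (memLp_wave ψ _) (memLp_wave ψ _))) (by positivity)
  have hpart : ∀ M : ℕ, t * ∑ n ∈ Finset.range M, R n ≤
      |lam| * (|virialFlux α δ t ψ M| + t * (2 * radialNorm α α' * (‖ψ‖ * Y))) := fun M => by
    have h1 : t * ∑ n ∈ Finset.range M, R n = lam * (√2)⁻¹ * (virialFlux α δ t ψ M +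
        ∑ n ∈ Finset.range M, √((n : ℝ) + 1) *
          (diffForm δ t (createFirst α (wave ψ n)) (wave ψ (n + 1))).re) := by
      rw [Finset.mul_sum, Finset.sum_congr rfl fun n _ => virial_identity hd hδ t hK h n,
        ← Finset.mul_sum, Finset.sum_add_distrib, Finset.sum_range_sub]
      simp [virialFlux]
    have h2 : |∑ n ∈ Finset.range M, √((n : ℝ) + 1) *
        (diffForm δ t (createFirst α (wave ψ n)) (wave ψ (n + 1))).re| ≤
        t * (2 * radialNorm α α' * (‖ψ‖ * Y)) := by
      refine (Finset.abs_sum_le_sum_abs _ _).trans ?_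
      calc _ ≤ ∑ n ∈ Finset.range M, t * (2 * radialNorm α α') *
            (‖ψ n‖ * (√((n : ℝ) + 1) * cutNorm δ ψ n)) := by
            refine Finset.sum_le_sum fun n _ => ?_
            rw [abs_mul, abs_of_nonneg (Real.sqrt_nonneg _)]
            have h3 := norm_diffForm_createFirst_le hd hder hinv hδ ht.le htδ (memLp_wave ψ n)
              (memLp_wave ψ (n + 1))
            rw [l2norm_wave] at h3
            calc _ ≤ √((n : ℝ) + 1) * (2 * t * radialNorm α α' * ‖ψ n‖ * cutNorm δ ψ n) :=
                  mul_le_mul_of_nonneg_left ((Complex.abs_re_le_norm _).trans h3)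
                    (Real.sqrt_nonneg _)
              _ = _ := by ring
        _ ≤ t * (2 * radialNorm α α') * (‖ψ‖ * Y) := by
            rw [← Finset.mul_sum]
            refine mul_le_mul_of_nonneg_left ?_ (by positivity)
            refine (sum_mul_le_sqrt_tsum (hasSum_norm_sq ψ).summable hy M).trans_eq ?_
            rw [(hasSum_norm_sq ψ).tsum_eq, Real.sqrt_sq (norm_nonneg _), hYdef]
            simp only [hsq]
        _ = _ := by ring
    have hc : (√2)⁻¹ ≤ 1 := inv_le_one_of_one_le₀ (by
      rw [Real.one_le_sqrt]; norm_num)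
    rw [h1]
    refine (le_abs_self _).trans ?_
    rw [abs_mul, abs_mul, abs_of_nonneg (by positivity : (0 : ℝ) ≤ (√2)⁻¹)]
    refine mul_le_mul (mul_le_of_le_one_right (abs_nonneg _) hc)
      ((abs_add_le _ _).trans (by linarith)) (abs_nonneg _) (abs_nonneg _)
  have hs : Summable fun n : ℕ => ‖ψ (n + 2)‖ * (√((n : ℝ) + 1) * cutNorm δ ψ n) := by
    have h2 := (summable_nat_add_iff 2).2 (hasSum_norm_sq ψ).summable
    refine Summable.of_nonneg_of_le (fun n => ?_) (fun n => ?_) (h2.add hy)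
    · have := cutNorm_nonneg δ ψ n
      positivity
    · nlinarith [sq_nonneg (‖ψ (n + 2)‖ - √((n : ℝ) + 1) * cutNorm δ ψ n),
        sq_nonneg ‖ψ (n + 2)‖, sq_nonneg (√((n : ℝ) + 1) * cutNorm δ ψ n)]
  have hlim : Tendsto (fun M : ℕ => t * ∑ n ∈ Finset.range (M + 1), R n) atTop
      (𝓝 (t * ∑' n, R n)) :=
    (((tendsto_add_atTop_iff_nat 1).2 hRs.hasSum.tendsto_sum_nat)).const_mul t
  have hfin : t * ∑' n, R n ≤ t * (|lam| * (2 * radialNorm α α' * (‖ψ‖ * Y))) := by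
    refine le_of_forall_pos_le_add fun ε hε => ?_
    have hC : 0 < |lam| * (2 * formNorm α) + 1 := by positivity
    have hf := frequently_mul_lt hs (div_pos hε hC)
    -- The flux is known to be small only for infinitely many M, but the partial sums converge, so a
    -- subsequence is enough.
    refine le_of_tendsto_of_frequently hlim (hf.mono fun M hM => ?_)
    have h1 := hpart (M + 1)
    have h2 := abs_virialFlux_le hd hδ t α ψ M
    have h3 : |lam| * |virialFlux α δ t ψ (M + 1)| ≤ ε := by
      calc _ ≤ |lam| * (2 * formNorm α * (ε / (|lam| * (2 * formNorm α) + 1))) := by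
            refine mul_le_mul_of_nonneg_left (h2.trans ?_) (abs_nonneg _)
            exact mul_le_mul_of_nonneg_left hM.le (by positivity)
        _ = (|lam| * (2 * formNorm α)) * ε / (|lam| * (2 * formNorm α) + 1) := by ring
        _ ≤ ε := by
            rw [div_le_iff₀ hC]
            nlinarith
    linarith
  exact le_of_mul_le_mul_left hfin ht

/-- The virial bound for the number of bosons in an eigenvector. -/
theorem sum_number_le (hd : 0 < d) {K : 𝒦 →ₗ[ℂ] 𝒦}
    (hK : K.IsSymmetric) {α α' : 𝒦 →L[ℂ] OneBoson 𝒦 d}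
    (hder : ∀ x, HasRadialDeriv (α x) (α' x))
    (hinv : ∀ x, MemLp (oneRadial (fun r => r⁻¹) (α x)) 2 (lineSphere d))
    {lam E : ℝ} {ψ Θ : FockSpace 𝒦 d}
    (h : ∀ n, ∀ᵐ k, fibre K E k (wave ψ n k) = (-(lam : ℂ)) • fieldWave α ψ n k)
    (hΘ : ∀ n, ∀ᵐ k, wave Θ n k = ((∑ j, ‖k j‖ : ℝ) : ℂ) • wave ψ n k) (M : ℕ) :
    ∑ n ∈ Finset.range M, ((n : ℝ) + 1) * ‖ψ (n + 1)‖ ^ 2 ≤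
      (2 * radialNorm α α' * |lam| * ‖ψ‖) ^ 2 := by
  have hB := radialNorm_nonneg α α'
  have hcut : ∀ δ : ℝ, 0 < δ → ∑ n ∈ Finset.range M, ((n : ℝ) + 1) * cutNorm δ ψ n ^ 2 ≤
      (2 * radialNorm α α' * |lam| * ‖ψ‖) ^ 2 := fun δ hδ => by
    have hY := summable_cutNorm hd hδ ψ Θ hΘ
    set S := ∑' n : ℕ, ((n : ℝ) + 1) * cutNorm δ ψ n ^ 2 with hS
    have hS0 : 0 ≤ S := tsum_nonneg fun n => by positivity
    -- Here t → 0 at fixed δ, with the summable cut-off boson numbers as dominating sequence.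
    have hlim : Tendsto (fun t => ∑' n : ℕ, ((n : ℝ) + 1) *
        (shiftForm δ t (wave ψ (n + 1)) (wave ψ (n + 1))).re) (𝓝[>] 0) (𝓝 S) := by
      refine tendsto_tsum_of_dominated_convergence hY (fun n => ?_)
        (Eventually.of_forall fun t n => ?_)
      · exact ((tendsto_shiftForm hd hδ (memLp_wave ψ (n + 1))).mono_left
          nhdsWithin_le_nhds).const_mul _
      · rw [norm_mul, Real.norm_of_nonneg (by positivity : (0 : ℝ) ≤ (n : ℝ) + 1), sq]
        exact mul_le_mul_of_nonneg_left ((Complex.abs_re_le_norm _).trans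
          (norm_shiftForm_le hd hδ t (memLp_wave ψ _) (memLp_wave ψ _))) (by positivity)
    have hle : S ≤ |lam| * (2 * radialNorm α α' * (‖ψ‖ * √S)) := by
      refine le_of_tendsto hlim ?_
      filter_upwards [Ioo_mem_nhdsGT (show (0 : ℝ) < δ / 2 by positivity)] with t ht
      exact tsum_shiftForm_le hd hK hder hinv ht.1 (by linarith [ht.2]) h hY
    -- From S ≤ c√S with S finite follows √S ≤ c. The finiteness is what the cutoff provides, and c
    -- does not depend on δ.
    have h1 : √S ≤ 2 * radialNorm α α' * |lam| * ‖ψ‖ := by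
      rcases hS0.eq_or_lt with h0 | h0
      · rw [← h0, Real.sqrt_zero]; positivity
      · have h2 := Real.sqrt_pos.2 h0
        refine le_of_mul_le_mul_right ?_ h2
        rw [Real.mul_self_sqrt hS0]
        linarith
    calc _ ≤ S := hY.sum_le_tsum _ fun n _ => by positivity
      _ = √S ^ 2 := (Real.sq_sqrt hS0).symm
      _ ≤ _ := by gcongr
  -- The cutoff is removed in a finite partial sum, so no limit is exchanged with an infinite sum.
  refine le_of_tendsto (tendsto_finsetSum _ fun n _ => (tendsto_cutNorm hd ψ n).const_mul _) ?_
  filter_upwards [self_mem_nhdsWithin] with δ hδ using hcut δ hδ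

end Virial

/-! ### The vacuum sector. -/

section Vacuum

variable {d : ℕ} {𝒦 : Type*} [NormedAddCommGroup 𝒦] [InnerProductSpace ℂ 𝒦]

theorem volume_fin_zero :
    (volume : Measure (Fin 0 → Mom d)) = Measure.dirac default := by
  rw [Measure.volume_pi_eq_dirac default]

instance instProbabilityFinZero : IsProbabilityMeasure (volume : Measure (Fin 0 → Mom d)) := by
  rw [volume_fin_zero]; infer_instance

theorem ae_fin_zero {p : (Fin 0 → Mom d) → Prop} (h : ∀ᵐ k, p k) : p default := by
  obtain ⟨k, hk⟩ := h.exists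
  rwa [Subsingleton.elim k default] at hk

theorem l2norm_fin_zero (f : (Fin 0 → Mom d) → 𝒦) : l2norm f volume = ‖f default‖ := by
  have h1 : MemLp f 2 volume := by
    have h2 : f = fun _ => f default := funext fun k => by rw [Subsingleton.elim k default]
    rw [h2]
    exact memLp_const _
  have h2 : l2norm f volume ^ 2 = ‖f default‖ ^ 2 := by
    rw [l2norm_sq h1, volume_fin_zero, integral_dirac]
  exact (pow_left_inj₀ (l2norm_nonneg _ _) (norm_nonneg _) two_ne_zero).1 h2

theorem component_eq_zero {ψ : FockSpace 𝒦 d} {n : ℕ} (h : wave ψ n =ᵐ[volume] 0) : ψ n = 0 :=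
  Subtype.ext (Lp.ext (h.trans (Lp.coeFn_zero 𝒦 2 (volume : Measure (Fin n → Mom d))).symm))

theorem inner_component (ψ χ : FockSpace 𝒦 d) (n : ℕ) :
    ⟪ψ n, χ n⟫_ℂ = ∫ k, ⟪wave ψ n k, wave χ n k⟫_ℂ := by
  rw [Submodule.coe_inner, L2.inner_def]
  rfl

theorem inner_of_component_eq_zero {ψ χ : FockSpace 𝒦 d} {m : ℕ}
    (h : ∀ n, n ≠ m → wave ψ n =ᵐ[volume] 0) :
    ⟪ψ, χ⟫_ℂ = ∫ k, ⟪wave ψ m k, wave χ m k⟫_ℂ := by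
  rw [← inner_component, lp.inner_eq_tsum, tsum_eq_single m]
  intro n hn
  rw [component_eq_zero (h n hn), inner_zero_left]

theorem norm_vacuum [FiniteDimensional ℂ 𝒦] (x : 𝒦) : ‖vacuum 𝒦 d x‖ = ‖x‖ := by
  have h1 : ⟪vacuum 𝒦 d x, vacuum 𝒦 d x⟫_ℂ = ⟪x, x⟫_ℂ := by
    rw [inner_of_component_eq_zero fun n hn => wave_vacuum_ne x hn]
    rw [integral_congr_ae (g := fun _ => ⟪x, x⟫_ℂ)]
    · simp
    · filter_upwards [wave_vacuum_zero (d := d) x] with k hk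
      rw [hk]
  rw [inner_self_eq_norm_sq_to_K, inner_self_eq_norm_sq_to_K] at h1
  have h2 : ‖vacuum 𝒦 d x‖ ^ 2 = ‖x‖ ^ 2 := by exact_mod_cast h1
  exact (pow_left_inj₀ (norm_nonneg _) (norm_nonneg _) two_ne_zero).1 h2

variable [FiniteDimensional ℂ 𝒦]

/-- The creation operator on the vacuum is the adjoint of the annihilation operator. -/
theorem integral_inner_create_const (α : 𝒦 →L[ℂ] OneBoson 𝒦 d) (x : 𝒦)
    {H : (Fin 1 → Mom d) → 𝒦} (hH : MemLp H 2 volume) :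
    ∫ k, ⟪create α (fun _ : Fin 0 → Mom d => x) k, H k⟫_ℂ = ⟪x, annihilate α H default⟫_ℂ := by
  have hmp := volume_preserving_funUnique (Fin 1) (Mom d)
  have hterm : ∀ i, MemLp (fun k : Fin 1 → Mom d => α (stdOrthonormalBasis ℂ 𝒦 i) (k 0)) 2 volume :=
    fun i => (memLp_form α _).comp_measurePreserving hmp
  have h1 : ∀ k, ⟪create α (fun _ : Fin 0 → Mom d => x) k, H k⟫_ℂ =
      ∑ i, ⟪x, stdOrthonormalBasis ℂ 𝒦 i⟫_ℂ *
        ⟪α (stdOrthonormalBasis ℂ 𝒦 i) (k 0), H k⟫_ℂ := fun k => by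
    simp [create, mul_comm]
  have h2 : ∀ i, ∫ k : Fin 1 → Mom d, ⟪α (stdOrthonormalBasis ℂ 𝒦 i) (k 0), H k⟫_ℂ =
      ∫ q, ⟪α (stdOrthonormalBasis ℂ 𝒦 i) q, H (Fin.cons q default)⟫_ℂ := fun i => by
    rw [← hmp.integral_comp (MeasurableEquiv.measurableEmbedding _)]
    refine integral_congr_ae (Eventually.of_forall fun k => ?_)
    have h3 : (Fin.cons (k 0) default : Fin 1 → Mom d) = k := by
      funext j
      fin_cases j
      rfl
    have h4 : MeasurableEquiv.funUnique (Fin 1) (Mom d) k = k 0 := rfl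
    simp only
    rw [h4, h3]
  simp only [h1]
  rw [integral_finsetSum _ fun i _ => (integrable_inner (hterm i) hH).const_mul _]
  simp only [integral_const_mul, h2, annihilate, inner_smul_right, inner_sum]
  simp [mul_comm]

end Vacuum

/-! ### Spectral gap of K and uniformity in finite dimension. -/

section Spectral

variable {𝒦 : Type*} [NormedAddCommGroup 𝒦] [InnerProductSpace ℂ 𝒦] [FiniteDimensional ℂ 𝒦]

/-- The eigenvalues outside the closure of a set have a positive distance from it. -/
theorem exists_spectral_gap {K : 𝒦 →ₗ[ℂ] 𝒦} (hK : K.IsSymmetric) {k : ℝ} {I : Set ℝ}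
    (hkI : k ∈ I)
    (hI : ∀ k' : ℝ, Module.End.HasEigenvalue K (k' : ℂ) → k' ∈ closure I → k' = k) :
    ∃ g : ℝ, 0 < g ∧ ∀ i, hK.eigenvalues rfl i ≠ k → ∀ E ∈ I, g ≤ |hK.eigenvalues rfl i - E| := by
  have h1 : ∀ i, ∃ g : ℝ, 0 < g ∧
      (hK.eigenvalues rfl i ≠ k → ∀ E ∈ I, g ≤ |hK.eigenvalues rfl i - E|) := fun i => by
    by_cases h : hK.eigenvalues rfl i = k
    · exact ⟨1, one_pos, fun h' => absurd h h'⟩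
    · have h2 : hK.eigenvalues rfl i ∉ closure I := fun h' =>
        h (hI _ (hK.hasEigenvalue_eigenvalues rfl i) h')
      refine ⟨_, (Metric.infDist_pos_iff_notMem_closure ⟨k, hkI⟩).1 h2, fun _ E hE => ?_⟩
      rw [← Real.dist_eq]
      exact Metric.infDist_le_dist_of_mem hE
  choose g hg hgi using h1
  obtain ⟨c, hc, hcg⟩ : ∃ c : ℝ, 0 < c ∧ ∀ i, c ≤ g i := by
    rcases isEmpty_or_nonempty (Fin (Module.finrank ℂ 𝒦)) with h | h
    · exact ⟨1, one_pos, fun i => h.elim i⟩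
    · obtain ⟨j, hj⟩ := Finite.exists_min g
      exact ⟨g j, hg j, hj⟩
  exact ⟨c, hc, fun i hi E hE => (hcg i).trans (hgi i hi E hE)⟩

/-- In an eigenbasis of K the coefficients of y at the eigenvalue k vanish, and at every other
eigenvalue K − E multiplies by at least g in modulus. -/
theorem gap_mul_norm_le {K : 𝒦 →ₗ[ℂ] 𝒦} (hK : K.IsSymmetric) {k g E : ℝ} (hg : 0 ≤ g)
    (h : ∀ i, hK.eigenvalues rfl i ≠ k → g ≤ |hK.eigenvalues rfl i - E|) {y : 𝒦}
    (hy : ∀ x ∈ Module.End.eigenspace K (k : ℂ), ⟪x, y⟫_ℂ = 0) :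
    g * ‖y‖ ≤ ‖K y - (E : ℂ) • y‖ := by
  set b := hK.eigenvectorBasis rfl with hb
  refine le_of_sq_le_sq ?_ (norm_nonneg _)
  rw [mul_pow, ← b.sum_sq_norm_inner_right, ← b.sum_sq_norm_inner_right (K y - _),
    Finset.mul_sum]
  refine Finset.sum_le_sum fun i _ => ?_
  have h1 : ⟪b i, K y - (E : ℂ) • y⟫_ℂ = ((hK.eigenvalues rfl i - E : ℝ) : ℂ) * ⟪b i, y⟫_ℂ := by
    rw [inner_sub_right, ← hK, hb, hK.apply_eigenvectorBasis, inner_smul_left, inner_smul_right]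
    push_cast
    rw [sub_mul]
    congr 2
    exact Complex.conj_ofReal _
  rw [h1, norm_mul, mul_pow, Complex.norm_real, Real.norm_eq_abs]
  by_cases hi : hK.eigenvalues rfl i = k
  · have h2 : ⟪b i, y⟫_ℂ = 0 := by
      refine hy _ (Module.End.mem_eigenspace_iff.2 ?_)
      rw [hb, hK.apply_eigenvectorBasis, hi]
      rfl
    simp [h2]
  · have := h i hi
    gcongr

/-- K − E preserves the eigenspace and its orthogonal complement, so the image splits orthogonally
and dominates each of its two parts. -/
theorem norm_eigen_projection {K : 𝒦 →ₗ[ℂ] 𝒦} (hK : K.IsSymmetric) {k g E : ℝ} (hg : 0 ≤ g)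
    (h : ∀ i, hK.eigenvalues rfl i ≠ k → g ≤ |hK.eigenvalues rfl i - E|) (ξ : 𝒦) :
    ∃ x ∈ Module.End.eigenspace K (k : ℂ), ‖ξ‖ ^ 2 = ‖x‖ ^ 2 + ‖ξ - x‖ ^ 2 ∧
      ⟪x, ξ - x⟫_ℂ = 0 ∧
      g * ‖ξ - x‖ ≤ ‖K ξ - (E : ℂ) • ξ‖ ∧ |k - E| * ‖x‖ ≤ ‖K ξ - (E : ℂ) • ξ‖ := by
  set V := Module.End.eigenspace K (k : ℂ)
  set x := V.starProjection ξ with hx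
  have hxV : x ∈ V := V.starProjection_apply_mem ξ
  have hort : ∀ z ∈ V, ⟪z, ξ - x⟫_ℂ = 0 := fun z hz => by
    rw [← inner_conj_symm, V.starProjection_inner_eq_zero ξ z hz, map_zero]
  have hxk : K x = (k : ℂ) • x := Module.End.mem_eigenspace_iff.1 hxV
  have hpyth : ∀ a b : 𝒦, ⟪a, b⟫_ℂ = 0 → ‖a + b‖ ^ 2 = ‖a‖ ^ 2 + ‖b‖ ^ 2 := fun a b hab => by
    rw [sq, sq, sq]
    exact norm_add_sq_eq_norm_sq_add_norm_sq_of_inner_eq_zero _ _ hab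
  have h1 : K ξ - (E : ℂ) • ξ = ((k - E : ℝ) : ℂ) • x + (K (ξ - x) - (E : ℂ) • (ξ - x)) := by
    rw [map_sub, hxk]
    push_cast
    module
  have h2 : ⟪((k - E : ℝ) : ℂ) • x, K (ξ - x) - (E : ℂ) • (ξ - x)⟫_ℂ = 0 := by
    rw [inner_smul_left, inner_sub_right, ← hK, hxk, inner_smul_left, inner_smul_right,
      hort x hxV]
    simp
  have h3 := hpyth _ _ h2
  rw [← h1, norm_smul, Complex.norm_real, Real.norm_eq_abs] at h3
  refine ⟨x, hxV, ?_, hort x hxV, ?_, ?_⟩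
  · have := hpyth x (ξ - x) (hort x hxV)
    rwa [add_sub_cancel] at this
  · refine (gap_mul_norm_le hK hg h hort).trans (le_of_sq_le_sq ?_ (norm_nonneg _))
    rw [h3]
    exact le_add_of_nonneg_left (sq_nonneg _)
  · refine le_of_sq_le_sq ?_ (norm_nonneg _)
    rw [h3]
    exact le_add_of_nonneg_right (sq_nonneg _)

/-- Pointwise convergence of sesquilinear forms on a finite dimensional space to a positive definite
limit implies a uniform lower bound. -/
theorem exists_eventually_le_re_inner {W H : Type*} [NormedAddCommGroup W] [InnerProductSpace ℂ W]
    [FiniteDimensional ℂ W] [NormedAddCommGroup H] [InnerProductSpace ℂ H] (L : W →ₗ[ℂ] H)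
    (A : ℝ → H →L[ℂ] H) (τ : W → W → ℂ)
    (hτ : ∀ u v, Tendsto (fun ε => ⟪L u, A ε (L v)⟫_ℂ) (𝓝[>] 0) (𝓝 (τ u v)))
    (hpos : ∀ v, v ≠ 0 → 0 < (τ v v).re) :
    ∃ γ : ℝ, 0 < γ ∧ ∀ᶠ ε in 𝓝[>] (0 : ℝ), ∀ v, γ * ‖v‖ ^ 2 ≤ (⟪L v, A ε (L v)⟫_ℂ).re := by
  set b := stdOrthonormalBasis ℂ W
  have hexp : ∀ ε v, ⟪L v, A ε (L v)⟫_ℂ = ∑ i, ∑ j, (starRingEnd ℂ ⟪b i, v⟫_ℂ *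
      ⟪b j, v⟫_ℂ) * ⟪L (b i), A ε (L (b j))⟫_ℂ := fun ε v => by
    have hv := b.sum_repr' v
    conv_lhs => rw [← hv]
    simp only [map_sum, map_smul, sum_inner, inner_sum, inner_smul_left, inner_smul_right,
      Finset.mul_sum]
    rw [Finset.sum_comm]
    exact Finset.sum_congr rfl fun i _ => Finset.sum_congr rfl fun j _ => by ring
  -- No linearity of τ is assumed; the limit inherits the expansion in a basis from the forms that
  -- converge to it.
  have hτexp : ∀ v, τ v v = ∑ i, ∑ j, (starRingEnd ℂ ⟪b i, v⟫_ℂ * ⟪b j, v⟫_ℂ) * τ (b i) (b j) :=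
    fun v => by
      refine tendsto_nhds_unique (hτ v v) ?_
      simp only [hexp]
      exact tendsto_finsetSum _ fun i _ => tendsto_finsetSum _ fun j _ => (hτ _ _).const_mul _
  -- Compactness of the unit sphere gives a positive minimum. It is called 2γ so that half of it can
  -- absorb the approximation error.
  obtain ⟨γ, hγ, hTγ⟩ : ∃ γ : ℝ, 0 < γ ∧ ∀ v, 2 * γ * ‖v‖ ^ 2 ≤ (τ v v).re := by
    have : ProperSpace W := FiniteDimensional.proper ℂ W
    rcases subsingleton_or_nontrivial W with h | h
    · refine ⟨1, one_pos, fun v => ?_⟩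
      rw [hτexp]
      simp [Subsingleton.elim v 0]
    · have hne : (Metric.sphere (0 : W) 1).Nonempty := by
        obtain ⟨w, hw⟩ := exists_ne (0 : W)
        refine ⟨((‖w‖⁻¹ : ℝ) : ℂ) • w, ?_⟩
        rw [mem_sphere_zero_iff_norm, norm_smul, Complex.norm_real, norm_inv, norm_norm,
          inv_mul_cancel₀ (norm_ne_zero_iff.2 hw)]
      have hc : Continuous fun v : W => (τ v v).re := by
        simp only [hτexp]
        fun_prop
      obtain ⟨w, hw, hmin⟩ := (isCompact_sphere (0 : W) 1).exists_isMinOn hne hc.continuousOn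
      have hw0 : w ≠ 0 := by
        rintro rfl
        simp at hw
      refine ⟨(τ w w).re / 2, half_pos (hpos w hw0), fun v => ?_⟩
      rcases eq_or_ne v 0 with rfl | hv
      · rw [hτexp 0]
        simp
      · have hn : (0 : ℝ) < ‖v‖ := norm_pos_iff.2 hv
        set r : ℝ := ‖v‖⁻¹ with hr
        have h1 : (τ w w).re ≤ (τ ((r : ℂ) • v) ((r : ℂ) • v)).re := hmin (by
          rw [mem_sphere_zero_iff_norm, norm_smul, Complex.norm_real, norm_inv, norm_norm,
            inv_mul_cancel₀ hn.ne'])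
        have h2 : τ ((r : ℂ) • v) ((r : ℂ) • v) = ((r * r : ℝ) : ℂ) * τ v v := by
          refine tendsto_nhds_unique (hτ _ _) ?_
          refine ((hτ v v).const_mul _).congr fun ε => ?_
          simp only [map_smul, inner_smul_left, inner_smul_right, Complex.conj_ofReal]
          push_cast
          ring
        rw [h2, Complex.re_ofReal_mul] at h1
        have h3 := mul_le_mul_of_nonneg_right h1 (sq_nonneg ‖v‖)
        calc _ = (τ w w).re * ‖v‖ ^ 2 := by ring
          _ ≤ _ := h3
          _ = _ := by rw [hr]; field_simp
  refine ⟨γ, hγ, ?_⟩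
  -- The total error of the finitely many matrix entries controls the quadratic form at all vectors
  -- at once.
  set D : ℝ → ℝ := fun ε => ∑ i, ∑ j, ‖⟪L (b i), A ε (L (b j))⟫_ℂ - τ (b i) (b j)‖ with hD
  have hlim : Tendsto D (𝓝[>] 0) (𝓝 0) := by
    have h1 : Tendsto D (𝓝[>] 0) (𝓝 (∑ i, ∑ j, ‖τ (b i) (b j) - τ (b i) (b j)‖)) :=
      tendsto_finsetSum _ fun i _ => tendsto_finsetSum _ fun j _ =>
        ((hτ (b i) (b j)).sub_const _).norm
    simpa using h1
  filter_upwards [hlim.eventually_lt_const hγ] with ε hε v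
  have hb : ∀ i, ‖⟪b i, v⟫_ℂ‖ ≤ ‖v‖ := fun i =>
    (norm_inner_le_norm _ _).trans_eq (by rw [b.norm_eq_one, one_mul])
  have hdiff : ‖⟪L v, A ε (L v)⟫_ℂ - τ v v‖ ≤ γ * ‖v‖ ^ 2 := by
    rw [hexp, hτexp]
    simp only [← Finset.sum_sub_distrib, ← mul_sub]
    calc _ ≤ ∑ i, ∑ j, ‖v‖ ^ 2 * ‖⟪L (b i), A ε (L (b j))⟫_ℂ - τ (b i) (b j)‖ := by
          refine (norm_sum_le _ _).trans (Finset.sum_le_sum fun i _ =>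
            (norm_sum_le _ _).trans (Finset.sum_le_sum fun j _ => ?_))
          rw [norm_mul, norm_mul, RCLike.norm_conj, sq]
          gcongr
          · exact hb i
          · exact hb j
      _ = ‖v‖ ^ 2 * D ε := by simp only [hD, Finset.mul_sum]
      _ ≤ _ := by
          rw [mul_comm]
          gcongr
  have h2 := (Complex.abs_re_le_norm _).trans hdiff
  rw [Complex.sub_re] at h2
  have h3 := (abs_le.1 h2).1
  have h4 := hTγ v
  linarith

end Spectral

/-! ### From the Fermi golden rule to approximate one-boson solutions. -/

section GoldenRule

variable {d : ℕ} {𝒦 : Type*} [NormedAddCommGroup 𝒦] [InnerProductSpace ℂ 𝒦]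
  [FiniteDimensional ℂ 𝒦]

theorem wave_fieldOnLevel (K : 𝒦 →ₗ[ℂ] 𝒦) (α : 𝒦 →L[ℂ] OneBoson 𝒦 d) (E : ℝ)
    (v : levelSpace d K E) (n : ℕ) :
    wave (fieldOnLevel K α E v) n =ᵐ[volume] fieldWave α (v : FockSpace 𝒦 d) n :=
  wave_fieldOperator α ⟨v, levelSpace_le_domain K α E v.2⟩ n

theorem annihilate_vacuum (α : 𝒦 →L[ℂ] OneBoson 𝒦 d) (x : 𝒦) (n : ℕ) :
    annihilate α (wave (vacuum 𝒦 d x) (n + 1)) =ᵐ[volume] 0 := by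
  have := annihilate_congr α (wave_vacuum_ne (d := d) x (Nat.succ_ne_zero n))
  rwa [annihilate_zero] at this

/-- The one-boson wave function of `φ(α) (x ⊗ Ω)`. -/
def vacuumWave (α : 𝒦 →L[ℂ] OneBoson 𝒦 d) (x : 𝒦) : (Fin 1 → Mom d) → 𝒦 :=
  (((√2)⁻¹ : ℝ) : ℂ) • create α (fun _ : Fin 0 → Mom d => x)

theorem memLp_vacuumWave (α : 𝒦 →L[ℂ] OneBoson 𝒦 d) (x : 𝒦) :
    MemLp (vacuumWave α x) 2 volume :=
  (memLp_create α (memLp_const x)).const_smul _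

theorem fieldWave_vacuum_one (α : 𝒦 →L[ℂ] OneBoson 𝒦 d) (x : 𝒦) :
    fieldWave α (vacuum 𝒦 d x) 1 =ᵐ[volume] vacuumWave α x := by
  filter_upwards [annihilate_vacuum α x 1, create_congr α (wave_vacuum_zero (d := d) x)]
    with k h1 h2
  simp only [fieldWave, vacuumWave, Pi.smul_apply, Pi.add_apply]
  rw [h1, h2]
  simp

theorem fieldWave_vacuum_ne (α : 𝒦 →L[ℂ] OneBoson 𝒦 d) (x : 𝒦) {n : ℕ} (hn : n ≠ 1) :
    fieldWave α (vacuum 𝒦 d x) n =ᵐ[volume] 0 := by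
  match n with
  | 0 =>
    filter_upwards [annihilate_vacuum α x 0] with k h1
    simp only [fieldWave, Pi.smul_apply]
    rw [h1]
    simp
  | n + 2 =>
    have h2 := create_congr α (wave_vacuum_ne (d := d) x (Nat.succ_ne_zero n))
    rw [create_zero] at h2
    filter_upwards [annihilate_vacuum α x (n + 2), h2] with k h1 h2
    simp only [fieldWave, Pi.smul_apply, Pi.add_apply]
    rw [h1, h2]
    simp

/-- The field maps x ⊗ Ω into the one-boson sector, which is orthogonal to the vacuum sector, so the
complementary projections in the golden rule can be dropped. -/
theorem complProjection_fieldOnLevel (K : 𝒦 →ₗ[ℂ] 𝒦) (α : 𝒦 →L[ℂ] OneBoson 𝒦 d) (E : ℝ)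
    (v : levelSpace d K E) :
    complProjection d K E (fieldOnLevel K α E v) = fieldOnLevel K α E v := by
  have h : fieldOnLevel K α E v ∈ (levelSpace d K E)ᗮ := by
    rw [Submodule.mem_orthogonal]
    rintro _ ⟨y, -, rfl⟩
    rw [inner_of_component_eq_zero fun n hn => wave_vacuum_ne y hn]
    refine integral_eq_zero_of_ae ?_
    obtain ⟨x, -, hx⟩ := v.2
    have h1 := wave_fieldOnLevel K α E v 0
    rw [← hx] at h1
    filter_upwards [h1, fieldWave_vacuum_ne α x zero_ne_one] with k h2 h3
    rw [h2, h3]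
    simp
  simp [complProjection, (Submodule.starProjection_apply_eq_zero_iff _).2 h]

theorem inner_complProjection_comm (K : 𝒦 →ₗ[ℂ] 𝒦) (E : ℝ) (ψ χ : FockSpace 𝒦 d) :
    ⟪ψ, complProjection d K E χ⟫_ℂ = ⟪complProjection d K E ψ, χ⟫_ℂ := by
  simp only [complProjection, _root_.sub_apply, ContinuousLinearMap.id_apply,
    inner_sub_left, inner_sub_right, Submodule.inner_starProjection_left_eq_right]

theorem re_inner_imaginaryPart (R : FockSpace 𝒦 d →L[ℂ] FockSpace 𝒦 d) (η : FockSpace 𝒦 d) :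
    (⟪η, (ℑ R : FockSpace 𝒦 d →L[ℂ] FockSpace 𝒦 d) η⟫_ℂ).re = (⟪η, R η⟫_ℂ).im := by
  have h1 : (ℑ R : FockSpace 𝒦 d →L[ℂ] FockSpace 𝒦 d) η =
      (-Complex.I * ((2⁻¹ : ℝ) : ℂ)) • (R η - (star R) η) := by
    rw [imaginaryPart_apply_coe, mul_smul, Complex.coe_smul]
    rfl
  rw [h1, inner_smul_right, inner_sub_right, ContinuousLinearMap.star_eq_adjoint,
    ContinuousLinearMap.adjoint_inner_right, ← inner_conj_symm (R η) η]
  generalize ⟪η, R η⟫_ℂ = z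
  simp only [Complex.mul_re, Complex.mul_im, Complex.neg_re, Complex.neg_im, Complex.I_re,
    Complex.I_im, Complex.ofReal_re, Complex.ofReal_im, Complex.sub_re, Complex.sub_im,
    Complex.conj_re, Complex.conj_im]
  ring

/-- The vector `x ⊗ Ω` as an element of the range of `P`. -/
def levelVacuum (d : ℕ) {K : 𝒦 →ₗ[ℂ] 𝒦} {E : ℝ} (x : Module.End.eigenspace K (E : ℂ)) :
    levelSpace d K E :=
  ⟨vacuum 𝒦 d x, x, x.2, rfl⟩

/-- The map `x ↦ φ(α) (x ⊗ Ω)`. -/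
def fieldVacuum (α : 𝒦 →L[ℂ] OneBoson 𝒦 d) : 𝒦 →ₗ[ℂ] FockSpace 𝒦 d :=
  (fieldOperator α).toFun ∘ₗ (vacuum 𝒦 d).codRestrict (fieldOperator α).domain fun x =>
    (LinearPMap.le_closure (fieldGraph α).toLinearPMap).1 ⟨_, vacuum_mem_fieldGraph α x, rfl⟩

theorem fieldOnLevel_levelVacuum {K : 𝒦 →ₗ[ℂ] 𝒦} (α : 𝒦 →L[ℂ] OneBoson 𝒦 d) {E : ℝ}
    (x : Module.End.eigenspace K (E : ℂ)) :
    fieldOnLevel K α E (levelVacuum d x) = fieldVacuum α x := rfl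

theorem wave_fieldVacuum_one (α : 𝒦 →L[ℂ] OneBoson 𝒦 d) (x : 𝒦) :
    wave (fieldVacuum α x) 1 =ᵐ[volume] vacuumWave α x :=
  (wave_fieldOperator α ⟨vacuum 𝒦 d x, _⟩ 1).trans (fieldWave_vacuum_one α x)

theorem wave_fieldVacuum_ne (α : 𝒦 →L[ℂ] OneBoson 𝒦 d) (x : 𝒦) {n : ℕ} (hn : n ≠ 1) :
    wave (fieldVacuum α x) n =ᵐ[volume] 0 :=
  (wave_fieldOperator α ⟨vacuum 𝒦 d x, _⟩ n).trans (fieldWave_vacuum_ne α x hn)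

/-- The range of P has finite dimension, so a positive definite weak limit yields one constant γ for
all x and all small ε. The form of the imaginary part of the resolvent is the imaginary part of its
form. -/
theorem FermiGoldenRule.exists_lower_bound {K : 𝒦 →ₗ[ℂ] 𝒦} {α : 𝒦 →L[ℂ] OneBoson 𝒦 d} {k : ℝ}
    (h : FermiGoldenRule K α k) : ∃ γ : ℝ, 0 < γ ∧ ∀ᶠ ε : ℝ in 𝓝[>] 0,
      ∀ x : Module.End.eigenspace K (k : ℂ), γ * ‖x‖ ^ 2 ≤ (⟪fieldVacuum α x,
        resolventAt (freeHamiltonian d K) (k + ε * Complex.I) (fieldVacuum α x)⟫_ℂ).im := by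
  obtain ⟨T, hT, hpos⟩ := h
  obtain ⟨γ, hγ, hev⟩ := exists_eventually_le_re_inner
    (fieldVacuum α ∘ₗ (Module.End.eigenspace K (k : ℂ)).subtype)
    (fun ε => (ℑ (resolventAt (freeHamiltonian d K) (k + ε * Complex.I)) :
        FockSpace 𝒦 d →L[ℂ] FockSpace 𝒦 d))
    (fun x y => ⟪levelVacuum d x, T (levelVacuum d y)⟫_ℂ)
    (fun x y => by
      have h1 := hT (levelVacuum d x) (levelVacuum d y)
      simp only [inner_complProjection_comm, complProjection_fieldOnLevel] at h1
      simp only [fieldOnLevel_levelVacuum] at h1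
      exact h1)
    (fun x hx => hpos _ fun h0 => hx (by
      have h1 : vacuum 𝒦 d (x : 𝒦) = 0 := congrArg Subtype.val h0
      have h2 := norm_vacuum (d := d) (x : 𝒦)
      rw [h1, norm_zero] at h2
      exact Subtype.ext (norm_eq_zero.1 h2.symm)))
  refine ⟨γ, hγ, hev.mono fun ε hε x => ?_⟩
  have h1 := hε x
  rwa [re_inner_imaginaryPart] at h1

theorem fibre_of_isResolvent {K : 𝒦 →ₗ[ℂ] 𝒦} {k ε : ℝ} {R : FockSpace 𝒦 d →L[ℂ] FockSpace 𝒦 d}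
    (h : IsResolvent (freeHamiltonian d K) (k + ε * Complex.I) R) (η : FockSpace 𝒦 d) (n : ℕ) :
    ∀ᵐ q, fibre K k q (wave (R η) n q) - (ε * Complex.I) • wave (R η) n q = wave η n q := by
  obtain ⟨hdom, heq⟩ := h.1 η
  have h2 := wave_freeHamiltonian K ⟨R η, hdom⟩ n
  have h3 : freeHamiltonian d K ⟨R η, hdom⟩ = η + (k + ε * Complex.I) • R η :=
    sub_eq_iff_eq_add.1 heq
  rw [h3] at h2
  filter_upwards [h2, wave_add η ((k + ε * Complex.I) • R η) n,
    wave_smul (k + ε * Complex.I) (R η) n] with q h4 h6 h7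
  rw [h6, Pi.add_apply, h7] at h4
  rw [← sub_eq_zero] at h4 ⊢
  rw [← neg_eq_zero, ← h4]
  simp only [fibre, LinearMap.add_apply, LinearMap.smul_apply, LinearMap.id_apply, Pi.smul_apply]
  push_cast
  module

/-- The Fermi golden rule provides approximate solutions of the one-boson equation. -/
theorem FermiGoldenRule.exists_solution {K : 𝒦 →ₗ[ℂ] 𝒦} {α : 𝒦 →L[ℂ] OneBoson 𝒦 d} {k : ℝ}
    (h : FermiGoldenRule K α k) : ∃ γ : ℝ, 0 < γ ∧ ∀ᶠ ε : ℝ in 𝓝[>] 0,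
      ∀ x ∈ Module.End.eigenspace K (k : ℂ), x ≠ 0 → ∃ f : (Fin 1 → Mom d) → 𝒦,
        MemLp f 2 volume ∧
        (∀ᵐ q, fibre K k q (f q) - (ε * Complex.I) • f q = vacuumWave α x q) ∧
        γ * ‖x‖ ^ 2 ≤ (∫ q, ⟪vacuumWave α x q, f q⟫_ℂ).im := by
  obtain ⟨γ, hγ, hev⟩ := h.exists_lower_bound
  refine ⟨γ, hγ, hev.mono fun ε hε x hx hx0 => ?_⟩
  have h1 : γ * ‖x‖ ^ 2 ≤ _ := hε ⟨x, hx⟩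
  have hη1 := wave_fieldVacuum_one α x
  have hη0 : ∀ n, n ≠ 1 → wave (fieldVacuum α x) n =ᵐ[volume] 0 := fun n hn =>
    wave_fieldVacuum_ne α x hn
  dsimp only at h1
  generalize fieldVacuum α x = η at h1 hη1 hη0
  by_cases hex : ∃ R, IsResolvent (freeHamiltonian d K) (k + ε * Complex.I) R
  · rw [resolventAt, dif_pos hex] at h1
    have hres := hex.choose_spec
    generalize hex.choose = R at h1 hres
    refine ⟨wave (R η) 1, memLp_wave _ _, ?_, ?_⟩
    · filter_upwards [fibre_of_isResolvent hres η 1, hη1] with q h2 h3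
      rw [h2, h3]
    · rw [inner_of_component_eq_zero hη0] at h1
      refine h1.trans_eq ?_
      congr 1
      refine integral_congr_ae ?_
      filter_upwards [hη1] with q hq
      rw [hq]
  -- Without a resolvent `resolventAt` is zero and the lower bound would read γ‖x‖² ≤ 0. The golden
  -- rule itself thus supplies the resolvent, and no self-adjointness of H₀ has to be proved.
  · exfalso
    rw [resolventAt, dif_neg hex] at h1
    simp only [_root_.zero_apply, inner_zero_right, Complex.zero_im] at h1
    have : 0 < γ * ‖x‖ ^ 2 := by
      have := norm_pos_iff.2 hx0
      positivity
    linarith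

theorem inner_fibre_comm {K : 𝒦 →ₗ[ℂ] 𝒦} (hK : K.IsSymmetric) (E : ℝ) {n : ℕ}
    (q : Fin n → Mom d) (x y : 𝒦) : ⟪fibre K E q x, y⟫_ℂ = ⟪x, fibre K E q y⟫_ℂ := by
  simp only [fibre, LinearMap.add_apply, LinearMap.smul_apply, LinearMap.id_apply, inner_add_left,
    inner_add_right, inner_smul_left, inner_smul_right, Complex.conj_ofReal]
  rw [hK]

/-- When the equation is paired with f, the symmetric fibre contributes a real number and only the ε
term has an imaginary part. -/
theorem im_integral_of_solution {K : 𝒦 →ₗ[ℂ] 𝒦} (hK : K.IsSymmetric) {k ε : ℝ} {n : ℕ}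
    {f u : (Fin n → Mom d) → 𝒦} (hf : MemLp f 2 volume) (hu : MemLp u 2 volume)
    (h : ∀ᵐ q, fibre K k q (f q) - (ε * Complex.I) • f q = u q) :
    (∫ q, ⟪u q, f q⟫_ℂ).im = ε * l2norm f volume ^ 2 := by
  have h1 : ∫ q, (⟪u q, f q⟫_ℂ).im = (∫ q, ⟪u q, f q⟫_ℂ).im :=
    integral_im (𝕜 := ℂ) (integrable_inner hu hf)
  rw [← h1, l2norm_sq hf, ← integral_const_mul]
  refine integral_congr_ae ?_
  filter_upwards [h] with q hq
  have h2 : (⟪fibre K k q (f q), f q⟫_ℂ).im = 0 := by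
    rw [← Complex.conj_eq_iff_im, inner_conj_symm, inner_fibre_comm hK]
  rw [← hq, inner_sub_left, Complex.sub_im, h2, inner_smul_left, inner_self_eq_norm_sq_to_K]
  simp [← Complex.ofReal_pow]

/-- Inserting u = (H₀ − k − iε)f into ⟨u, φ⟩ and moving the operator to φ gives −λ⟨f, u⟩ − λ⟨f, g⟩ +
(E − k + iε)⟨f, φ⟩. The left side is real and Im⟨f, u⟩ = −ε‖f‖², so the other terms must balance
λε‖f‖²; one factor ‖f‖ is then divided out. -/
theorem norm_solution_le {K : 𝒦 →ₗ[ℂ] 𝒦} (hK : K.IsSymmetric) {k ε E lam : ℝ} (hε : 0 ≤ ε) {n : ℕ}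
    {f u g φ : (Fin n → Mom d) → 𝒦} (hf : MemLp f 2 volume) (hu : MemLp u 2 volume)
    (hg : MemLp g 2 volume) (hφ : MemLp φ 2 volume)
    (h : ∀ᵐ q, fibre K k q (f q) - (ε * Complex.I) • f q = u q)
    (hE : ∀ᵐ q, fibre K E q (φ q) = (-(lam : ℂ)) • (u q + g q))
    (him : (∫ q, ⟪u q, φ q⟫_ℂ).im = 0) :
    |lam| * (ε * l2norm f volume) ≤
      |lam| * l2norm g volume + (|k - E| + ε) * l2norm φ volume := by
  have h1 := im_integral_of_solution hK hf hu h
  have h2 : ∫ q, ⟪u q, φ q⟫_ℂ = (-(lam : ℂ)) * (∫ q, ⟪f q, u q⟫_ℂ) +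
      ((-(lam : ℂ)) * (∫ q, ⟪f q, g q⟫_ℂ) +
        (((E - k : ℝ) : ℂ) + ε * Complex.I) * (∫ q, ⟪f q, φ q⟫_ℂ)) := by
    have i1 := (integrable_inner hf hu).const_mul (-(lam : ℂ))
    have i2 := (integrable_inner hf hg).const_mul (-(lam : ℂ))
    have i3 := (integrable_inner hf hφ).const_mul (((E - k : ℝ) : ℂ) + ε * Complex.I)
    have i4 : Integrable fun q => -(lam : ℂ) * ⟪f q, g q⟫_ℂ +
      (((E - k : ℝ) : ℂ) + ε * Complex.I) * ⟪f q, φ q⟫_ℂ := i2.add i3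
    rw [← integral_const_mul, ← integral_const_mul, ← integral_const_mul,
      ← integral_add i2 i3, ← integral_add i1 i4]
    refine integral_congr_ae ?_
    filter_upwards [h, hE] with q h3 h4
    have h5 : fibre K k q (φ q) = fibre K E q (φ q) + ((E - k : ℝ) : ℂ) • φ q := by
      simp only [fibre, LinearMap.add_apply, LinearMap.smul_apply, LinearMap.id_apply]
      push_cast
      module
    have h6 : ⟪u q, φ q⟫_ℂ = ⟪f q, fibre K k q (φ q)⟫_ℂ + ε * Complex.I * ⟪f q, φ q⟫_ℂ := by
      rw [← h3, inner_sub_left, inner_fibre_comm hK, inner_smul_left]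
      simp
    rw [h6, h5, h4]
    simp only [inner_add_right, inner_smul_right]
    ring
  have h3 : (∫ q, ⟪f q, u q⟫_ℂ).im = -(ε * l2norm f volume ^ 2) := by
    rw [← h1, im_integral_inner_comm]
  set A := ∫ q, ⟪f q, g q⟫_ℂ with hA
  set B := ∫ q, ⟪f q, φ q⟫_ℂ with hB
  set a := l2norm f volume with ha
  have hA' : ‖A‖ ≤ a * l2norm g volume := norm_integral_inner_le hf hg
  have hB' : ‖B‖ ≤ a * l2norm φ volume := norm_integral_inner_le hf hφ
  have hC : ‖((E - k : ℝ) : ℂ) + ε * Complex.I‖ ≤ |k - E| + ε := by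
    refine (norm_add_le _ _).trans ?_
    rw [norm_mul, Complex.norm_I, Complex.norm_real, Complex.norm_real, Real.norm_eq_abs,
      Real.norm_of_nonneg hε, abs_sub_comm]
    simp
  have h4 := congrArg Complex.im h2
  rw [him, Complex.add_im, ← Complex.ofReal_neg, Complex.im_ofReal_mul, h3] at h4
  have h5 : lam * (ε * a ^ 2) = -(((-lam : ℝ) : ℂ) * A +
      (((E - k : ℝ) : ℂ) + ε * Complex.I) * B).im := by linarith
  have h6 : |lam| * (ε * a ^ 2) ≤ |lam| * (a * l2norm g volume) +
      (|k - E| + ε) * (a * l2norm φ volume) := by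
    have h7 : |lam| * (ε * a ^ 2) = |lam * (ε * a ^ 2)| := by
      rw [abs_mul, abs_of_nonneg (by positivity : 0 ≤ ε * a ^ 2)]
    rw [h7, h5, abs_neg]
    refine (Complex.abs_im_le_norm _).trans ((norm_add_le _ _).trans ?_)
    rw [norm_mul, norm_mul, Complex.norm_real, Real.norm_eq_abs, abs_neg]
    gcongr
  rcases (l2norm_nonneg f volume).eq_or_lt with h0 | h0
  · rw [ha, ← h0]
    have := l2norm_nonneg g volume
    have := l2norm_nonneg φ volume
    have : 0 ≤ (|k - E| + ε) * l2norm φ volume := by positivity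
    have : 0 ≤ |lam| * l2norm g volume := by positivity
    simp only [mul_zero]
    linarith
  · refine le_of_mul_le_mul_right ?_ h0
    rw [← ha]
    linarith

end GoldenRule

/-! ### Estimates on the vacuum and one-boson components of an eigenvector. -/

section Perturbation

variable {d : ℕ} {𝒦 : Type*} [NormedAddCommGroup 𝒦] [InnerProductSpace ℂ 𝒦]
  [FiniteDimensional ℂ 𝒦]

theorem bounds_of_sum_le {s : ℕ → ℝ} {N c : ℝ} (hc : 0 ≤ c)
    (hs : HasSum (fun n => s n ^ 2) (N ^ 2))
    (h : ∀ M : ℕ, ∑ n ∈ Finset.range M, ((n : ℝ) + 1) * s (n + 1) ^ 2 ≤ c ^ 2) :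
    (∀ n, s (n + 1) ≤ c) ∧ N ^ 2 ≤ s 0 ^ 2 + c ^ 2 := by
  have h1 : ∀ M : ℕ, ∑ n ∈ Finset.range M, s (n + 1) ^ 2 ≤ c ^ 2 := fun M =>
    (Finset.sum_le_sum fun n _ => le_mul_of_one_le_left (sq_nonneg _) (by
      linarith [Nat.cast_nonneg (α := ℝ) n])).trans (h M)
  refine ⟨fun n => ?_, ?_⟩
  · refine le_of_sq_le_sq ((Finset.single_le_sum (f := fun n => s (n + 1) ^ 2)
      (fun _ _ => sq_nonneg _) (Finset.self_mem_range_succ n)).trans (h1 (n + 1))) hc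
  · rw [← hs.tsum_eq, hs.summable.tsum_eq_zero_add]
    have h3 : Summable fun n => s (n + 1) ^ 2 :=
      (summable_nat_add_iff (f := fun n => s n ^ 2) 1).2 hs.summable
    gcongr
    exact le_of_tendsto' h3.hasSum.tendsto_sum_nat h1

/-- The estimates on an eigenvector that come from its components with at most one boson. -/
theorem eigenvector_estimate {K : 𝒦 →ₗ[ℂ] 𝒦} (hK : K.IsSymmetric) {α : 𝒦 →L[ℂ] OneBoson 𝒦 d}
    {k E lam gap ε γ : ℝ} (hlam : 0 < |lam|) (hgap : 0 ≤ gap) (hε : 0 < ε)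
    (hg : ∀ i, hK.eigenvalues rfl i ≠ k → gap ≤ |hK.eigenvalues rfl i - E|)
    (hγ : ∀ x ∈ Module.End.eigenspace K (k : ℂ), x ≠ 0 → ∃ f : (Fin 1 → Mom d) → 𝒦,
        MemLp f 2 volume ∧
        (∀ᵐ q, fibre K k q (f q) - (ε * Complex.I) • f q = vacuumWave α x q) ∧
        γ * ‖x‖ ^ 2 ≤ (∫ q, ⟪vacuumWave α x q, f q⟫_ℂ).im)
    {ψ : FockSpace 𝒦 d}
    (h : ∀ n, ∀ᵐ k, fibre K E k (wave ψ n k) = (-(lam : ℂ)) • fieldWave α ψ n k) :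
    ∃ X y : ℝ, 0 ≤ X ∧ 0 ≤ y ∧ ‖ψ 0‖ ^ 2 = X ^ 2 + y ^ 2 ∧
      gap * y ≤ |lam| * (formNorm α * ‖ψ 1‖) ∧
      |k - E| * X ≤ |lam| * (formNorm α * ‖ψ 1‖) ∧
      (0 < X → ∃ a : ℝ, 0 ≤ a ∧ γ * X ^ 2 ≤ ε * a ^ 2 ∧
        |lam| * (ε * a) ≤ |lam| * (2 * (formNorm α * ‖ψ 2‖) + formNorm α * y) +
          (|k - E| + ε) * ‖ψ 1‖) := by
  have hF := formNorm_nonneg α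
  set ξ := wave ψ 0 default with hξ
  have hξc : wave ψ 0 = fun _ => ξ := funext fun q => by rw [hξ, Subsingleton.elim q default]
  have hξn : ‖ψ 0‖ = ‖ξ‖ := by rw [← l2norm_wave, l2norm_fin_zero]
  have h0 : K ξ - (E : ℂ) • ξ = (-(lam : ℂ)) • ((((√2)⁻¹ : ℝ) : ℂ) •
      annihilate α (wave ψ 1) default) := by
    have h1 := ae_fin_zero (h 0)
    simp only [fieldWave, Pi.smul_apply] at h1
    rw [← hξ] at h1
    rw [← h1]
    simp [fibre, sub_eq_add_neg]
  have hρ : ‖K ξ - (E : ℂ) • ξ‖ ≤ |lam| * (formNorm α * ‖ψ 1‖) := by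
    rw [h0, norm_smul, norm_smul, norm_neg, Complex.norm_real, Real.norm_eq_abs,
      ← l2norm_fin_zero]
    refine mul_le_mul_of_nonneg_left ?_ (abs_nonneg _)
    refine (mul_le_of_le_one_left (l2norm_nonneg _ _) norm_inv_sqrt_two).trans ?_
    have h1 := l2norm_annihilate_le α (memLp_wave ψ 1)
    rw [l2norm_wave] at h1
    simpa using h1
  obtain ⟨x, hx, hpyth, hort, hy, hkE⟩ := norm_eigen_projection hK hgap hg ξ
  refine ⟨‖x‖, ‖ξ - x‖, norm_nonneg _, norm_nonneg _, by rw [hξn, hpyth], hy.trans hρ,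
    hkE.trans hρ, fun hX => ?_⟩
  obtain ⟨f, hf, hfeq, hfγ⟩ := hγ x hx (norm_pos_iff.1 hX)
  have hu := memLp_vacuumWave (d := d) α x
  rw [im_integral_of_solution hK hf hu hfeq] at hfγ
  refine ⟨l2norm f volume, l2norm_nonneg _ _, hfγ, ?_⟩
  -- The remainder of the one-boson source: annihilation from two bosons and creation from the part
  -- of the vacuum component outside the eigenspace.
  set g : (Fin 1 → Mom d) → 𝒦 := (((√2)⁻¹ : ℝ) : ℂ) • (annihilate α (wave ψ 2) +
    create α (fun _ : Fin 0 → Mom d => ξ - x)) with hgdef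
  have hann := memLp_annihilate α (memLp_wave ψ 2)
  have hcr : MemLp (create α (fun _ : Fin 0 → Mom d => ξ - x)) 2 volume :=
    memLp_create α (memLp_const _)
  have hgm : MemLp g 2 volume := (hann.add hcr).const_smul _
  have hgn : l2norm g volume ≤ 2 * (formNorm α * ‖ψ 2‖) + formNorm α * ‖ξ - x‖ := by
    rw [hgdef, l2norm_smul]
    refine (mul_le_of_le_one_left (l2norm_nonneg _ _) norm_inv_sqrt_two).trans ?_
    refine (l2norm_add_le hann hcr).trans (add_le_add ?_ ?_)
    · refine (l2norm_annihilate_le α (memLp_wave ψ 2)).trans ?_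
      rw [l2norm_wave]
      refine mul_le_mul_of_nonneg_right ?_ (by positivity)
      rw [Real.sqrt_le_left (by norm_num)]
      norm_num
    · refine (l2norm_create_le α (memLp_const _)).trans_eq ?_
      rw [l2norm_fin_zero]
      simp
  have hE : ∀ᵐ q, fibre K E q (wave ψ 1 q) = (-(lam : ℂ)) • (vacuumWave α x q + g q) := by
    filter_upwards [h 1] with q hq
    rw [hq]
    congr 1
    have h1 : (fun _ : Fin 0 → Mom d => ξ) = (fun _ => x) + fun _ => ξ - x := by
      funext q
      simp
    simp only [fieldWave, vacuumWave, hgdef, Pi.smul_apply, Pi.add_apply, hξc]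
    rw [h1, create_add, Pi.add_apply]
    module
  -- Pairing the vacuum equation with x gives −λ⟨u, ψ₁⟩ = (k − E)‖x‖², which is real, and λ ≠ 0.
  have him : (∫ q, ⟪vacuumWave α x q, wave ψ 1 q⟫_ℂ).im = 0 := by
    have h1 : ∫ q, ⟪vacuumWave α x q, wave ψ 1 q⟫_ℂ =
        ⟪x, (((√2)⁻¹ : ℝ) : ℂ) • annihilate α (wave ψ 1) default⟫_ℂ := by
      rw [inner_smul_right, ← integral_inner_create_const α x (memLp_wave ψ 1),
        ← integral_const_mul]
      simp only [vacuumWave, Pi.smul_apply, inner_smul_left, Complex.conj_ofReal]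
    have hxk : K x = (k : ℂ) • x := Module.End.mem_eigenspace_iff.1 hx
    have h2 : ⟪x, ξ⟫_ℂ = ((‖x‖ ^ 2 : ℝ) : ℂ) := by
      have h3 : ξ = x + (ξ - x) := by abel
      rw [h3, inner_add_right, hort, add_zero, inner_self_eq_norm_sq_to_K]
      push_cast
      rfl
    have h3 : ((-lam : ℝ) : ℂ) * ∫ q, ⟪vacuumWave α x q, wave ψ 1 q⟫_ℂ =
        (((k - E) * ‖x‖ ^ 2 : ℝ) : ℂ) := by
      rw [h1, Complex.ofReal_neg, ← inner_smul_right, ← h0, inner_sub_right, ← hK, hxk,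
        inner_smul_left, inner_smul_right, Complex.conj_ofReal, h2]
      push_cast
      ring
    have h4 := congrArg Complex.im h3
    rw [Complex.im_ofReal_mul, Complex.ofReal_im] at h4
    exact (mul_eq_zero.1 h4).resolve_left (neg_ne_zero.2 (abs_pos.1 hlam))
  have h1 := norm_solution_le hK hε.le hf hu hgm (memLp_wave ψ 1) hfeq hE him
  rw [l2norm_wave] at h1
  refine h1.trans ?_
  gcongr

end Perturbation

/-- For weak coupling the estimates on an eigenvector are contradictory. -/
theorem weak_coupling_contradiction {C F γ gap ε L N ξ X y n₁ n₂ κ : ℝ} (hC : 0 < C) (hF : 0 ≤ F)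
    (hγ : 0 < γ) (hgap : 0 < gap) (hε : 0 < ε) (hεγ : 16 * C ^ 2 * ε < γ) (hL : 0 < L) (hL1 : L ≤ 1)
    (hLC : C * L ≤ 1 / 2) (hLgap : 4 * (F * C * L) ≤ gap)
    (hLε : (2 * F * C + F * (F * C / gap) + 2 * F * C ^ 2) * L ≤ ε * C) (hN : 0 < N)
    (hX0 : 0 ≤ X) (hy0 : 0 ≤ y) (hκ : 0 ≤ κ) (hn₁0 : 0 ≤ n₁)
    (hn₁ : n₁ ≤ C * L * N) (hn₂ : n₂ ≤ C * L * N) (hξ : N ^ 2 ≤ ξ ^ 2 + (C * L * N) ^ 2)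
    (hsq : ξ ^ 2 = X ^ 2 + y ^ 2) (hy : gap * y ≤ L * (F * n₁)) (hκX : κ * X ≤ L * (F * n₁))
    (ha : 0 < X → ∃ a : ℝ, 0 ≤ a ∧ γ * X ^ 2 ≤ ε * a ^ 2 ∧
      L * (ε * a) ≤ L * (2 * (F * n₂) + F * y) + (κ + ε) * n₁) : False := by
  have h1 : L * (F * n₁) ≤ F * C * L * L * N := by
    calc _ ≤ L * (F * (C * L * N)) := by gcongr
      _ = _ := by ring
  have hyb : y ≤ F * C / gap * L * L * N := by
    rw [show F * C / gap * L * L * N = (F * C * L * L * N) / gap by ring, le_div_iff₀ hgap]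
    linarith
  have hy4 : y ≤ N / 4 := by
    have h2 : gap * y ≤ gap * (N / 4) := by
      calc gap * y ≤ F * C * L * L * N := hy.trans h1
        _ ≤ F * C * L * 1 * N := by gcongr
        _ = (4 * (F * C * L)) * (N / 4) := by ring
        _ ≤ gap * (N / 4) := by gcongr
    exact le_of_mul_le_mul_left h2 hgap
  have hCLN : (C * L * N) ^ 2 ≤ (N / 2) ^ 2 := by
    refine pow_le_pow_left₀ (by positivity) ?_ 2
    nlinarith
  -- The components with bosons take at most N²/4 and y takes at most N²/16, so X² ≥ 11N²/16.
  have hX2 : (N / 2) ^ 2 ≤ X ^ 2 := by nlinarith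
  have hXN : N / 2 ≤ X := le_of_sq_le_sq hX2 hX0
  have hκb : κ ≤ 2 * F * C * L * L := by
    have h2 : κ * (N / 2) ≤ (2 * F * C * L * L) * (N / 2) := by
      calc κ * (N / 2) ≤ κ * X := by gcongr
        _ ≤ _ := hκX.trans h1
        _ = _ := by ring
    exact le_of_mul_le_mul_right h2 (by positivity)
  obtain ⟨a, ha0, haγ, hab⟩ := ha (by linarith)
  -- The main term εCN comes from ε n₁. Everything else is O(L) with coefficients independent of ε,
  -- and `hLε` lets another εCN absorb it.
  have h3 : ε * a ≤ 2 * (ε * C) * N := by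
    refine le_of_mul_le_mul_left ?_ hL
    calc L * (ε * a) ≤ L * (2 * (F * n₂) + F * y) + (κ + ε) * n₁ := hab
      _ ≤ L * (2 * (F * (C * L * N)) + F * (F * C / gap * L * L * N)) +
          (2 * F * C * L * L + ε) * (C * L * N) := by gcongr
      _ = L * ((2 * F * C * L + F * (F * C / gap) * L * L + 2 * F * C ^ 2 * L * L + ε * C) * N) := by
          ring
      _ ≤ L * ((2 * F * C * L + F * (F * C / gap) * L * 1 + 2 * F * C ^ 2 * L * 1 + ε * C) * N) := by
          gcongr
      _ = L * (((2 * F * C + F * (F * C / gap) + 2 * F * C ^ 2) * L + ε * C) * N) := by ring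
      _ ≤ L * ((ε * C + ε * C) * N) := by gcongr
      _ = _ := by ring
  have h4 : (ε * a) ^ 2 ≤ (2 * (ε * C) * N) ^ 2 := pow_le_pow_left₀ (by positivity) h3 2
  have h5 : γ * (N / 2) ^ 2 ≤ ε * a ^ 2 := (mul_le_mul_of_nonneg_left hX2 hγ.le).trans haγ
  -- The golden rule bounds a² below by a multiple of 1/ε, while the upper bound on εa is
  -- proportional to ε; comparing squares forces γ ≤ 16C²ε.
  have h6 : γ * (ε * N ^ 2) ≤ (16 * C ^ 2 * ε) * (ε * N ^ 2) := by
    have := mul_le_mul_of_nonneg_left h5 hε.le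
    nlinarith
  exact absurd (le_of_mul_le_mul_right h6 (by positivity)) (not_le.2 hεγ)

end PauliFierz

end

theorem theorem1p1 {d : ℕ} (hd : 0 < d)
    {𝒦 : Type*} [NormedAddCommGroup 𝒦] [InnerProductSpace ℂ 𝒦] [FiniteDimensional ℂ 𝒦]
    (K : 𝒦 →ₗ[ℂ] 𝒦) (hK : K.IsSymmetric)
    (α : 𝒦 →L[ℂ] PauliFierz.OneBoson 𝒦 d)
    (k : ℝ) (hk : Module.End.HasEigenvalue K (k : ℂ))
    (hk0 : ∃ k' : ℝ, k' < k ∧ Module.End.HasEigenvalue K (k' : ℂ))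
    (I : Set ℝ) (hI_open : IsOpen I) (hI_interval : I.OrdConnected) (hkI : k ∈ I)
    (hI : ∀ k' : ℝ, Module.End.HasEigenvalue K (k' : ℂ) → k' ∈ closure I → k' = k)
    (hFGR : PauliFierz.FermiGoldenRule K α k)
    (hI0 : PauliFierz.InvPowBounded (1 / 2) α)
    (hI1a : PauliFierz.RadiallyRegular α)
    (hI1b : ∃ a : ℝ, 1 < a ∧ PauliFierz.InvPowBounded a α) :
    ∃ lam0 : ℝ, 0 < lam0 ∧ ∀ lam : ℝ, 0 < |lam| → |lam| < lam0 →
      ∀ E : ℝ, E ∈ I → ¬ PauliFierz.IsEigenvalue (PauliFierz.hamiltonian K α lam) (E : ℂ) := by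
  open PauliFierz in
  obtain ⟨α', hder, -⟩ := hI1a
  obtain ⟨a, ha, β, hβ⟩ := hI1b
  have hinv : ∀ x, MemLp (oneRadial (fun r => r⁻¹) (α x)) 2 (lineSphere d) := fun x =>
    memLp_oneRadial_inv hd ha (hβ x)
  obtain ⟨gap, hgap, hgapI⟩ := exists_spectral_gap hK hkI hI
  obtain ⟨γ, hγ, hev⟩ := hFGR.exists_solution
  -- The summand 1 keeps C positive even if the radial norm vanishes.
  set C := 2 * radialNorm α α' + 1 with hC
  set F := formNorm α with hFdef
  have hB := radialNorm_nonneg α α'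
  have hF : 0 ≤ F := formNorm_nonneg α
  have hC0 : 0 < C := by positivity
  -- The golden rule is used at a single ε, fixed before λ; the threshold for the coupling below
  -- depends on this ε.
  obtain ⟨ε, hεsol, hε, hε1⟩ := (hev.and (Ioo_mem_nhdsGT
    (show (0 : ℝ) < γ / (16 * C ^ 2) by positivity))).exists
  have hεγ : 16 * C ^ 2 * ε < γ := by
    rw [lt_div_iff₀ (by positivity)] at hε1
    linarith
  have hlim : ∀ c b : ℝ, 0 < b → ∀ᶠ L in 𝓝[>] (0 : ℝ), c * L < b := fun c b hb => by
    have h1 : Tendsto (fun L : ℝ => c * L) (𝓝[>] 0) (𝓝 (c * 0)) :=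
      (tendsto_id.mono_left nhdsWithin_le_nhds).const_mul c
    rw [mul_zero] at h1
    exact h1.eventually_lt_const hb
  have hall := ((hlim 1 1 one_pos).and (hlim C (1 / 2) (by norm_num))).and
    ((hlim (4 * (F * C)) gap hgap).and
      (hlim (2 * F * C + F * (F * C / gap) + 2 * F * C ^ 2) (ε * C) (by positivity)))
  obtain ⟨lam0, hlam0, hsub⟩ := mem_nhdsGT_iff_exists_Ioo_subset.1 hall
  refine ⟨lam0, hlam0, fun lam hlam hlt E hE hEig => ?_⟩
  obtain ⟨ψ, hψ0, hψ⟩ := hEig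
  obtain ⟨⟨hL1, hLC⟩, hLgap, hLε⟩ := hsub ⟨hlam, hlt⟩
  have heq := eigenvector_equation hψ
  obtain ⟨Θ, hΘ⟩ := exists_fieldEnergy ψ
  have hN : 0 < ‖(ψ : FockSpace 𝒦 d)‖ := norm_pos_iff.2 fun h0 => hψ0 (Subtype.ext h0)
  have hnum : ∀ M : ℕ, ∑ n ∈ Finset.range M, ((n : ℝ) + 1) * ‖(ψ : FockSpace 𝒦 d) (n + 1)‖ ^ 2 ≤
      (C * |lam| * ‖(ψ : FockSpace 𝒦 d)‖) ^ 2 := fun M => by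
    refine (sum_number_le hd hK hder hinv heq hΘ M).trans (pow_le_pow_left₀ (by positivity) ?_ 2)
    rw [hC]
    gcongr
    linarith
  obtain ⟨hcomp, hnorm⟩ := bounds_of_sum_le (s := fun n => ‖(ψ : FockSpace 𝒦 d) n‖)
    (by positivity) (hasSum_norm_sq _) hnum
  obtain ⟨X, y, hX0, hy0, hsq, hy, hκX, hsol⟩ := eigenvector_estimate hK hlam hgap.le hε
    (fun i hi => hgapI i hi E hE) hεsol heq
  exact weak_coupling_contradiction hC0 hF hγ hgap hε hεγ hlam (by linarith) hLC.le (by linarith)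
    hLε.le hN hX0 hy0 (abs_nonneg _) (norm_nonneg _) (hcomp 0) (hcomp 1) hnorm hsq hy hκX hsol
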